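/- **Setting.** Let $n\ge 1$ and let $\Theta\subset\mathbb R^n$ be compact with $0$ in its interior. Let $H$ be a separable complex Hilbert space and let $a_\theta,b_\theta$ ($\theta\in\Theta$) be non-negative sesquilinear forms on $H$ such that $(u,\tilde u)_\theta:=a_\theta(u,\tilde u)+b_\theta(u,\tilde u)$ are uniformly equivalent inner products on $H$, with norms $\|\cdot\|_\theta$. Write $s[u]:=s(u,u)$ for a form $s$. Assume that for some $L_a>0$ $$|a_{\theta_1}(u,\tilde u)-a_{\theta_2}(u,\tilde u)|\le L_a|\theta_1-\theta_2|\,\|u\|_{\theta_1}\|\tilde u\|_{\theta_1}\qquad(u,\tilde u\in H,\ \theta_1,\theta_2\in\Theta).$$ Let $V_\theta:=\{v\in H: a_\theta[v]=0\}$, let $W_\theta$ be its $(\cdot,\cdot)_\theta$-orthogonal complement, and assume: * (H1) for every $\theta\in\Theta$ there is $\nu_\theta>0$ with $a_\theta[w]\ge\nu_\theta\|w\|_\theta^2$ for all $w\in W_\theta$; * (H2) there are a closed subspace $V_\star\subset H$ and $L_\star\ge 0$ such that, with $V^\star_\theta:=V_\theta$ for $\theta\ne0$ and $V^\star_0:=V_\star$,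 one has $\inf_{v_2\in V^\star_{\theta_2}}\|v_1-v_2\|_{\theta_2}\le L_\star|\theta_1-\theta_2|\,\|v_1\|_{\theta_1}$ for all $v_1\in V^\star_{\theta_1}$, $\theta_1,\theta_2\in\Theta$; * (H3) there is $\gamma>0$ with $a_\theta[w]\ge\gamma|\theta|^2\|w\|^2_\theta$ for all $w\in W_\theta$, $\theta\in\Theta$; * (H4) there are sesquilinear maps $a_0':V_0\times H\to\mathbb C^n$ and $a_0'':V_0\times V_0\to\mathbb C^{n\times n}$ and constants $K',K''\ge0$ with $|a_\theta(v,u)-a_0'(v,u)\cdot\theta|\le K'|\theta|^2\|v\|_0\|u\|_0$ and $|a_\theta(v,\tilde v)-a_0''(v,\tilde v)\theta\cdot\theta|\le K''|\theta|^3\|v\|_0\|\tilde v\|_0$ for all $v,\tilde v\in V_0$, $u\in H$, $\theta\in\Theta$. Let $Z\subset V_0$ be a closed subspace with $V_0=V_\star\dotplus Z$ and $|(v,z)_0|\le K_Z\|v\|_0\|z\|_0$ for all $v\in V_\star$, $z\in Z$, for some $K_Z\in[0,1)$. Let $H$ be compactly and densely embedded in a separable complex Hilbert space $\mathcal H$ with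 inner product $d_0$, with $d_0[u]\le b_0[u]$ for all $u\in H$. Closures $\overline{V_0},\overline{V_\star},\overline Z$ of subspaces are taken in $\mathcal H$. For $\xi\in\mathbb R^n$ and $v\in V_0$ let $N_\xi v\in W_0$ be the unique solution of $a_0(N_\xi v,w)=-a_0'(v,w)\cdot\xi$ for all $w\in W_0$, and put $a^{\rm h}_\xi(v,\tilde v):=a_0''(v,\tilde v)\xi\cdot\xi-a_0(N_\xi v,N_\xi\tilde v)$ on $V_0$. Let * $\mathbb L_\xi$ be the self-adjoint operator in $(\overline{V_0},d_0)$ generated by the form $\mathbb S_\xi(v+z,\tilde v+\tilde z):=a^{\rm h}_\xi(z,\tilde z)+b_0(v+z,\tilde v+\tilde z)$ with form domain $V_\star\dotplus Z=V_0$; * $\mathbf B_0$ and $\mathbf B_\star$ be the self-adjoint operators in $(\overline{V_0},d_0)$ and $(\overline{V_\star},d_0)$ generated by $b_0$ with form domains $V_0$ and $V_\star$, respectively. The limit collective spectrum is $\mathrm{Sp}_0:=\overline{\bigcup_{\xi\in\mathbb R^n}\mathrm{Sp}\,\mathbb L_\xi}$. **Theorem.** 1. The eigenvalues $\lambda_0^{(k)}$,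 $1\le k$ ($k\le\dim V_0$ if $\dim V_0<\infty$), of $\mathbf B_0$, which are also those of $\mathbb L_0$, and the eigenvalues $\lambda_\star^{(k)}$, $1\le k$ ($k\le\dim V_\star$ if $\dim V_\star<\infty$), of $\mathbf B_\star$ are real and can be listed in ascending order accounting for multiplicities. One has $\lambda_0^{(k)}\le\lambda_\star^{(k)}$ for all $k$ if $\dim V_\star=\infty$, and for all $k\le\dim V_\star$ otherwise. If $Z\neq\{0\}$, then $$\mathrm{Sp}_0=\bigcup_{k=1}^\infty\big[\lambda_0^{(k)},\lambda_\star^{(k)}\big]\quad\text{if }\dim V_\star=\infty,$$ $$\mathrm{Sp}_0=\bigcup_{k=1}^N\big[\lambda_0^{(k)},\lambda_\star^{(k)}\big]\cup\big[\lambda_0^{(N+1)},+\infty\big)\quad\text{if }N:=\dim V_\star<\infty.$$ 2. Suppose in addition that $Z$ is chosen so that $b_0(z,v)=d_0(z,v)$ for all $z\in Z$, $v\in V_\star$. For real $\lambda\notin\mathrm{Sp}\,\mathbf B_\star$ let $\beta(\lambda):\overline Z\to\overline Z$ be the bounded operator $$\beta(\lambda):=\lambda I+(\lambda-1)^2\,\mathcal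 P_{\overline Z}\,(\mathbf B_\star-\lambda I)^{-1}\mathcal P_{\overline{V_\star}},$$ where $\mathcal P$ denotes $d_0$-orthogonal projections, and let $\beta_\lambda(z,\tilde z):=-b_0(z,\tilde z)+d_0(\beta(\lambda)z,\tilde z)$ on $Z$. Then $$\mathrm{Sp}_0=\big\{\lambda\in\mathbb R\setminus\mathrm{Sp}\,\mathbf B_\star:\ \beta_\lambda[z]\ge0\ \text{for some } 0\ne z\in Z\big\}\ \cup\ \mathrm{Sp}\,\mathbf B_\star .$$ -/

import Mathlib

open scoped ComplexOrder InnerProductSpace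

noncomputable section

/-! ### Non-negative sesquilinear forms

Sesquilinear forms are linear in the first and antilinear in the second argument. -/

/-- A non-negative sesquilinear form on a complex vector space: `form u u` is real and `≥ 0`
(the order on `ℂ` is the one for which `0 ≤ w` means that `w` is real and non-negative). -/
structure NonnegForm (H : Type*) [AddCommGroup H] [Module ℂ H] where
  form : H →ₗ[ℂ] H →ₗ⋆[ℂ] ℂ
  nonneg : ∀ u : H, 0 ≤ form u u

namespace NonnegForm

variable {H : Type*} [AddCommGroup H] [Module ℂ H]

theorem conj_symm (s : NonnegForm H) (u v : H) :
    (starRingEnd ℂ) (s.form u v) = s.form v u := by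
  have im0 : ∀ x : H, (s.form x x).im = 0 := fun x => ((Complex.nonneg_iff).1 (s.nonneg x)).2.symm
  have h1 := im0 (u + v)
  have h2 := im0 (u + Complex.I • v)
  simp only [map_add, LinearMap.add_apply, map_smul, LinearMap.smul_apply, LinearMap.map_smulₛₗ,
    smul_eq_mul, Complex.add_im, Complex.mul_im, Complex.I_re, Complex.I_im, Complex.conj_I,
    Complex.neg_re, Complex.neg_im, Complex.add_re, Complex.mul_re, im0] at h1 h2
  apply Complex.ext
  · simp only [Complex.conj_re]
    linarith
  · simp only [Complex.conj_im]
    linarith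

/-- The semi-inner product `⟪u, v⟫ = s(v, u)` in Mathlib's convention. -/
abbrev core (s : NonnegForm H) : PreInnerProductSpace.Core ℂ H where
  inner u v := s.form v u
  conj_inner_symm u v := s.conj_symm u v
  re_inner_nonneg u := ((Complex.nonneg_iff).1 (s.nonneg u)).1
  add_left u v w := by simp
  smul_left u v r := by simp

theorem norm_sq_le (s : NonnegForm H) (u v : H) :
    ‖s.form u v‖ ^ 2 ≤ (s.form u u).re * (s.form v v).re := by
  have h := @InnerProductSpace.Core.inner_mul_inner_self_le ℂ H _ _ _ s.core v u
  have h' : ‖s.form u v‖ * ‖s.form v u‖ ≤ (s.form v v).re * (s.form u u).re := h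
  have h3 : ‖s.form v u‖ = ‖s.form u v‖ := by rw [← s.conj_symm u v, RCLike.norm_conj]
  rw [h3] at h'
  nlinarith

theorem apply_eq_zero (s : NonnegForm H) {v : H} (hv : s.form v v = 0) (u : H) :
    s.form v u = 0 := by
  have h := s.norm_sq_le v u
  rw [hv, Complex.zero_re, zero_mul] at h
  have h2 : ‖s.form v u‖ = 0 := by nlinarith [norm_nonneg (s.form v u)]
  exact norm_eq_zero.1 h2

/-- The null space `{v | s[v] = 0}` of a non-negative form. -/
def nullSpace (s : NonnegForm H) : Submodule ℂ H where
  carrier := {v | s.form v v = 0}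
  zero_mem' := by simp
  add_mem' := by
    intro u v hu hv
    simp only [Set.mem_ofPred_eq] at hu hv ⊢
    simp [s.apply_eq_zero hu, s.apply_eq_zero hv]
  smul_mem' := by
    intro c v hv
    simp only [Set.mem_ofPred_eq] at hv ⊢
    simp [hv]

/-- The sum of two non-negative forms. -/
def add (a b : NonnegForm H) : NonnegForm H where
  form := a.form + b.form
  nonneg u := by
    simpa using add_nonneg (a.nonneg u) (b.nonneg u)

/-- The norm `s[u] ^ (1/2)` of a non-negative form. -/
def norm (s : NonnegForm H) (u : H) : ℝ := √((s.form u u).re)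

/-- The orthogonal complement of a subspace with respect to a form. -/
def orthCompl (s : NonnegForm H) (V : Submodule ℂ H) : Submodule ℂ H where
  carrier := {w | ∀ v ∈ V, s.form w v = 0}
  zero_mem' := by simp
  add_mem' := by
    intro u w hu hw v hv
    simp [hu v hv, hw v hv]
  smul_mem' := by
    intro c w hw v hv
    simp [hw v hv]

theorem norm_sq (s : NonnegForm H) (u : H) : s.norm u ^ 2 = (s.form u u).re :=
  Real.sq_sqrt ((Complex.nonneg_iff).1 (s.nonneg u)).1

theorem norm_nonneg' (s : NonnegForm H) (u : H) : 0 ≤ s.norm u := Real.sqrt_nonneg _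

theorem norm_apply_le (s : NonnegForm H) (u v : H) : ‖s.form u v‖ ≤ s.norm u * s.norm v := by
  have h := s.norm_sq_le u v
  rw [← s.norm_sq, ← s.norm_sq, ← mul_pow] at h
  exact le_of_sq_le_sq h (mul_nonneg (s.norm_nonneg' u) (s.norm_nonneg' v))

theorem re_le_add_re (a b : NonnegForm H) (u : H) :
    (a.form u u).re ≤ ((a.add b).form u u).re := by
  have := ((Complex.nonneg_iff).1 (b.nonneg u)).1
  simp [add]
  exact this

theorem norm_le_add_norm (a b : NonnegForm H) (u : H) : a.norm u ≤ (a.add b).norm u :=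
  Real.sqrt_le_sqrt (re_le_add_re a b u)

end NonnegForm

/-- A bounded non-negative form which is coercive on a closed subspace `W` of a Hilbert space is
uniquely solvable on `W` for bounded antilinear right-hand sides. -/
theorem NonnegForm.existsUnique_solution {H : Type*} [NormedAddCommGroup H]
    [InnerProductSpace ℂ H] [CompleteSpace H] (s : NonnegForm H) (W : Submodule ℂ H)
    (hW : IsClosed (W : Set H)) (C c : ℝ) (hc : 0 < c)
    (hbdd : ∀ u v : H, ‖s.form u v‖ ≤ C * ‖u‖ * ‖v‖)
    (hcoer : ∀ w ∈ W, c * ‖w‖ ^ 2 ≤ (s.form w w).re)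
    (l : H →ₗ⋆[ℂ] ℂ) (D : ℝ) (hl : ∀ u : H, ‖l u‖ ≤ D * ‖u‖) :
    ∃! w : W, ∀ x ∈ W, s.form w x = l x := by
  have : CompleteSpace W := hW.completeSpace_coe
  -- the form as an operator on `W`
  let B0 : W →ₗ⋆[ℂ] W →ₗ[ℂ] ℂ := LinearMap.mk₂'ₛₗ (starRingEnd ℂ) (RingHom.id ℂ)
    (fun u v => s.form v u) (by intros; simp) (by intros; simp) (by intros; simp)
    (by intros; simp)
  let B : W →L⋆[ℂ] W →L[ℂ] ℂ := B0.mkContinuous₂ C (by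
    intro u v
    have h := hbdd v u
    change ‖s.form v u‖ ≤ C * ‖(u : H)‖ * ‖(v : H)‖
    linarith)
  let T : W →L[ℂ] W := InnerProductSpace.continuousLinearMapOfBilin B
  have hT : ∀ u v : W, ⟪T u, v⟫_ℂ = s.form v u := fun u v =>
    InnerProductSpace.continuousLinearMapOfBilin_apply B u v
  have hlow : ∀ u : W, c * ‖u‖ ≤ ‖T u‖ := by
    intro u
    rcases eq_or_ne u 0 with rfl | hu
    · simp
    have hpos : 0 < ‖u‖ := norm_pos_iff.2 hu
    have h1 : c * ‖u‖ ^ 2 ≤ ‖T u‖ * ‖u‖ := by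
      calc c * ‖u‖ ^ 2 ≤ (s.form u u).re := hcoer u u.2
        _ ≤ ‖s.form (u : H) u‖ := Complex.re_le_norm _
        _ = ‖⟪T u, u⟫_ℂ‖ := by rw [hT]
        _ ≤ ‖T u‖ * ‖u‖ := norm_inner_le_norm _ _
    nlinarith
  have hanti : AntilipschitzWith (Real.toNNReal c⁻¹) T := by
    refine ContinuousLinearMap.antilipschitz_of_bound T fun u => ?_
    rw [Real.coe_toNNReal _ (inv_pos.2 hc).le, ← div_eq_inv_mul, le_div_iff₀ hc]
    linarith [hlow u]
  have hclosed : IsClosed (T.range : Set W) := hanti.isClosed_range T.uniformContinuous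
  have hrange : T.range = ⊤ := by
    have := hclosed.completeSpace_coe
    rw [← T.range.orthogonal_orthogonal, Submodule.eq_top_iff']
    intro v w hw
    have h0 : s.form (w : H) w = 0 := by
      rw [← hT]
      exact hw _ ⟨w, rfl⟩
    have h1 := hcoer w w.2
    rw [h0, Complex.zero_re] at h1
    have h2 : ‖(w : H)‖ ^ 2 ≤ 0 := by
      by_contra h
      push Not at h
      nlinarith [mul_pos hc h]
    have h3 : (w : H) = 0 := by
      have : ‖(w : H)‖ = 0 := by nlinarith [norm_nonneg (w : H)]
      exact norm_eq_zero.1 this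
    have h4 : w = 0 := Subtype.ext h3
    simp [h4]
  -- the right-hand side, by the Riesz representation theorem
  let l0 : W →ₗ[ℂ] ℂ :=
    { toFun := fun x => (starRingEnd ℂ) (l x)
      map_add' := by intros; simp
      map_smul' := by intros; simp }
  let l1 : W →L[ℂ] ℂ := l0.mkContinuous D (by
    intro x
    change ‖(starRingEnd ℂ) (l x)‖ ≤ D * ‖(x : H)‖
    rw [RCLike.norm_conj]
    exact hl x)
  obtain ⟨w, hw⟩ : ∃ w, T w = (InnerProductSpace.toDual ℂ W).symm l1 := by
    have : (InnerProductSpace.toDual ℂ W).symm l1 ∈ T.range := by rw [hrange]; trivial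
    exact this
  have hsol : ∀ x ∈ W, s.form w x = l x := by
    intro x hx
    have h1 : s.form x w = (starRingEnd ℂ) (l x) := by
      have := hT w ⟨x, hx⟩
      rw [hw, InnerProductSpace.toDual_symm_apply] at this
      exact this.symm
    rw [← s.conj_symm, h1, Complex.conj_conj]
  refine ⟨w, hsol, ?_⟩
  intro w' hw'
  have h0 : s.form ((w' - w : W) : H) ((w' - w : W) : H) = 0 := by
    have e1 := hw' _ (w' - w).2
    have e2 := hsol _ (w' - w).2
    have : s.form ((w' - w : W) : H) ((w' - w : W) : H)
        = s.form w' ((w' - w : W) : H) - s.form w ((w' - w : W) : H) := by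
      rw [← LinearMap.sub_apply, ← map_sub]
      rfl
    rw [this, e1, e2, sub_self]
  have h1 := hcoer _ (w' - w).2
  rw [h0, Complex.zero_re] at h1
  have h2 : ‖((w' - w : W) : H)‖ = 0 := by
    by_contra h
    have : 0 < ‖((w' - w : W) : H)‖ ^ 2 := by positivity
    nlinarith [mul_pos hc this]
  exact sub_eq_zero.1 (Subtype.ext (norm_eq_zero.1 h2))

/-! ### Operators generated by forms, their spectra and eigenvalues -/

section FormOperators

variable {Q E : Type*} [AddCommGroup Q] [Module ℂ Q] [NormedAddCommGroup E]
  [InnerProductSpace ℂ E]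

/-- The Hilbert space in which a form with form domain `Q`, placed in `E` by `j`, acts: the
closure of `j(Q)` in `E`. -/
abbrev formSpace (j : Q →ₗ[ℂ] E) : Submodule ℂ E := (LinearMap.range j).topologicalClosure

/-- The graph of the operator generated by a sesquilinear form `s` with form domain `Q`: all pairs
`(j q, f)`, with `f` in the closure of `j(Q)`, such that `s(q, q') = (f, j q')` for all `q' ∈ Q`,
where `(·,·)` is the inner product of `E` (linear in the first argument). -/
def formGraph (j : Q →ₗ[ℂ] E) (s : Q →ₗ[ℂ] Q →ₗ⋆[ℂ] ℂ) :
    Submodule ℂ (formSpace j × formSpace j) where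
  carrier := {p | ∃ q : Q, j q = p.1 ∧ ∀ q' : Q, s q q' = ⟪j q', (p.2 : E)⟫_ℂ}
  zero_mem' := ⟨0, by simp, by simp⟩
  add_mem' := by
    rintro p₁ p₂ ⟨q₁, h₁, k₁⟩ ⟨q₂, h₂, k₂⟩
    refine ⟨q₁ + q₂, by simp [h₁, h₂], fun q' => ?_⟩
    simp [k₁ q', k₂ q']
  smul_mem' := by
    rintro c p ⟨q, h, k⟩
    refine ⟨c • q, by simp [h], fun q' => ?_⟩
    simp [k q']

/-- The operator generated by the sesquilinear form `s` with form domain `Q`, as an unbounded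
operator in the closure of `j(Q)` in `E`. -/
def formOperator (j : Q →ₗ[ℂ] E) (s : Q →ₗ[ℂ] Q →ₗ⋆[ℂ] ℂ) :
    formSpace j →ₗ.[ℂ] formSpace j :=
  (formGraph j s).toLinearPMap

/-- If `j` is injective, then `formGraph` is single-valued, so it is the graph of
`formOperator`. -/
theorem formOperator_graph (j : Q →ₗ[ℂ] E) (hj : Function.Injective j)
    (s : Q →ₗ[ℂ] Q →ₗ⋆[ℂ] ℂ) : (formOperator j s).graph = formGraph j s := by
  refine Submodule.toLinearPMap_graph_eq _ ?_
  rintro ⟨u, f⟩ ⟨q, hq, hs⟩ hu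
  simp only at hq hs hu ⊢
  have hq0 : q = 0 := hj (by rw [hq, hu, map_zero]; rfl)
  have horth : ∀ x ∈ LinearMap.range j, ⟪x, (f : E)⟫_ℂ = 0 := by
    rintro _ ⟨q', rfl⟩
    rw [← hs q', hq0]
    simp
  have hclosed : IsClosed {x : E | ⟪x, (f : E)⟫_ℂ = 0} :=
    isClosed_eq (by fun_prop) continuous_const
  have hf : (f : E) ∈ {x : E | ⟪x, (f : E)⟫_ℂ = 0} :=
    closure_minimal horth hclosed f.2
  exact Subtype.ext (inner_self_eq_zero.1 hf)

end FormOperators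

section Spectrum

variable {E : Type*} [NormedAddCommGroup E] [InnerProductSpace ℂ E]

/-- `R` is the resolvent `(T - μ)⁻¹`: a bounded everywhere defined two-sided inverse. -/
def IsResolventAt (T : E →ₗ.[ℂ] E) (μ : ℂ) (R : E →L[ℂ] E) : Prop :=
  (∀ x : E, ∃ h : R x ∈ T.domain, T ⟨R x, h⟩ - μ • R x = x) ∧
    ∀ y : T.domain, R (T y - μ • (y : E)) = y

/-- The spectrum of an unbounded operator. -/
def opSpectrum (T : E →ₗ.[ℂ] E) : Set ℂ := {μ | ¬ ∃ R : E →L[ℂ] E, IsResolventAt T μ R}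

open Classical in
/-- The resolvent operator `(T - μ)⁻¹` for `μ` outside the spectrum (and `0` otherwise). -/
def opResolvent (T : E →ₗ.[ℂ] E) (μ : ℂ) : E →L[ℂ] E :=
  if h : ∃ R : E →L[ℂ] E, IsResolventAt T μ R then h.choose else 0

/-- The eigenspace `ker (T - μ)`. -/
def opEigenspace (T : E →ₗ.[ℂ] E) (μ : ℂ) : Submodule ℂ T.domain :=
  LinearMap.ker (T.toFun - μ • T.domain.subtype)

/-- The dimension of a vector space, with value `⊤` if it is infinite. -/
def edim (V : Type*) [AddCommGroup V] [Module ℂ V] : ℕ∞ := Cardinal.toENat (Module.rank ℂ V)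

/-- `ev 0 ≤ ev 1 ≤ …` (all `ev k` with `k < N`) are the eigenvalues of `T`, listed in ascending
order and repeated according to multiplicity. -/
structure IsEigenvalueList (T : E →ₗ.[ℂ] E) (N : ℕ∞) (ev : ℕ → ℝ) : Prop where
  mono : ∀ j k : ℕ, j ≤ k → (k : ℕ∞) < N → ev j ≤ ev k
  mult : ∀ μ : ℂ, {k : ℕ | (k : ℕ∞) < N ∧ (ev k : ℂ) = μ}.encard = edim (opEigenspace T μ)

end Spectrum

/-! ### The abstract problem -/

open Classical in
/-- The null spaces `V_θ = {v | a_θ[v] = 0}` for `θ ≠ 0`, continued by `V_⋆` to `θ = 0`. -/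
def starFamily {n : ℕ} {H : Type*} [AddCommGroup H] [Module ℂ H]
    (a : EuclideanSpace ℝ (Fin n) → NonnegForm H) (Vstar : Submodule ℂ H)
    (θ : EuclideanSpace ℝ (Fin n)) : Submodule ℂ H :=
  if θ = 0 then Vstar else (a θ).nullSpace

/-- The data and the standing assumptions of the abstract degenerating problem. The inner product
of `𝓗` is `d₀`, that is `d₀(u, v) = ⟪v, u⟫`. The values of `a θ` and `b θ` for `θ ∉ Θ` play no
role. -/
structure DegenerateProblem (n : ℕ) (H 𝓗 : Type*) [NormedAddCommGroup H] [InnerProductSpace ℂ H]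
    [NormedAddCommGroup 𝓗] [InnerProductSpace ℂ 𝓗] where
  /-- the parameter set -/
  Θ : Set (EuclideanSpace ℝ (Fin n))
  isCompact_Θ : IsCompact Θ
  zero_mem_interior : (0 : EuclideanSpace ℝ (Fin n)) ∈ interior Θ
  /-- the singular forms -/
  a : EuclideanSpace ℝ (Fin n) → NonnegForm H
  /-- the regular forms -/
  b : EuclideanSpace ℝ (Fin n) → NonnegForm H
  /-- `(·,·)_θ = a_θ + b_θ` are uniformly equivalent inner products of the Hilbert space `H` -/
  norm_equiv : ∃ K : ℝ, 0 < K ∧ ∀ θ ∈ Θ, ∀ u : H,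
    ‖u‖ ≤ K * ((a θ).add (b θ)).norm u ∧ ((a θ).add (b θ)).norm u ≤ K * ‖u‖
  /-- Lipschitz continuity of `a` -/
  a_lipschitz : ∃ L : ℝ, 0 < L ∧ ∀ θ₁ ∈ Θ, ∀ θ₂ ∈ Θ, ∀ u v : H,
    ‖(a θ₁).form u v - (a θ₂).form u v‖ ≤
      L * ‖θ₁ - θ₂‖ * ((a θ₁).add (b θ₁)).norm u * ((a θ₁).add (b θ₁)).norm v
  /-- (H1): the gap condition, `W_θ` being the `(·,·)_θ`-orthogonal complement of
  `V_θ = {v | a_θ[v] = 0}` -/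
  gap : ∀ θ ∈ Θ, ∃ ν : ℝ, 0 < ν ∧ ∀ w ∈ ((a θ).add (b θ)).orthCompl (a θ).nullSpace,
    ν * ((a θ).add (b θ)).norm w ^ 2 ≤ ((a θ).form w w).re
  /-- the subspace `V_⋆` -/
  Vstar : Submodule ℂ H
  isClosed_Vstar : IsClosed (Vstar : Set H)
  /-- (H2): `V_θ` for `θ ≠ 0`, continued by `V_⋆` to `θ = 0`, is Lipschitz continuous -/
  removable : ∃ L : ℝ, 0 ≤ L ∧ ∀ θ₁ ∈ Θ, ∀ θ₂ ∈ Θ, ∀ v₁ ∈ starFamily a Vstar θ₁,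
      ⨅ v₂ : starFamily a Vstar θ₂, ((a θ₂).add (b θ₂)).norm (v₁ - v₂) ≤
        L * ‖θ₁ - θ₂‖ * ((a θ₁).add (b θ₁)).norm v₁
  /-- (H3): the gap degenerates at most quadratically -/
  quadratic_gap : ∃ γ : ℝ, 0 < γ ∧ ∀ θ ∈ Θ,
    ∀ w ∈ ((a θ).add (b θ)).orthCompl (a θ).nullSpace,
      γ * ‖θ‖ ^ 2 * ((a θ).add (b θ)).norm w ^ 2 ≤ ((a θ).form w w).re
  /-- the sesquilinear map `a₀' : V₀ × H → ℂⁿ` -/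
  a₁ : (a 0).nullSpace →ₗ[ℂ] H →ₗ⋆[ℂ] (Fin n → ℂ)
  /-- the sesquilinear map `a₀'' : V₀ × V₀ → ℂⁿˣⁿ` -/
  a₂ : (a 0).nullSpace →ₗ[ℂ] (a 0).nullSpace →ₗ⋆[ℂ] Matrix (Fin n) (Fin n) ℂ
  /-- (H4), first order -/
  diff_one : ∃ K : ℝ, 0 ≤ K ∧ ∀ (v : (a 0).nullSpace) (u : H), ∀ θ ∈ Θ,
    ‖(a θ).form v u - ∑ i, a₁ v u i * (θ i : ℂ)‖ ≤
      K * ‖θ‖ ^ 2 * ((a 0).add (b 0)).norm v * ((a 0).add (b 0)).norm u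
  /-- (H4), second order -/
  diff_two : ∃ K : ℝ, 0 ≤ K ∧ ∀ v w : (a 0).nullSpace, ∀ θ ∈ Θ,
    ‖(a θ).form v w - ∑ i, ∑ j, a₂ v w i j * (θ j : ℂ) * (θ i : ℂ)‖ ≤
      K * ‖θ‖ ^ 3 * ((a 0).add (b 0)).norm v * ((a 0).add (b 0)).norm w
  /-- the defect subspace -/
  Z : Submodule ℂ H
  isClosed_Z : IsClosed (Z : Set H)
  /-- `V₀` is the direct sum of `V_⋆` and `Z` -/
  sup_eq : Vstar ⊔ Z = (a 0).nullSpace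
  inf_eq : Vstar ⊓ Z = ⊥
  /-- the sum is transversal -/
  transversal : ∃ K : ℝ, 0 ≤ K ∧ K < 1 ∧ ∀ v ∈ Vstar, ∀ z ∈ Z,
    ‖((a 0).add (b 0)).form v z‖ ≤
      K * ((a 0).add (b 0)).norm v * ((a 0).add (b 0)).norm z
  /-- the compact dense embedding of `H` into `𝓗` -/
  emb : H →L[ℂ] 𝓗
  emb_injective : Function.Injective emb
  emb_denseRange : DenseRange emb
  emb_compact : IsCompactOperator emb
  /-- `d₀[u] ≤ b₀[u]` -/
  d_le_b : ∀ u : H, ‖emb u‖ ^ 2 ≤ ((b 0).form u u).re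

namespace DegenerateProblem

variable {n : ℕ} {H 𝓗 : Type*} [NormedAddCommGroup H] [InnerProductSpace ℂ H]
  [NormedAddCommGroup 𝓗] [InnerProductSpace ℂ 𝓗] (P : DegenerateProblem n H 𝓗)

/-- `V₀ = {v | a₀[v] = 0}`. -/
abbrev V₀ : Submodule ℂ H := (P.a 0).nullSpace

/-- The inner product `(·,·)₀ = a₀ + b₀`. -/
abbrev ip₀ : NonnegForm H := (P.a 0).add (P.b 0)

/-- `W₀`, the `(·,·)₀`-orthogonal complement of `V₀`. -/
abbrev W₀ : Submodule ℂ H := P.ip₀.orthCompl P.V₀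

theorem zero_mem : (0 : EuclideanSpace ℝ (Fin n)) ∈ P.Θ := interior_subset P.zero_mem_interior

theorem exists_bound : ∃ K : ℝ, 0 < K ∧ ∀ θ ∈ P.Θ, ∀ u v : H,
    ‖(P.a θ).form u v‖ ≤ K * ‖u‖ * ‖v‖ ∧ ‖((P.a θ).add (P.b θ)).form u v‖ ≤ K * ‖u‖ * ‖v‖ := by
  obtain ⟨K, hK, h⟩ := P.norm_equiv
  refine ⟨K * K, by positivity, fun θ hθ u v => ?_⟩
  have key : ((P.a θ).add (P.b θ)).norm u * ((P.a θ).add (P.b θ)).norm v ≤ K * K * ‖u‖ * ‖v‖ := by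
    calc _ ≤ (K * ‖u‖) * (K * ‖v‖) :=
          mul_le_mul (h θ hθ u).2 (h θ hθ v).2 (NonnegForm.norm_nonneg' _ _) (by positivity)
      _ = _ := by ring
  refine ⟨?_, (NonnegForm.norm_apply_le _ u v).trans key⟩
  refine ((P.a θ).norm_apply_le u v).trans (le_trans ?_ key)
  exact mul_le_mul (NonnegForm.norm_le_add_norm _ _ _) (NonnegForm.norm_le_add_norm _ _ _)
    (NonnegForm.norm_nonneg' _ _) (NonnegForm.norm_nonneg' _ _)

theorem isClosed_W₀ : IsClosed (P.W₀ : Set H) := by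
  obtain ⟨K, hK, h⟩ := P.exists_bound
  have : (P.W₀ : Set H) = ⋂ v ∈ P.V₀, {w : H | P.ip₀.form w v = 0} := by
    ext w
    simp only [Set.mem_iInter]
    exact Iff.rfl
  rw [this]
  refine isClosed_biInter fun v _ => ?_
  let f : H →L[ℂ] ℂ := (P.ip₀.form.flip v).mkContinuous (K * ‖v‖) (fun w => by
    have := (h 0 P.zero_mem w v).2
    change ‖P.ip₀.form w v‖ ≤ _
    linarith)
  exact isClosed_eq f.continuous continuous_const

/-- The first-order form `a₀'(v, ·) · ξ` as an antilinear functional. -/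
def firstOrder (ξ : EuclideanSpace ℝ (Fin n)) (v : P.V₀) : H →ₗ⋆[ℂ] ℂ where
  toFun u := ∑ i, P.a₁ v u i * (ξ i : ℂ)
  map_add' u w := by simp [add_mul, Finset.sum_add_distrib]
  map_smul' c u := by simp [mul_assoc, Finset.mul_sum]

theorem firstOrder_bound (ξ : EuclideanSpace ℝ (Fin n)) (v : P.V₀) :
    ∃ D : ℝ, ∀ u : H, ‖P.firstOrder ξ v u‖ ≤ D * ‖u‖ := by
  obtain ⟨K, hK, hb⟩ := P.exists_bound
  obtain ⟨M, hM, hn⟩ := P.norm_equiv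
  obtain ⟨C, hC, hd⟩ := P.diff_one
  obtain ⟨t, ht, hmem⟩ : ∃ t : ℝ, 0 < t ∧ t • ξ ∈ P.Θ := by
    have hcont : Filter.Tendsto (fun t : ℝ => t • ξ) (nhdsWithin 0 (Set.Ioi 0)) (nhds 0) := by
      have : Continuous fun t : ℝ => t • ξ := by fun_prop
      have h := this.tendsto 0
      rw [zero_smul] at h
      exact h.mono_left nhdsWithin_le_nhds
    have h1 := hcont.eventually (mem_interior_iff_mem_nhds.1 P.zero_mem_interior)
    obtain ⟨t, h2, h3⟩ := (h1.and self_mem_nhdsWithin).exists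
    exact ⟨t, h3, h2⟩
  refine ⟨t⁻¹ * (K * ‖(v : H)‖ + C * ‖t • ξ‖ ^ 2 * P.ip₀.norm v * M), fun u => ?_⟩
  have h1 := hd v u _ hmem
  have h2 := (hb _ hmem v u).1
  have h3 := (hn 0 P.zero_mem u).2
  have e : ∑ i, P.a₁ v u i * (((t • ξ) i : ℝ) : ℂ) = (t : ℂ) * P.firstOrder ξ v u := by
    simp only [firstOrder, LinearMap.coe_mk, AddHom.coe_mk, Finset.mul_sum]
    refine Finset.sum_congr rfl fun i _ => ?_
    simp
    ring
  rw [e] at h1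
  have h4 : ‖(t : ℂ) * P.firstOrder ξ v u‖ ≤
      K * ‖(v : H)‖ * ‖u‖ + C * ‖t • ξ‖ ^ 2 * P.ip₀.norm v * P.ip₀.norm u := by
    have := norm_sub_norm_le ((t : ℂ) * P.firstOrder ξ v u) ((P.a (t • ξ)).form v u)
    rw [norm_sub_rev] at this
    linarith
  have h5 : C * ‖t • ξ‖ ^ 2 * P.ip₀.norm v * P.ip₀.norm u ≤
      C * ‖t • ξ‖ ^ 2 * P.ip₀.norm v * (M * ‖u‖) := by
    refine mul_le_mul_of_nonneg_left h3 ?_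
    have := P.ip₀.norm_nonneg' v
    positivity
  rw [norm_mul, Complex.norm_real, Real.norm_of_nonneg ht.le] at h4
  rw [mul_assoc, ← div_eq_inv_mul, le_div_iff₀ ht]
  linarith

/-- The linearised cell problem: for `v ∈ V₀` there is a unique `w ∈ W₀` with
`a₀(w, x) = - a₀'(v, x) · ξ` for all `x ∈ W₀`. -/
theorem existsUnique_corrector [CompleteSpace H] (ξ : EuclideanSpace ℝ (Fin n)) (v : P.V₀) :
    ∃! w : P.W₀, ∀ x ∈ P.W₀, (P.a 0).form w x = (-P.firstOrder ξ v) x := by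
  obtain ⟨K, hK, hb⟩ := P.exists_bound
  obtain ⟨M, hM, hn⟩ := P.norm_equiv
  obtain ⟨ν, hν, hg⟩ := P.gap 0 P.zero_mem
  obtain ⟨D, hD⟩ := P.firstOrder_bound ξ v
  refine (P.a 0).existsUnique_solution P.W₀ P.isClosed_W₀ K (ν / M ^ 2) (by positivity)
    (fun u w => (hb 0 P.zero_mem u w).1) (fun w hw => ?_) _ D (fun u => by simpa using hD u)
  refine le_trans ?_ (hg w hw)
  have h1 := (hn 0 P.zero_mem w).1
  rw [div_mul_eq_mul_div, div_le_iff₀ (by positivity)]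
  calc ν * ‖w‖ ^ 2 ≤ ν * (M * P.ip₀.norm w) ^ 2 := by gcongr
    _ = _ := by ring

/-- The corrector `N_ξ : V₀ → W₀`, the solution operator of the linearised cell problem
`a₀(N_ξ v, x) = - a₀'(v, x) · ξ` for all `x ∈ W₀`. -/
def corrector [CompleteSpace H] (ξ : EuclideanSpace ℝ (Fin n)) : P.V₀ →ₗ[ℂ] P.W₀ where
  toFun v := (P.existsUnique_corrector ξ v).choose
  map_add' v w := by
    refine ((P.existsUnique_corrector ξ (v + w)).choose_spec.2 _ fun x hx => ?_).symm
    have h1 := (P.existsUnique_corrector ξ v).choose_spec.1 x hx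
    have h2 := (P.existsUnique_corrector ξ w).choose_spec.1 x hx
    simp only [Submodule.coe_add, map_add, LinearMap.add_apply, h1, h2]
    simp [firstOrder, add_mul, Finset.sum_add_distrib]
    ring
  map_smul' c v := by
    refine ((P.existsUnique_corrector ξ (c • v)).choose_spec.2 _ fun x hx => ?_).symm
    have h1 := (P.existsUnique_corrector ξ v).choose_spec.1 x hx
    simp only [Submodule.coe_smul, map_smul, LinearMap.smul_apply, h1, RingHom.id_apply]
    simp [firstOrder, mul_assoc, Finset.mul_sum]

theorem corrector_spec [CompleteSpace H] (ξ : EuclideanSpace ℝ (Fin n)) (v : P.V₀) :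
    ∀ x ∈ P.W₀, (P.a 0).form (P.corrector ξ v) x = -∑ i, P.a₁ v x i * (ξ i : ℂ) :=
  (P.existsUnique_corrector ξ v).choose_spec.1

/-- The homogenised form `a^h_ξ(v, w) = a₀''(v, w) ξ · ξ - a₀(N_ξ v, N_ξ w)` on `V₀`. -/
def homForm [CompleteSpace H] (ξ : EuclideanSpace ℝ (Fin n)) : P.V₀ →ₗ[ℂ] P.V₀ →ₗ⋆[ℂ] ℂ :=
  LinearMap.mk₂'ₛₗ (RingHom.id ℂ) (starRingEnd ℂ)
    (fun v w => ∑ i, ∑ j, P.a₂ v w i j * (ξ j : ℂ) * (ξ i : ℂ) -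
      (P.a 0).form (P.corrector ξ v) (P.corrector ξ w))
    (by intros; simp [add_mul, Finset.sum_add_distrib]; ring)
    (by intros; simp [mul_assoc, Finset.mul_sum, mul_sub])
    (by intros; simp [add_mul, Finset.sum_add_distrib]; ring)
    (by intros; simp [mul_assoc, Finset.mul_sum, mul_sub])

theorem Z_le : P.Z ≤ P.V₀ := le_sup_right.trans P.sup_eq.le

/-- The operator `𝐁₀` generated by `b₀` with form domain `V₀`, in the closure of `V₀` in `𝓗`. -/
def B₀ : formSpace (P.emb.toLinearMap ∘ₗ P.V₀.subtype) →ₗ.[ℂ]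
    formSpace (P.emb.toLinearMap ∘ₗ P.V₀.subtype) :=
  formOperator _ ((P.b 0).form.domRestrict₁₂ P.V₀ P.V₀)

/-- The closure of `V_⋆` in `𝓗`. -/
abbrev Vbar : Submodule ℂ 𝓗 := formSpace (P.emb.toLinearMap ∘ₗ P.Vstar.subtype)

/-- The closure of `Z` in `𝓗`. -/
abbrev Zbar : Submodule ℂ 𝓗 := formSpace (P.emb.toLinearMap ∘ₗ P.Z.subtype)

/-- The operator `𝐁_⋆` generated by `b₀` with form domain `V_⋆`, in the closure of `V_⋆`. -/
def Bstar : P.Vbar →ₗ.[ℂ] P.Vbar :=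
  formOperator _ ((P.b 0).form.domRestrict₁₂ P.Vstar P.Vstar)

/-- The map `(v, z) ↦ v + z` from `V_⋆ × Z` to `𝓗`; it identifies the form domain `V_⋆ ∔ Z` with
`V_⋆ × Z`. -/
def sumMap : P.Vstar × P.Z →ₗ[ℂ] 𝓗 :=
  P.emb.toLinearMap ∘ₗ (P.Vstar.subtype.coprod P.Z.subtype)

/-- The form `𝕊_ξ(v + z, v' + z') = a^h_ξ(z, z') + b₀(v + z, v' + z')` on `V_⋆ ∔ Z`. -/
def limitForm [CompleteSpace H] (ξ : EuclideanSpace ℝ (Fin n)) :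
    P.Vstar × P.Z →ₗ[ℂ] P.Vstar × P.Z →ₗ⋆[ℂ] ℂ :=
  LinearMap.mk₂'ₛₗ (RingHom.id ℂ) (starRingEnd ℂ)
    (fun p q => P.homForm ξ (Submodule.inclusion P.Z_le p.2) (Submodule.inclusion P.Z_le q.2) +
      (P.b 0).form ((p.1 : H) + p.2) ((q.1 : H) + q.2))
    (by intros; simp; ring)
    (by intros; simp; ring)
    (by intros; simp; ring)
    (by intros; simp; ring)

/-- The operator `𝕃_ξ` generated by `𝕊_ξ` in the closure of `V_⋆ ∔ Z` in `𝓗`. -/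
def limitOp [CompleteSpace H] (ξ : EuclideanSpace ℝ (Fin n)) :
    formSpace P.sumMap →ₗ.[ℂ] formSpace P.sumMap :=
  formOperator P.sumMap (P.limitForm ξ)

/-- The limit collective spectrum: the closure of the union of the spectra of all `𝕃_ξ`. -/
def limitSpectrum [CompleteSpace H] : Set ℂ := closure (⋃ ξ, opSpectrum (P.limitOp ξ))

/-- An element of `Z` as an element of the closure of `Z` in `𝓗`. -/
def toZbar (z : P.Z) : P.Zbar :=
  ⟨P.emb z, Submodule.le_topologicalClosure _ ⟨z, rfl⟩⟩

/-- The operator-valued `β`-function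
`β(λ) = λ I + (λ - 1)² 𝒫_Z (𝐁_⋆ - λ I)⁻¹ 𝒫_{V_⋆}` on the closure of `Z`, for `λ` outside the
spectrum of `𝐁_⋆`; the projections are the orthogonal ones of `𝓗` onto the closures of `Z` and
`V_⋆`. -/
def betaOp [CompleteSpace 𝓗] (lam : ℝ) : P.Zbar →L[ℂ] P.Zbar :=
  (lam : ℂ) • ContinuousLinearMap.id ℂ P.Zbar +
    ((lam : ℂ) - 1) ^ 2 • (P.Zbar.orthogonalProjectionOnto ∘L P.Vbar.subtypeL ∘L
      opResolvent P.Bstar (lam : ℂ) ∘L P.Vbar.orthogonalProjectionOnto ∘L P.Zbar.subtypeL)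

/-- The form `β_λ(z, z') = - b₀(z, z') + d₀(β(λ) z, z')` on `Z`. -/
def betaForm [CompleteSpace 𝓗] (lam : ℝ) (z z' : P.Z) : ℂ :=
  -(P.b 0).form z z' + ⟪(P.toZbar z'), P.betaOp lam (P.toZbar z)⟫_ℂ

end DegenerateProblem

end

/-!
The eigenvalues of the limit operators are minimax values of compact forms. On `V₀ = V_⋆ ∔ Z` the
form of `𝕃_ξ` is `b₀ + a^h_ξ`, where `a^h_ξ` is quadratic in `ξ`, vanishes on `V_⋆` and is bounded
by `b₀`. It is also bounded below by `c |ξ|² ‖z‖²`: `a^h_ξ[v]` is the limit of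
`t⁻² a_{tξ}[v + t N_ξ v]` as `t → 0`, the gap (H3) bounds `a_{tξ}` below by the squared distance
to `V_{tξ}`, which by (H2) is close to `V_⋆`, and `Z` is transversal to `V_⋆`. Along a ray
`ξ = t e`, the form `a^h_ξ` is therefore a penalty for leaving `V_⋆`: the `k`-th eigenvalue grows
continuously from `λ₀^(k)` and tends to `λ_⋆^(k)`, or to `+∞` when `k > dim V_⋆`, so that it sweeps
out the `k`-th band. Since `λ₀^(k) → ∞`, the bands are locally finite and their union is closed.

For `λ ∉ Sp B_⋆` the form `-β_λ` is the Schur complement of `b₀ - λ d₀` with respect to `V_⋆`. By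
counting negative squares, `λ` lies in some band exactly when `-β_λ` is nonpositive at some nonzero
`z ∈ Z`.
-/

noncomputable section

open Filter Topology

section Dimension

variable {V W : Type*} [AddCommGroup V] [Module ℂ V] [AddCommGroup W] [Module ℂ W]

theorem edim_le_of_injective {f : V →ₗ[ℂ] W} (hf : Function.Injective f) : edim V ≤ edim W := by
  simpa only [edim, Cardinal.toENat_lift] using
    OrderHomClass.mono Cardinal.toENat (LinearMap.lift_rank_le_of_injective f hf)

theorem edim_congr (e : V ≃ₗ[ℂ] W) : edim V = edim W :=
  (edim_le_of_injective e.injective).antisymm (edim_le_of_injective e.symm.injective)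

theorem edim_mono {U₁ U₂ : Submodule ℂ V} (h : U₁ ≤ U₂) : edim U₁ ≤ edim U₂ :=
  edim_le_of_injective (Submodule.inclusion_injective h)

theorem edim_prod : edim (V × W) = edim V + edim W := by
  simp only [edim, rank_prod, map_add, Cardinal.toENat_lift]

theorem one_le_edim_iff : 1 ≤ edim V ↔ Nontrivial V := by
  rw [edim, Cardinal.one_le_toENat, Cardinal.one_le_iff_pos, rank_pos_iff_nontrivial]

theorem edim_map_of_injective {f : V →ₗ[ℂ] W} (hf : Function.Injective f) (U : Submodule ℂ V) :
    edim (U.map f) = edim U :=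
  (edim_congr (Submodule.equivMapOfInjective f hf U)).symm

theorem edim_sup_span_singleton {U : Submodule ℂ V} {u : V} (hu : u ∉ U) :
    edim (U ⊔ ℂ ∙ u : Submodule ℂ V) = edim U + 1 := by
  have hu0 : u ≠ 0 := fun h => hu (h ▸ U.zero_mem)
  have hdisj : U ⊓ ℂ ∙ u = ⊥ := (Submodule.disjoint_span_singleton_of_notMem hu).eq_bot
  have hone : Module.rank ℂ (ℂ ∙ u) = 1 :=
    (rank_submodule_eq_one_iff _).2 ⟨u, Submodule.mem_span_singleton_self u, hu0, le_rfl⟩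
  have hrank := congrArg Cardinal.toENat (Submodule.rank_sup_add_rank_inf_eq U (ℂ ∙ u))
  rwa [hdisj, rank_bot, add_zero, map_add, hone, map_one] at hrank

theorem edim_span_image {ι : Type*} {v : ι → V} (hv : LinearIndependent ℂ v) (S : Set ι) :
    edim (Submodule.span ℂ (v '' S)) = S.encard := by
  rw [edim, rank_span_set (hv.linearIndepOn (s := S)).id_image, Set.toENat_cardinalMk,
    hv.injective.encard_image]

theorem exists_ne_zero_forall_apply_eq_zero {k : ℕ} (hk : (k : ℕ∞) < edim V)
    (φ : Fin k → V →ₗ[ℂ] ℂ) : ∃ u : V, u ≠ 0 ∧ ∀ i, φ i u = 0 := by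
  contrapose! hk
  have hinj : Function.Injective (LinearMap.pi φ) := by
    refine (injective_iff_map_eq_zero _).2 fun u hu => by_contra fun hne => ?_
    obtain ⟨i, hi⟩ := hk u hne
    exact hi (congrFun hu i)
  refine (edim_le_of_injective hinj).trans_eq ?_
  rw [edim, rank_fin_fun, map_natCast]

end Dimension

section Enumeration

variable {ι : Type*}

theorem exists_injective_nat_of_finite_le (x : ι → ℝ) (hx : ∀ r, {i | x i ≤ r}.Finite) :
    ∃ ρ : ι → ℕ, Function.Injective ρ ∧ ∀ i i', x i < x i' → ρ i < ρ i' := by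
  have hcount : Countable ι := by
    rw [← Set.countable_univ_iff]
    refine (Set.countable_iUnion fun n : ℕ => (hx n).countable).mono fun i _ => ?_
    exact Set.mem_iUnion.2 (exists_nat_ge (x i))
  obtain ⟨c, hc⟩ := exists_injective_nat ι
  -- ties are broken by an arbitrary enumeration `c`
  let key : ι → ℝ ×ₗ ℕ := fun i => toLex (x i, c i)
  have hkey : Function.Injective key := fun i i' h =>
    hc (congrArg (fun p : ℝ ×ₗ ℕ => (ofLex p).2) h)
  have hfin : ∀ i, {i' | key i' < key i}.Finite := fun i =>
    (hx (x i)).subset fun i' h => (Prod.Lex.lt_iff.1 h).elim le_of_lt fun h => h.1.le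
  have hrank : ∀ i i', key i < key i' →
      {l | key l < key i}.ncard < {l | key l < key i'}.ncard := fun i i' h =>
    Set.ncard_lt_ncard ⟨fun l hl => lt_trans hl h, fun hle => (lt_irrefl (key i)) (hle h)⟩ (hfin i')
  refine ⟨fun i => {l | key l < key i}.ncard, fun i i' h => ?_, fun i i' h => hrank i i' ?_⟩
  · rcases lt_trichotomy (key i) (key i') with hlt | heq | hlt
    · exact absurd h (hrank i i' hlt).ne
    · exact hkey heq
    · exact absurd h (hrank i' i hlt).ne'
  · exact Prod.Lex.lt_iff.2 (Or.inl h)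

theorem natCast_lt_encard_iff {S : Set ι} {k : ℕ} :
    (k : ℕ∞) < S.encard ↔ ∀ hS : S.Finite, k < hS.toFinset.card := by
  refine ⟨fun h hS => ?_, fun h => ?_⟩
  · rwa [hS.encard_eq_coe_toFinset_card, Nat.cast_lt] at h
  · rcases S.finite_or_infinite with hS | hS
    · rw [hS.encard_eq_coe_toFinset_card, Nat.cast_lt]
      exact h hS
    · exact hS.encard_eq ▸ ENat.natCast_lt_top k

theorem exists_equiv_strictMono_of_injective {ρ : ι → ℕ} (hρ : Function.Injective ρ) :
    ∃ e : {k : ℕ // (k : ℕ∞) < ENat.card ι} ≃ ι, StrictMono (ρ ∘ e) := by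
  rw [show ENat.card ι = (Set.range ρ).encard from ENat.card_congr (Equiv.ofInjective ρ hρ)]
  let p : ℕ → Prop := fun k => k ∈ Set.range ρ
  have hcard : ∀ k : {k : ℕ // (k : ℕ∞) < (Set.range ρ).encard},
      ∀ hp : {l | p l}.Finite, k < hp.toFinset.card := fun k hp =>
    natCast_lt_encard_iff.1 k.2 hp
  choose e he using fun k => Nat.nth_mem (p := p) k.1 (hcard k)
  have hmono : StrictMono (ρ ∘ e) := fun k l hkl => by
    rw [Function.comp_apply, Function.comp_apply, he, he]
    exact Nat.nth_lt_nth' hkl (hcard l)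
  refine ⟨Equiv.ofBijective e ⟨hmono.injective.of_comp, fun i => ?_⟩, hmono⟩
  obtain ⟨k, hk, hki⟩ := Nat.exists_lt_card_nth_eq (p := p) ⟨i, rfl⟩
  exact ⟨⟨k, natCast_lt_encard_iff.2 hk⟩, hρ ((he _).trans hki)⟩

theorem exists_equiv_monotone (x : ι → ℝ) (hx : ∀ r, {i | x i ≤ r}.Finite) :
    ∃ e : {k : ℕ // (k : ℕ∞) < ENat.card ι} ≃ ι, Monotone (x ∘ e) := by
  obtain ⟨ρ, hρ, hxρ⟩ := exists_injective_nat_of_finite_le x hx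
  obtain ⟨e, he⟩ := exists_equiv_strictMono_of_injective hρ
  exact ⟨e, fun k l hkl => not_lt.1 fun hlt => (hxρ _ _ hlt).not_ge (he.monotone hkl)⟩

end Enumeration

section CompactOperators

variable {𝕜 E : Type*} [RCLike 𝕜] [NormedAddCommGroup E] [InnerProductSpace 𝕜 E]

theorem mem_orthogonal_of_forall_hilbertBasis {ι : Type*} {F : Submodule 𝕜 E} [CompleteSpace F]
    (B : HilbertBasis ι 𝕜 F) {x : E} (hx : ∀ i, inner 𝕜 (B i : E) x = 0) : x ∈ Fᗮ := by
  rw [← Submodule.orthogonalProjectionOnto_eq_zero_iff]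
  refine B.repr.map_eq_zero_iff.1 (lp.ext (funext fun i => ?_))
  rw [B.repr_apply_apply, F.inner_orthogonalProjectionOnto_eq_of_mem_left]
  exact hx i

theorem exists_orthonormal_eigenvectors [CompleteSpace E] {T : E →L[𝕜] E} (hT : IsCompactOperator T)
    (hsymm : (T : E →ₗ[𝕜] E).IsSymmetric) :
    ∃ w : Set E, Orthonormal 𝕜 ((↑) : w → E) ∧ (Submodule.span 𝕜 w)ᗮ = ⊥ ∧
      ∀ x ∈ w, ∃ μ : ℝ, T x = (μ : 𝕜) • x := by
  let F : 𝕜 → Submodule 𝕜 E := Module.End.eigenspace (T : E →ₗ[𝕜] E)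
  have hF : ∀ μ, CompleteSpace (F μ) := fun μ => by
    have hker : (F μ : Set E) = {y | T y = μ • y} :=
      Set.ext fun _ => Module.End.mem_eigenspace_iff
    exact (hker ▸ isClosed_eq T.continuous (continuous_const_smul μ)).completeSpace_coe
  choose w B _ using fun μ => exists_hilbertBasis 𝕜 (F μ)
  let e : (Σ μ, w μ) → E := fun p => B p.1 p.2
  have he : Orthonormal 𝕜 e :=
    hsymm.orthogonalFamily_eigenspaces.orthonormal_sigma_orthonormal fun μ => (B μ).orthonormal
  refine ⟨Set.range e, he.toSubtypeRange, ?_, ?_⟩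
  · rw [eq_bot_iff, ← ContinuousLinearMap.orthogonalComplement_iSup_eigenspaces_eq_bot hT hsymm,
      ← Submodule.iInf_orthogonal]
    refine le_iInf fun μ x hx => mem_orthogonal_of_forall_hilbertBasis (B μ) fun i => ?_
    exact hx _ (Submodule.subset_span ⟨⟨μ, i⟩, rfl⟩)
  · rintro _ ⟨p, rfl⟩
    have heig : T (e p) = p.1 • e p := Module.End.mem_eigenspace_iff.1 (B p.1 p.2).2
    have hreal := hsymm.conj_eigenvalue_eq_self <|
      Module.End.hasEigenvalue_of_hasEigenvector ⟨(B p.1 p.2).2, he.ne_zero p⟩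
    exact ⟨RCLike.re p.1, by rw [RCLike.conj_eq_iff_re.1 hreal, heig]⟩

end CompactOperators

section CompactResolvent

variable {E : Type*} [NormedAddCommGroup E] [InnerProductSpace ℂ E] {T : E →ₗ.[ℂ] E} {K : E →L[ℂ] E}

theorem mem_opEigenspace_iff {μ : ℂ} {y : T.domain} : y ∈ opEigenspace T μ ↔ T y = μ • (y : E) := by
  rw [opEigenspace, LinearMap.mem_ker, LinearMap.sub_apply, sub_eq_zero]
  rfl

theorem isResolventAt_opResolvent {μ : ℂ} (hμ : μ ∉ opSpectrum T) :
    IsResolventAt T μ (opResolvent T μ) := by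
  have hex : ∃ R, IsResolventAt T μ R := not_not.1 hμ
  rw [opResolvent, dif_pos hex]
  exact hex.choose_spec

theorem IsResolventAt.opEigenspace_eq_bot {μ : ℂ} (hK : IsResolventAt T μ K) :
    opEigenspace T μ = ⊥ := by
  refine (Submodule.eq_bot_iff _).2 fun y hy => Subtype.ext ?_
  rw [← hK.2 y, mem_opEigenspace_iff.1 hy, sub_self, map_zero, ZeroMemClass.coe_zero]

theorem IsResolventAt.mem_domain {μ : ℂ} (hK : IsResolventAt T μ K) (x : E) : K x ∈ T.domain :=
  (hK.1 x).choose

theorem IsResolventAt.apply_zero (hK : IsResolventAt T 0 K) (x : E) :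
    T ⟨K x, hK.mem_domain x⟩ = x := by
  obtain ⟨_, hx⟩ := hK.1 x
  rwa [zero_smul, sub_zero] at hx

theorem IsResolventAt.zero_apply (hK : IsResolventAt T 0 K) (y : T.domain) : K (T y) = y := by
  rw [← hK.2 y, zero_smul, sub_zero]

theorem IsResolventAt.mul_of_mem_resolventSet (hK : IsResolventAt T 0 K) {μ : ℂ} (hμ : μ ≠ 0)
    {A : E →L[ℂ] E} (hA₁ : ∀ f, μ⁻¹ • A f - K (A f) = f) (hA₂ : ∀ f, A (μ⁻¹ • f - K f) = f) :
    IsResolventAt T μ (μ⁻¹ • K ∘L A) := by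
  refine ⟨fun f => ?_, fun y => ?_⟩
  · have hf : (μ⁻¹ • K ∘L A) f = K (μ⁻¹ • A f) := by
      rw [smul_apply, ContinuousLinearMap.comp_apply, map_smul]
    rw [hf]
    refine ⟨hK.mem_domain _, ?_⟩
    rw [hK.apply_zero, map_smul, smul_inv_smul₀ hμ, hA₁]
  · have hy : T y - μ • (y : E) = μ • (μ⁻¹ • T y - K (T y)) := by
      rw [hK.zero_apply, smul_sub, smul_inv_smul₀ hμ]
    rw [hy, map_smul, smul_apply, ContinuousLinearMap.comp_apply, hA₂,
      smul_inv_smul₀ hμ, hK.zero_apply]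

theorem IsResolventAt.hasEigenvalue_inv_imp (hK : IsResolventAt T 0 K) {μ : ℂ} (hμ : μ ≠ 0)
    (h : Module.End.HasEigenvalue (K : Module.End ℂ E) μ⁻¹) : opEigenspace T μ ≠ ⊥ := by
  obtain ⟨f, hf⟩ := h.exists_hasEigenvector
  have hKf : K f = μ⁻¹ • f := hf.apply_eq_smul
  refine (Submodule.ne_bot_iff _).2 ⟨⟨K f, hK.mem_domain f⟩, ?_, fun h0 => hf.2 ?_⟩
  · have hf' : f = μ • K f := by rw [hKf, smul_inv_smul₀ hμ]
    exact mem_opEigenspace_iff.2 ((hK.apply_zero f).trans hf')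
  · rw [← hK.apply_zero f, h0, LinearPMap.map_zero]

theorem IsResolventAt.mem_opSpectrum_iff [CompleteSpace E] (hK : IsResolventAt T 0 K)
    (hcomp : IsCompactOperator K) {μ : ℂ} : μ ∈ opSpectrum T ↔ opEigenspace T μ ≠ ⊥ := by
  refine ⟨fun hμ => ?_, fun hμ ⟨R, hR⟩ => hμ hR.opEigenspace_eq_bot⟩
  contrapose! hμ
  rcases eq_or_ne μ 0 with rfl | h0
  · exact fun h => h ⟨K, hK⟩
  have hres := (hcomp.hasEigenvalue_or_mem_resolventSet (inv_ne_zero h0)).resolve_left fun h =>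
    hK.hasEigenvalue_inv_imp h0 h hμ
  obtain ⟨A, hA⟩ := spectrum.mem_resolventSet_iff.1 hres
  have hA₁ := fun f => DFunLike.congr_fun A.mul_inv f
  have hA₂ := fun f => DFunLike.congr_fun A.inv_mul f
  rw [hA] at hA₁ hA₂
  refine fun h => h ⟨_, hK.mul_of_mem_resolventSet h0 (A := ↑A⁻¹) (fun f => ?_) fun f => ?_⟩
  · simpa [Algebra.algebraMap_eq_smul_one] using hA₁ f
  · simpa [Algebra.algebraMap_eq_smul_one] using hA₂ f

theorem IsEigenvalueList.mem_opSpectrum_iff [CompleteSpace E] {N : ℕ∞} {ev : ℕ → ℝ}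
    (hev : IsEigenvalueList T N ev) (hK : IsResolventAt T 0 K) (hcomp : IsCompactOperator K)
    {μ : ℂ} : μ ∈ opSpectrum T ↔ ∃ k : ℕ, (k : ℕ∞) < N ∧ (ev k : ℂ) = μ := by
  rw [hK.mem_opSpectrum_iff hcomp, ← Submodule.nontrivial_iff_ne_bot, ← one_le_edim_iff,
    ← hev.mult, Set.one_le_encard_iff_nonempty]
  rfl

end CompactResolvent

namespace NonnegForm

variable {Q Q' : Type*} [AddCommGroup Q] [Module ℂ Q] [AddCommGroup Q'] [Module ℂ Q']

theorem re_nonneg (s : NonnegForm Q) (u : Q) : 0 ≤ (s.form u u).re :=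
  (Complex.nonneg_iff.1 (s.nonneg u)).1

/-- The pull-back `(u, v) ↦ s(f u, f v)` of a non-negative form along a linear map. -/
def comap (s : NonnegForm Q) (f : Q' →ₗ[ℂ] Q) : NonnegForm Q' where
  form := LinearMap.mk₂'ₛₗ (RingHom.id ℂ) (starRingEnd ℂ) (fun u v => s.form (f u) (f v))
    (by simp) (by simp) (by simp) (by simp)
  nonneg u := s.nonneg (f u)

theorem comap_comap {Q'' : Type*} [AddCommGroup Q''] [Module ℂ Q''] (s : NonnegForm Q)
    (f : Q' →ₗ[ℂ] Q) (g : Q'' →ₗ[ℂ] Q') : (s.comap f).comap g = s.comap (f ∘ₗ g) := rfl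

/-- The perturbation `s + τ h` of a non-negative form by a penalty `h` of strength `τ`. -/
def addSMul (s h : NonnegForm Q) (τ : NNReal) : NonnegForm Q where
  form := s.form + ((τ : ℝ) : ℂ) • h.form
  nonneg u := add_nonneg (s.nonneg u)
    (mul_nonneg (Complex.zero_le_real.2 τ.2) (h.nonneg u))

theorem addSMul_apply_re (s h : NonnegForm Q) (τ : NNReal) (u : Q) :
    ((s.addSMul h τ).form u u).re = (s.form u u).re + τ * (h.form u u).re := by
  simp [addSMul]

theorem addSMul_zero (s h : NonnegForm Q) : s.addSMul h 0 = s := by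
  cases s
  simp [addSMul]

theorem form_add_self_re (s : NonnegForm Q) (u v : Q) :
    (s.form (u + v) (u + v)).re =
      (s.form u u).re + 2 * (s.form u v).re + (s.form v v).re := by
  have h : (s.form v u).re = (s.form u v).re := by rw [← s.conj_symm, Complex.conj_re]
  simp only [map_add, LinearMap.add_apply, Complex.add_re, h]
  ring

theorem norm_add_le (s : NonnegForm Q) (u v : Q) : s.norm (u + v) ≤ s.norm u + s.norm v := by
  refine le_of_sq_le_sq ?_ (add_nonneg (s.norm_nonneg' u) (s.norm_nonneg' v))
  rw [s.norm_sq, s.form_add_self_re, ← s.norm_sq, ← s.norm_sq]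
  linarith [(Complex.re_le_norm _).trans (s.norm_apply_le u v)]

theorem norm_sub_rev (s : NonnegForm Q) (u v : Q) : s.norm (u - v) = s.norm (v - u) := by
  rw [← neg_sub v u]
  simp only [norm, map_neg, LinearMap.neg_apply, neg_neg]

theorem norm_le_of_form_le (s : NonnegForm Q) {u : Q} {r x : ℝ} (hx : 0 ≤ x)
    (h : (s.form u u).re ≤ r * x ^ 2) : s.norm u ≤ √r * x := by
  refine (Real.sqrt_le_sqrt h).trans_eq ?_
  rw [Real.sqrt_mul' r (sq_nonneg x), Real.sqrt_sq hx]

theorem exists_forall_form_eq (s : NonnegForm Q) (hdef : ∀ u, s.form u u = 0 → u = 0)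
    (hcomplete : ∀ x : ℕ → Q,
      (∀ ε > 0, ∃ N, ∀ m ≥ N, ∀ n ≥ N, s.norm (x m - x n) < ε) →
        ∃ u, Tendsto (fun n => s.norm (x n - u)) atTop (𝓝 0))
    (l : Q →ₗ⋆[ℂ] ℂ) {D : ℝ} (hl : ∀ u, ‖l u‖ ≤ D * s.norm u) : ∃ u, ∀ v, s.form u v = l v := by
  let core : InnerProductSpace.Core ℂ Q := { s.core with definite := hdef }
  let : NormedAddCommGroup Q := core.toNormedAddCommGroup
  let : InnerProductSpace ℂ Q := InnerProductSpace.ofCore core.toCore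
  have hnorm : ∀ u : Q, ‖u‖ = s.norm u := fun _ => rfl
  have : CompleteSpace Q := Metric.complete_of_cauchySeq_tendsto fun x hx => by
    simp only [Metric.cauchySeq_iff, dist_eq_norm, hnorm] at hx
    obtain ⟨u, hu⟩ := hcomplete x hx
    exact ⟨u, tendsto_iff_norm_sub_tendsto_zero.2 hu⟩
  let l₀ : Q →L[ℂ] ℂ := LinearMap.mkContinuous
    { toFun := fun u => (starRingEnd ℂ) (l u)
      map_add' := by simp
      map_smul' := by simp } D fun u => by simpa [hnorm] using hl u
  refine ⟨(InnerProductSpace.toDual ℂ Q).symm l₀, fun v => ?_⟩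
  have hv : s.form v ((InnerProductSpace.toDual ℂ Q).symm l₀) = (starRingEnd ℂ) (l v) :=
    InnerProductSpace.toDual_symm_apply (x := v) (y := l₀)
  rw [← s.conj_symm, hv, Complex.conj_conj]

end NonnegForm

section FormOperatorGraph

variable {Q E : Type*} [AddCommGroup Q] [Module ℂ Q] [NormedAddCommGroup E]
  [InnerProductSpace ℂ E]

theorem apply_mem_formSpace (j : Q →ₗ[ℂ] E) (u : Q) : j u ∈ formSpace j :=
  Submodule.le_topologicalClosure _ ⟨u, rfl⟩

variable {j : Q →ₗ[ℂ] E} {s : Q →ₗ[ℂ] Q →ₗ⋆[ℂ] ℂ}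

theorem eq_zero_of_mem_formSpace {f : E} (hf : f ∈ formSpace j)
    (h : ∀ u, ⟪j u, f⟫_ℂ = 0) : f = 0 := by
  have hclosed : IsClosed {x : E | ⟪x, f⟫_ℂ = 0} := isClosed_eq (by fun_prop) continuous_const
  have hmem : f ∈ {x : E | ⟪x, f⟫_ℂ = 0} :=
    closure_minimal (by rintro _ ⟨u, rfl⟩; exact h u) hclosed hf
  exact inner_self_eq_zero.1 hmem

theorem mem_formOperator_domain_iff (hj : Function.Injective j) {x f : formSpace j} :
    (∃ h : x ∈ (formOperator j s).domain, formOperator j s ⟨x, h⟩ = f) ↔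
      ∃ u, j u = x ∧ ∀ v, s u v = ⟪j v, (f : E)⟫_ℂ := by
  change _ ↔ (x, f) ∈ formGraph j s
  rw [← formOperator_graph j hj, LinearPMap.mem_graph_iff]
  exact ⟨fun ⟨h, hx⟩ => ⟨⟨x, h⟩, rfl, hx⟩, fun ⟨y, hy, hyf⟩ => by subst hy; exact ⟨y.2, hyf⟩⟩

theorem exists_eq_formOperator_apply (hj : Function.Injective j) (y : (formOperator j s).domain) :
    ∃ u, j u = (y : formSpace j) ∧ ∀ v, s u v = ⟪j v, (formOperator j s y : E)⟫_ℂ :=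
  (mem_formOperator_domain_iff hj).1 ⟨y.2, rfl⟩

end FormOperatorGraph

/-! ### Compact forms -/

section CompactForms

variable {Q E : Type*} [NormedAddCommGroup Q] [NormedSpace ℂ Q] [NormedAddCommGroup E]
  [InnerProductSpace ℂ E]

/-- A non-negative form `s` whose square root is a norm equivalent to that of `Q`, where `Q` is
compactly embedded in `E` by `j`. The form then generates an operator with compact inverse. -/
structure CompactForm (j : Q →ₗ[ℂ] E) (s : NonnegForm Q) : Prop where
  injective : Function.Injective j
  isCompactOperator : IsCompactOperator j
  exists_form_le : ∃ C : ℝ, ∀ u, (s.form u u).re ≤ C * ‖u‖ ^ 2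
  exists_le_form : ∃ c : ℝ, 0 < c ∧ ∀ u, c * ‖u‖ ^ 2 ≤ (s.form u u).re

namespace CompactForm

variable {j : Q →ₗ[ℂ] E} {s : NonnegForm Q}

theorem exists_norm_le (hs : CompactForm j s) : ∃ M : ℝ, 0 < M ∧ ∀ u, ‖u‖ ≤ M * s.norm u := by
  obtain ⟨c, hc, h⟩ := hs.exists_le_form
  refine ⟨(√c)⁻¹, by positivity, fun u => ?_⟩
  rw [← div_eq_inv_mul, le_div_iff₀' (by positivity)]
  refine Real.le_sqrt_of_sq_le ?_
  rw [mul_pow, Real.sq_sqrt hc.le]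
  exact h u

theorem exists_norm_apply_le (hs : CompactForm j s) : ∃ J : ℝ, 0 ≤ J ∧ ∀ u, ‖j u‖ ≤ J * ‖u‖ :=
  let j' : Q →L[ℂ] E := ⟨j, hs.isCompactOperator.continuous⟩
  ⟨‖j'‖, norm_nonneg j', j'.le_opNorm⟩

theorem exists_norm_apply_le_norm (hs : CompactForm j s) :
    ∃ J : ℝ, 0 ≤ J ∧ ∀ u, ‖j u‖ ≤ J * s.norm u := by
  obtain ⟨M, hM, hMle⟩ := hs.exists_norm_le
  obtain ⟨J, hJ, hJle⟩ := hs.exists_norm_apply_le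
  refine ⟨J * M, by positivity, fun u => (hJle u).trans ?_⟩
  rw [mul_assoc]
  exact mul_le_mul_of_nonneg_left (hMle u) hJ

theorem totallyBounded_image (hs : CompactForm j s) (r : ℝ) :
    TotallyBounded (j '' {u | (s.form u u).re ≤ r}) := by
  obtain ⟨M, hM, h⟩ := hs.exists_norm_le
  refine (hs.isCompactOperator.isCompact_closure_image_of_bounded
    (Metric.isBounded_closedBall (x := (0 : Q)) (r := M * √r))).totallyBounded.subset
      (subset_closure.trans' (Set.image_mono fun u hu => ?_))
  rw [mem_closedBall_zero_iff]
  exact (h u).trans (mul_le_mul_of_nonneg_left (Real.sqrt_le_sqrt hu) hM.le)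

theorem eq_zero_of_form_eq_zero (hs : CompactForm j s) {u : Q} (hu : s.form u u = 0) : u = 0 := by
  obtain ⟨M, -, h⟩ := hs.exists_norm_le
  simpa [NonnegForm.norm, hu] using h u

theorem eq_of_forall_form_eq (hs : CompactForm j s) {u v : Q}
    (h : ∀ w, s.form u w = s.form v w) : u = v := by
  refine sub_eq_zero.1 (hs.eq_zero_of_form_eq_zero ?_)
  rw [map_sub s.form, LinearMap.sub_apply, h, sub_self]

theorem exists_forall_form_eq [CompleteSpace Q] (hs : CompactForm j s) (l : Q →ₗ⋆[ℂ] ℂ) {D : ℝ}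
    (hD : 0 ≤ D) (hl : ∀ u, ‖l u‖ ≤ D * ‖u‖) : ∃ u, ∀ v, s.form u v = l v := by
  obtain ⟨M, hM, hnorm⟩ := hs.exists_norm_le
  obtain ⟨C, hC⟩ := hs.exists_form_le
  have hnorm' : ∀ u, s.norm u ≤ √C * ‖u‖ := fun u => by
    rw [← Real.sqrt_sq (norm_nonneg u), ← Real.sqrt_mul' C (sq_nonneg _)]
    exact Real.sqrt_le_sqrt (hC u)
  refine s.exists_forall_form_eq (fun u => hs.eq_zero_of_form_eq_zero) (fun x hx => ?_) l
    (D := D * M) fun u => (hl u).trans ?_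
  · have hcauchy : CauchySeq x := Metric.cauchySeq_iff.2 fun ε hε => by
      obtain ⟨N, hN⟩ := hx (M⁻¹ * ε) (by positivity)
      refine ⟨N, fun m hm n hn => ?_⟩
      rw [dist_eq_norm]
      exact (hnorm _).trans_lt ((lt_inv_mul_iff₀ hM).1 (hN m hm n hn))
    obtain ⟨u, hu⟩ := cauchySeq_tendsto_of_complete hcauchy
    refine ⟨u, squeeze_zero (fun n => s.norm_nonneg' _) (fun n => hnorm' _) ?_⟩
    simpa using (tendsto_iff_norm_sub_tendsto_zero.1 hu).const_mul √C
  · rw [mul_assoc]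
    exact mul_le_mul_of_nonneg_left (hnorm u) hD

theorem exists_forall_form_eq_inner [CompleteSpace Q] (hs : CompactForm j s) (f : E) :
    ∃ u, ∀ v, s.form u v = ⟪j v, f⟫_ℂ := by
  obtain ⟨J, hJ0, hJ⟩ := hs.exists_norm_apply_le
  refine hs.exists_forall_form_eq (((innerₛₗ ℂ).flip f).comp j) (D := J * ‖f‖) (by positivity)
    fun u => (norm_inner_le_norm (𝕜 := ℂ) (j u) f).trans ?_
  rw [mul_right_comm]
  gcongr
  exact hJ u

variable [CompleteSpace Q]

/-- The solution operator `f ↦ u` of the variational problem `s(u, ·) = (f, j ·)`. -/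
def sol (hs : CompactForm j s) : E →ₗ[ℂ] Q where
  toFun f := (hs.exists_forall_form_eq_inner f).choose
  map_add' f g := hs.eq_of_forall_form_eq fun v => by
    rw [map_add, LinearMap.add_apply, (hs.exists_forall_form_eq_inner _).choose_spec,
      (hs.exists_forall_form_eq_inner f).choose_spec,
      (hs.exists_forall_form_eq_inner g).choose_spec, inner_add_right]
  map_smul' c f := hs.eq_of_forall_form_eq fun v => by
    rw [map_smul, LinearMap.smul_apply, (hs.exists_forall_form_eq_inner _).choose_spec,
      (hs.exists_forall_form_eq_inner f).choose_spec, inner_smul_right, RingHom.id_apply,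
      smul_eq_mul]

theorem form_sol (hs : CompactForm j s) (f : E) (v : Q) : s.form (hs.sol f) v = ⟪j v, f⟫_ℂ :=
  (hs.exists_forall_form_eq_inner f).choose_spec v

theorem sol_eq (hs : CompactForm j s) {f : E} {u : Q} (hu : ∀ v, s.form u v = ⟪j v, f⟫_ℂ) :
    hs.sol f = u :=
  hs.eq_of_forall_form_eq fun v => by rw [form_sol, hu]

theorem exists_norm_sol_le (hs : CompactForm j s) : ∃ D : ℝ, ∀ f, ‖hs.sol f‖ ≤ D * ‖f‖ := by
  obtain ⟨c, hc, h⟩ := hs.exists_le_form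
  obtain ⟨J, hJ0, hJ⟩ := hs.exists_norm_apply_le
  refine ⟨J / c, fun f => ?_⟩
  have hsq : c * ‖hs.sol f‖ ^ 2 ≤ J * ‖hs.sol f‖ * ‖f‖ :=
    calc c * ‖hs.sol f‖ ^ 2 ≤ (s.form (hs.sol f) (hs.sol f)).re := h _
      _ ≤ ‖⟪j (hs.sol f), f⟫_ℂ‖ := by rw [form_sol]; exact Complex.re_le_norm _
      _ ≤ ‖j (hs.sol f)‖ * ‖f‖ := norm_inner_le_norm _ _
      _ ≤ _ := by gcongr; exact hJ _
  rcases (norm_nonneg (hs.sol f)).eq_or_lt with h0 | hpos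
  · rw [← h0]
    positivity
  · rw [div_mul_eq_mul_div, le_div_iff₀ hc]
    nlinarith

/-- The inverse of the operator generated by the form. -/
def inv (hs : CompactForm j s) : formSpace j →L[ℂ] formSpace j :=
  ContinuousLinearMap.codRestrict
    ((⟨j, hs.isCompactOperator.continuous⟩ : Q →L[ℂ] E) ∘L
      LinearMap.mkContinuousOfExistsBound hs.sol hs.exists_norm_sol_le ∘L (formSpace j).subtypeL)
    (formSpace j) fun _ => apply_mem_formSpace j _

theorem coe_inv (hs : CompactForm j s) (f : formSpace j) : (hs.inv f : E) = j (hs.sol f) := rfl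

theorem inv_isSymmetric (hs : CompactForm j s) :
    (hs.inv : formSpace j →ₗ[ℂ] formSpace j).IsSymmetric := fun f g => by
  change ⟪j (hs.sol f), (g : E)⟫_ℂ = ⟪(f : E), j (hs.sol g)⟫_ℂ
  rw [← hs.form_sol, ← s.conj_symm, hs.form_sol, inner_conj_symm]

theorem inv_isCompactOperator (hs : CompactForm j s) : IsCompactOperator hs.inv :=
  (hs.isCompactOperator.comp_clm
    (LinearMap.mkContinuousOfExistsBound hs.sol hs.exists_norm_sol_le ∘L
      (formSpace j).subtypeL)).codRestrict (V := formSpace j) (fun f => (hs.inv f).2)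
    (Submodule.isClosed_topologicalClosure _)

theorem inv_injective (hs : CompactForm j s) : Function.Injective hs.inv :=
  (injective_iff_map_eq_zero _).2 fun f hf => by
    have hsol : hs.sol f = 0 := hs.injective (by rw [← coe_inv, hf, map_zero]; rfl)
    refine Subtype.ext (eq_zero_of_mem_formSpace f.2 fun u => ?_)
    rw [← hs.form_sol, hsol, map_zero, LinearMap.zero_apply]

end CompactForm

theorem CompactForm.isResolventAt_inv [CompleteSpace Q] {j : Q →ₗ[ℂ] E} {s : NonnegForm Q}
    (hs : CompactForm j s) : IsResolventAt (formOperator j s.form) 0 hs.inv := by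
  refine ⟨fun f => ?_, fun y => ?_⟩
  · obtain ⟨h, hf⟩ := (mem_formOperator_domain_iff hs.injective).2
      ⟨_, (hs.coe_inv f).symm, hs.form_sol f⟩
    exact ⟨h, by rw [zero_smul, sub_zero]; exact hf⟩
  · obtain ⟨u, hu, hform⟩ := exists_eq_formOperator_apply hs.injective y
    rw [zero_smul, sub_zero]
    exact Subtype.ext (by rw [hs.coe_inv, hs.sol_eq hform, hu])

end CompactForms

section Orthonormal

variable {𝕜 E ι : Type*} [RCLike 𝕜] [NormedAddCommGroup E] [InnerProductSpace 𝕜 E] {e : ι → E}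

theorem one_le_norm_sub_of_orthonormal (he : Orthonormal 𝕜 e) {i k : ι} (hik : i ≠ k) :
    1 ≤ ‖e i - e k‖ := by
  have h := norm_sub_sq (𝕜 := 𝕜) (e i) (e k)
  rw [he.norm_eq_one, he.norm_eq_one, he.inner_eq_zero hik, map_zero] at h
  nlinarith [norm_nonneg (e i - e k)]

theorem finite_setOf_mem_of_orthonormal (he : Orthonormal 𝕜 e) {A : Set E}
    (hA : TotallyBounded A) : {i | e i ∈ A}.Finite := by
  obtain ⟨t, ht, hcov⟩ := Metric.totallyBounded_iff.1 hA (1 / 2) (by norm_num)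
  have hball : ∀ i ∈ {i | e i ∈ A}, ∃ y ∈ t, dist (e i) y < 1 / 2 := fun i hi => by
    simpa using hcov hi
  choose! c hct hcd using hball
  refine Set.Finite.of_finite_image (f := c) (ht.subset (Set.image_subset_iff.2 hct))
    fun i hi k hk hik => by_contra fun hne => ?_
  have hi_lt := hcd i hi
  have hk_lt := hcd k hk
  rw [← hik] at hk_lt
  have hsep := one_le_norm_sub_of_orthonormal he hne
  rw [← dist_eq_norm] at hsep
  linarith [dist_triangle_right (e i) (e k) (c i)]

theorem hasSum_norm_sq_inner_hilbertBasis [CompleteSpace E] (B : HilbertBasis ι 𝕜 E) (x : E) :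
    HasSum (fun i => ‖inner 𝕜 (B i) x‖ ^ 2) (‖x‖ ^ 2) := by
  simpa only [inner_mul_symm_re_eq_norm, norm_mul, norm_inner_symm x, ← sq,
    ← norm_sq_eq_re_inner] using RCLike.hasSum_re 𝕜 (B.hasSum_inner_mul_inner x x)

end Orthonormal

section Eigenbases

variable {Q E : Type*} [AddCommGroup Q] [Module ℂ Q] [NormedAddCommGroup E]
  [InnerProductSpace ℂ E]

/-- The eigenvectors of the operator generated by a form `s`, as elements of the form domain:
the solutions of `s(q, ·) = μ (q, ·)`. -/
def formEigenvectors (j : Q →ₗ[ℂ] E) (s : Q →ₗ[ℂ] Q →ₗ⋆[ℂ] ℂ) (μ : ℂ) : Submodule ℂ Q where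
  carrier := {q | ∀ v, s q v = μ * ⟪j v, j q⟫_ℂ}
  zero_mem' := by simp
  add_mem' hu hv w := by
    rw [map_add, LinearMap.add_apply, hu, hv, map_add, inner_add_right, mul_add]
  smul_mem' c u hu w := by
    rw [map_smul, LinearMap.smul_apply, hu, map_smul, inner_smul_right, smul_eq_mul,
      mul_left_comm]

theorem edim_opEigenspace {j : Q →ₗ[ℂ] E} (hj : Function.Injective j)
    (s : Q →ₗ[ℂ] Q →ₗ⋆[ℂ] ℂ) (μ : ℂ) :
    edim (opEigenspace (formOperator j s) μ) = edim (formEigenvectors j s μ) := by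
  have himage : (opEigenspace (formOperator j s) μ).map
      ((formSpace j).subtype ∘ₗ (formOperator j s).domain.subtype) =
      (formEigenvectors j s μ).map j := by
    ext x
    constructor
    · rintro ⟨y, hy, rfl⟩
      obtain ⟨u, hu, hform⟩ := exists_eq_formOperator_apply hj y
      refine ⟨u, fun v => ?_, hu⟩
      rw [hform, mem_opEigenspace_iff.1 hy, Submodule.coe_smul, inner_smul_right, hu]
    · rintro ⟨u, hu, rfl⟩
      obtain ⟨hdom, happ⟩ := (mem_formOperator_domain_iff hj (s := s)
        (x := ⟨j u, apply_mem_formSpace j u⟩) (f := μ • ⟨j u, apply_mem_formSpace j u⟩)).2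
          ⟨u, rfl, fun v => by rw [hu, Submodule.coe_smul, inner_smul_right]⟩
      exact ⟨⟨_, hdom⟩, mem_opEigenspace_iff.2 happ, rfl⟩
  rw [← edim_map_of_injective hj, ← himage, edim_map_of_injective]
  exact Subtype.val_injective.comp Subtype.val_injective

theorem isEigenvalueList_formOperator_comp_equiv {Q' : Type*} [AddCommGroup Q'] [Module ℂ Q']
    {j : Q →ₗ[ℂ] E} (hj : Function.Injective j) (s : NonnegForm Q) (e : Q' ≃ₗ[ℂ] Q)
    {N : ℕ∞} {ev : ℕ → ℝ} :
    IsEigenvalueList (formOperator (j ∘ₗ e.toLinearMap) (s.comap e.toLinearMap).form) N ev ↔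
      IsEigenvalueList (formOperator j s.form) N ev := by
  have hedim : ∀ μ : ℂ, edim (opEigenspace (formOperator j s.form) μ) =
      edim (opEigenspace (formOperator (j ∘ₗ e.toLinearMap) (s.comap e.toLinearMap).form) μ) := by
    intro μ
    have hmap : (formEigenvectors (j ∘ₗ e.toLinearMap) (s.comap e.toLinearMap).form μ).map
        e.toLinearMap = formEigenvectors j s.form μ := by
      ext q
      obtain ⟨q', rfl⟩ := e.surjective q
      refine e.injective.mem_set_image.trans ?_
      exact (e.surjective.forall (p := fun v => s.form (e q') v = μ * ⟪j v, j (e q')⟫_ℂ)).symm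
    rw [edim_opEigenspace hj, edim_opEigenspace (j := j ∘ₗ e.toLinearMap) (hj.comp e.injective),
      ← hmap, edim_map_of_injective e.injective]
  exact ⟨fun h => ⟨h.mono, fun μ => (h.mult μ).trans (hedim μ).symm⟩,
    fun h => ⟨h.mono, fun μ => (h.mult μ).trans (hedim μ)⟩⟩

/-- Eigenvectors `q i` of the form `s`, with real eigenvalues `x i`, whose images under `j` are
orthonormal; completeness is encoded as Parseval's identity on the form domain. -/
structure IsEigenbasis (j : Q →ₗ[ℂ] E) (s : NonnegForm Q) {ι : Type*} (x : ι → ℝ) (q : ι → Q) :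
    Prop where
  eig : ∀ i, q i ∈ formEigenvectors j s.form (x i)
  orthonormal : Orthonormal ℂ (j ∘ q)
  hasSum_norm_sq : ∀ u, HasSum (fun i => ‖⟪j (q i), j u⟫_ℂ‖ ^ 2) (‖j u‖ ^ 2)

namespace IsEigenbasis

variable {j : Q →ₗ[ℂ] E} {s : NonnegForm Q} {ι : Type*} {x : ι → ℝ} {q : ι → Q}

theorem linearIndependent (h : IsEigenbasis j s x q) : LinearIndependent ℂ q :=
  LinearIndependent.of_comp j h.orthonormal.linearIndependent

theorem form_self_re (h : IsEigenbasis j s x q) (i : ι) : (s.form (q i) (q i)).re = x i := by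
  have hnorm : ‖j (q i)‖ = 1 := h.orthonormal.norm_eq_one i
  rw [h.eig, inner_self_eq_norm_sq_to_K, hnorm]
  simp

theorem form_left (h : IsEigenbasis j s x q) (u : Q) (i : ι) :
    s.form u (q i) = x i * ⟪j (q i), j u⟫_ℂ := by
  rw [← s.conj_symm, h.eig, map_mul, inner_conj_symm, Complex.conj_ofReal]

theorem comp_equiv (h : IsEigenbasis j s x q) {κ : Type*} (e : κ ≃ ι) :
    IsEigenbasis j s (x ∘ e) (q ∘ e) where
  eig k := h.eig (e k)
  orthonormal := h.orthonormal.comp e e.injective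
  hasSum_norm_sq u := (e.hasSum_iff (f := fun i => ‖⟪j (q i), j u⟫_ℂ‖ ^ 2)).2
    (h.hasSum_norm_sq u)

theorem inner_sum_smul [DecidableEq ι] (h : IsEigenbasis j s x q) (S : Finset ι) (c : ι → ℂ)
    (i : ι) : ⟪j (q i), j (∑ k ∈ S, c k • q k)⟫_ℂ = if i ∈ S then c i else 0 := by
  have horth := orthonormal_iff_ite.1 h.orthonormal
  simp only [Function.comp_apply] at horth
  simp only [map_sum, map_smul, inner_sum, inner_smul_right, horth, mul_ite, mul_one, mul_zero,
    Finset.sum_ite_eq]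

theorem eq_sum_smul (h : IsEigenbasis j s x q) (hj : Function.Injective j) {S : Finset ι} {u : Q}
    (hu : ∀ i ∉ S, ⟪j (q i), j u⟫_ℂ = 0) : u = ∑ i ∈ S, ⟪j (q i), j u⟫_ℂ • q i := by
  classical
  refine sub_eq_zero.1 (hj ?_)
  have hsum := h.hasSum_norm_sq (u - ∑ i ∈ S, ⟪j (q i), j u⟫_ℂ • q i)
  have hcoeff : ∀ i, ⟪j (q i), j (u - ∑ i ∈ S, ⟪j (q i), j u⟫_ℂ • q i)⟫_ℂ = 0 := fun i => by
    rw [map_sub, inner_sub_right, h.inner_sum_smul]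
    split_ifs with hi
    · exact sub_self _
    · rw [hu i hi, sub_zero]
  simp only [hcoeff, norm_zero, ne_eq, OfNat.ofNat_ne_zero, not_false_eq_true, zero_pow] at hsum
  rw [map_zero, ← norm_eq_zero, ← sq_eq_zero_iff, hsum.unique hasSum_zero]

theorem inner_eq_zero_of_mem_span (h : IsEigenbasis j s x q) {S : Set ι} {u : Q}
    (hu : u ∈ Submodule.span ℂ (q '' S)) {i : ι} (hi : i ∉ S) : ⟪j (q i), j u⟫_ℂ = 0 := by
  have hker : Submodule.span ℂ (q '' S) ≤ LinearMap.ker (innerₛₗ ℂ (j (q i)) ∘ₗ j) := by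
    rw [Submodule.span_le]
    rintro _ ⟨k, hk, rfl⟩
    exact h.orthonormal.2 fun hik => hi (hik ▸ hk)
  exact hker hu

theorem edim_eq_encard (h : IsEigenbasis j s x q) (hj : Function.Injective j) {S : Set ι}
    {U : Submodule ℂ Q} (hU : ∀ i ∈ S, q i ∈ U)
    (hS : ∀ u ∈ U, ∀ i ∉ S, ⟪j (q i), j u⟫_ℂ = 0) : edim U = S.encard := by
  have hle : Submodule.span ℂ (q '' S) ≤ U :=
    Submodule.span_le.2 (Set.image_subset_iff.2 hU)
  have hspan := edim_span_image h.linearIndependent S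
  rcases S.finite_or_infinite with hfin | hinf
  · rw [← hspan]
    refine congrArg (fun U : Submodule ℂ Q => edim U) (le_antisymm (fun u hu => ?_) hle)
    rw [h.eq_sum_smul hj (S := hfin.toFinset) (u := u) fun i hi =>
      hS u hu i (fun hiS => hi (hfin.mem_toFinset.2 hiS))]
    exact sum_mem fun i hi => Submodule.smul_mem _ _
      (Submodule.subset_span ⟨i, hfin.mem_toFinset.1 hi, rfl⟩)
  · rw [hinf.encard_eq] at hspan ⊢
    exact top_le_iff.1 (hspan ▸ edim_mono hle)

theorem edim_eq (h : IsEigenbasis j s x q) (hj : Function.Injective j) :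
    edim Q = ENat.card ι := by
  rw [← edim_congr (Submodule.topEquiv (R := ℂ) (M := Q)),
    h.edim_eq_encard hj (S := Set.univ) (by simp) (by simp), Set.encard_univ]

theorem edim_opEigenspace_eq_encard (h : IsEigenbasis j s x q) (hj : Function.Injective j)
    (μ : ℂ) : edim (opEigenspace (formOperator j s.form) μ) = {i | (x i : ℂ) = μ}.encard := by
  rw [edim_opEigenspace hj]
  refine h.edim_eq_encard hj (fun i hi => ?_) fun u hu i hi => ?_
  · rw [← show (x i : ℂ) = μ from hi]
    exact h.eig i
  · have hleft := h.form_left u i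
    rw [hu] at hleft
    by_contra h0
    exact hi (mul_right_cancel₀ h0 hleft).symm

theorem form_sum_smul (h : IsEigenbasis j s x q) (S : Finset ι) (c : ι → ℂ) (v : Q) :
    s.form (∑ i ∈ S, c i • q i) v = ∑ i ∈ S, x i * (c i * ⟪j v, j (q i)⟫_ℂ) := by
  rw [map_sum, LinearMap.sum_apply]
  refine Finset.sum_congr rfl fun i _ => ?_
  rw [map_smul, LinearMap.smul_apply, h.eig, smul_eq_mul, mul_left_comm]

theorem form_sum_inner_smul (h : IsEigenbasis j s x q) (S : Finset ι) (u : Q) :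
    s.form (∑ i ∈ S, ⟪j (q i), j u⟫_ℂ • q i) u =
      ((∑ i ∈ S, x i * ‖⟪j (q i), j u⟫_ℂ‖ ^ 2 : ℝ) : ℂ) := by
  rw [h.form_sum_smul, Complex.ofReal_sum]
  refine Finset.sum_congr rfl fun i _ => ?_
  rw [← inner_conj_symm (j u), Complex.mul_conj']
  push_cast
  rfl

theorem sum_mul_norm_sq_le (h : IsEigenbasis j s x q) (S : Finset ι) (u : Q) :
    ∑ i ∈ S, x i * ‖⟪j (q i), j u⟫_ℂ‖ ^ 2 ≤ (s.form u u).re := by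
  classical
  set w := ∑ i ∈ S, ⟪j (q i), j u⟫_ℂ • q i with hw
  have horth : s.form w (u - w) = 0 := by
    rw [hw, h.form_sum_smul]
    refine Finset.sum_eq_zero fun i hi => ?_
    rw [← inner_conj_symm (j (u - w)), map_sub, inner_sub_right, h.inner_sum_smul, if_pos hi,
      sub_self, map_zero, mul_zero, mul_zero]
  have hpyth : s.form u u = s.form w u + s.form (u - w) (u - w) := by
    have horth' : s.form (u - w) w = 0 := by rw [← s.conj_symm, horth, map_zero]
    rw [map_sub (s.form (u - w)), horth', sub_zero, map_sub s.form, LinearMap.sub_apply,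
      add_sub_cancel]
  rw [hpyth, h.form_sum_inner_smul, Complex.add_re, Complex.ofReal_re]
  exact le_add_of_nonneg_right (s.re_nonneg _)

theorem form_re_le_of_mem_span (h : IsEigenbasis j s x q) (hj : Function.Injective j)
    {S : Finset ι} {r : ℝ} (hr : ∀ i ∈ S, x i ≤ r) {u : Q}
    (hu : u ∈ Submodule.span ℂ (q '' S)) : (s.form u u).re ≤ r * ‖j u‖ ^ 2 := by
  have hcoeff : ∀ i ∉ S, ⟪j (q i), j u⟫_ℂ = 0 := fun i hi => h.inner_eq_zero_of_mem_span hu hi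
  have hnorm : ‖j u‖ ^ 2 = ∑ i ∈ S, ‖⟪j (q i), j u⟫_ℂ‖ ^ 2 :=
    (h.hasSum_norm_sq u).unique (hasSum_sum_of_ne_finset_zero fun i hi => by
      rw [hcoeff i hi, norm_zero, zero_pow two_ne_zero])
  have hform := h.form_sum_inner_smul S u
  rw [← h.eq_sum_smul hj hcoeff] at hform
  rw [hform, Complex.ofReal_re, hnorm, Finset.mul_sum]
  exact Finset.sum_le_sum fun i hi => mul_le_mul_of_nonneg_right (hr i hi) (by positivity)

theorem le_form_re_of_orthogonal (h : IsEigenbasis j s x q) {r : ℝ} {u : Q}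
    (hu : ∀ i, x i < r → ⟪j (q i), j u⟫_ℂ = 0) : r * ‖j u‖ ^ 2 ≤ (s.form u u).re := by
  refine hasSum_le_of_sum_le ((h.hasSum_norm_sq u).mul_left r) fun S =>
    (Finset.sum_le_sum fun i _ => ?_).trans (h.sum_mul_norm_sq_le S u)
  rcases lt_or_ge (x i) r with hi | hi
  · rw [hu i hi, norm_zero, zero_pow two_ne_zero, mul_zero, mul_zero]
  · exact mul_le_mul_of_nonneg_right hi (by positivity)

end IsEigenbasis

end Eigenbases

section EigenvalueLists

variable {Q E : Type*} [NormedAddCommGroup Q] [NormedSpace ℂ Q] [NormedAddCommGroup E]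
  [InnerProductSpace ℂ E] {j : Q →ₗ[ℂ] E} {s : NonnegForm Q}

theorem CompactForm.exists_isEigenbasis [CompleteSpace Q] [CompleteSpace E]
    (hs : CompactForm j s) :
    ∃ (w : Set (formSpace j)) (x : w → ℝ) (q : w → Q), IsEigenbasis j s x q := by
  have : CompleteSpace (formSpace j) :=
    (Submodule.isClosed_topologicalClosure (LinearMap.range j)).completeSpace_coe
  obtain ⟨w, hw, hbot, heig⟩ :=
    exists_orthonormal_eigenvectors hs.inv_isCompactOperator hs.inv_isSymmetric
  choose! μ hμ' using heig
  have hμ : ∀ e ∈ w, hs.inv e = (μ e : ℂ) • e := hμ'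
  let B := HilbertBasis.mkOfOrthogonalEqBot hw (by rwa [Subtype.range_coe])
  have hμ0 : ∀ e : w, (μ e : ℂ) ≠ 0 := fun e h0 => hw.ne_zero e (hs.inv_injective (by
    rw [hμ e e.2, h0, zero_smul, map_zero]))
  have hj : ∀ e : w, j ((μ e : ℂ)⁻¹ • hs.sol (e : formSpace j)) = (e : formSpace j) := fun e => by
    rw [map_smul, ← hs.coe_inv, hμ e e.2, Submodule.coe_smul]
    exact inv_smul_smul₀ (hμ0 e) _
  refine ⟨w, fun e => (μ e)⁻¹, fun e => (μ e : ℂ)⁻¹ • hs.sol (e : formSpace j),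
    fun e v => ?_, ?_, fun u => ?_⟩
  · rw [map_smul, LinearMap.smul_apply, hs.form_sol, hj, Complex.ofReal_inv, smul_eq_mul]
  · rw [show j ∘ _ = Subtype.val ∘ ((↑) : w → formSpace j) from funext hj]
    exact hw.comp_linearIsometry (formSpace j).subtypeₗᵢ
  · have hparseval := hasSum_norm_sq_inner_hilbertBasis B ⟨j u, apply_mem_formSpace j u⟩
    simp only [B, HilbertBasis.coe_mkOfOrthogonalEqBot] at hparseval
    simp only [hj]
    exact hparseval

theorem IsEigenbasis.finite_le {ι : Type*} {x : ι → ℝ} {q : ι → Q} (h : IsEigenbasis j s x q)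
    (hs : CompactForm j s) (r : ℝ) : {i | x i ≤ r}.Finite :=
  (finite_setOf_mem_of_orthonormal h.orthonormal (hs.totallyBounded_image r)).subset
    fun i hi => ⟨q i, (h.form_self_re i).trans_le hi, rfl⟩

theorem CompactForm.exists_isEigenvalueList [CompleteSpace Q] [CompleteSpace E]
    (hs : CompactForm j s) :
    ∃ ev : ℕ → ℝ, IsEigenvalueList (formOperator j s.form) (edim Q) ev := by
  classical
  obtain ⟨w, x, q, h⟩ := hs.exists_isEigenbasis
  obtain ⟨e, he⟩ := exists_equiv_monotone x (h.finite_le hs)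
  rw [h.edim_eq hs.injective]
  let ev : ℕ → ℝ := fun k => if hk : (k : ℕ∞) < ENat.card w then x (e ⟨k, hk⟩) else 0
  have hev : ∀ p : {k : ℕ // (k : ℕ∞) < ENat.card w}, ev p = x (e p) := fun p => dif_pos p.2
  refine ⟨ev, fun i k hik hk => ?_, fun μ => ?_⟩
  · have hi : (i : ℕ∞) < ENat.card w := (Nat.cast_le.2 hik).trans_lt hk
    rw [hev ⟨i, hi⟩, hev ⟨k, hk⟩]
    exact he hik
  · rw [h.edim_opEigenspace_eq_encard hs.injective,
      ← (Subtype.val_injective.comp e.symm.injective).encard_image]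
    congr 1
    ext k
    constructor
    · rintro ⟨hk, hμ⟩
      rw [hev ⟨k, hk⟩] at hμ
      exact ⟨e ⟨k, hk⟩, hμ, congrArg Subtype.val (e.symm_apply_apply _)⟩
    · rintro ⟨i, hi, rfl⟩
      refine ⟨(e.symm i).2, ?_⟩
      rw [Function.comp_apply, hev, e.apply_symm_apply]
      exact hi

theorem IsEigenvalueList.exists_isEigenbasis [CompleteSpace Q] [CompleteSpace E]
    {N : ℕ∞} {ev : ℕ → ℝ} (hev : IsEigenvalueList (formOperator j s.form) N ev)
    (hs : CompactForm j s) :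
    ∃ q, IsEigenbasis j s (fun k : {k : ℕ // (k : ℕ∞) < N} => ev k) q := by
  obtain ⟨w, x, q, h⟩ := hs.exists_isEigenbasis
  have hfiber : ∀ r : ℝ, Nonempty ({k : {k : ℕ // (k : ℕ∞) < N} // ev k = r} ≃
      {i // x i = r}) := fun r => by
    have hcard : ENat.card {k : {k : ℕ // (k : ℕ∞) < N} // ev k = r} =
        ENat.card {i // x i = r} := by
      have hmult := (hev.mult r).trans (h.edim_opEigenspace_eq_encard hs.injective r)
      simp only [Complex.ofReal_inj] at hmult
      refine Eq.trans (ENat.card_congr ?_) hmult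
      exact Equiv.subtypeSubtypeEquivSubtypeInter _ (fun k : ℕ => ev k = r)
    have : Finite {i // x i = r} := ((h.finite_le hs r).subset fun i hi => le_of_eq hi).to_subtype
    have : Finite {k : {k : ℕ // (k : ℕ∞) < N} // ev k = r} := by
      rw [← ENat.card_lt_top, hcard, ENat.card_lt_top]
      infer_instance
    exact ⟨(Finite.card_eq.1 (congrArg ENat.toNat hcard)).some⟩
  let e := Equiv.ofFiberEquiv fun r => (hfiber r).some
  have he : x ∘ e = fun k => ev k.1 := funext fun k => Equiv.ofFiberEquiv_map _ k
  exact ⟨q ∘ e, he ▸ h.comp_equiv e⟩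

end EigenvalueLists

/-! ### The minimax principle -/

section Minimax

variable {Q E : Type*} [AddCommGroup Q] [Module ℂ Q] [NormedAddCommGroup E]
  [InnerProductSpace ℂ E]

/-- The form `s` has Rayleigh quotient at most `r` on some subspace of dimension at least `k`. -/
def RayleighLE (j : Q →ₗ[ℂ] E) (s : NonnegForm Q) (k : ℕ) (r : ℝ) : Prop :=
  ∃ U : Submodule ℂ Q, (k : ℕ∞) ≤ edim U ∧ ∀ u ∈ U, (s.form u u).re ≤ r * ‖j u‖ ^ 2

/-- The `k`-th minimax value of the form `s`, counted from `0`; a junk value if `k` is not smaller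
than the dimension of the form domain. -/
def minimaxValue (j : Q →ₗ[ℂ] E) (s : NonnegForm Q) (k : ℕ) : ℝ :=
  sInf {r | RayleighLE j s (k + 1) r}

end Minimax

section MinimaxPrinciple

variable {Q E : Type*} [NormedAddCommGroup Q] [NormedSpace ℂ Q] [CompleteSpace Q]
  [NormedAddCommGroup E] [InnerProductSpace ℂ E] [CompleteSpace E] {j : Q →ₗ[ℂ] E}
  {s : NonnegForm Q} {ev : ℕ → ℝ}

theorem IsEigenvalueList.rayleighLE (hev : IsEigenvalueList (formOperator j s.form) (edim Q) ev)
    (hs : CompactForm j s) {m : ℕ} {r : ℝ} (hm : (m : ℕ∞) ≤ edim Q) (hr : ∀ k < m, ev k ≤ r) :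
    RayleighLE j s m r := by
  obtain ⟨q, h⟩ := hev.exists_isEigenbasis hs
  let e : Fin m ↪ {k : ℕ // (k : ℕ∞) < edim Q} :=
    ⟨fun i => ⟨i, (Nat.cast_lt.2 i.2).trans_le hm⟩, fun _ _ hab => Fin.ext (congrArg (·.1) hab)⟩
  have hcard : (Finset.univ.map e : Set {k : ℕ // (k : ℕ∞) < edim Q}).encard = m := by
    rw [Set.encard_coe_eq_coe_finsetCard, Finset.card_map, Finset.card_fin]
  refine ⟨_, (hcard.symm.trans (edim_span_image h.linearIndependent _).symm).le, fun u hu => ?_⟩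
  refine h.form_re_le_of_mem_span hs.injective (fun i hi => ?_) hu
  obtain ⟨k, -, rfl⟩ := Finset.mem_map.1 hi
  exact hr k k.2

theorem IsEigenvalueList.le_of_rayleighLE
    (hev : IsEigenvalueList (formOperator j s.form) (edim Q) ev) (hs : CompactForm j s) {k : ℕ}
    (hk : (k : ℕ∞) < edim Q) {r : ℝ} (hr : RayleighLE j s (k + 1) r) : ev k ≤ r := by
  obtain ⟨q, h⟩ := hev.exists_isEigenbasis hs
  obtain ⟨U, hU, hle⟩ := hr
  obtain ⟨u, hu0, hu⟩ := exists_ne_zero_forall_apply_eq_zero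
    ((Nat.cast_lt.2 k.lt_succ_self).trans_le hU) fun i : Fin k =>
      innerₛₗ ℂ (j (q ⟨i, (Nat.cast_lt.2 i.2).trans hk⟩)) ∘ₗ j ∘ₗ U.subtype
  have hlower : ev k * ‖j u‖ ^ 2 ≤ (s.form u u).re :=
    h.le_form_re_of_orthogonal fun i hi =>
      hu ⟨i, not_le.1 fun hki => hi.not_ge (hev.mono k i hki i.2)⟩
  have hpos : 0 < ‖j u‖ :=
    norm_pos_iff.2 fun h0 => hu0 (Subtype.ext (hs.injective (h0.trans (map_zero j).symm)))
  exact le_of_mul_le_mul_right (hlower.trans (hle u u.2)) (by positivity)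

theorem IsEigenvalueList.le_iff_rayleighLE
    (hev : IsEigenvalueList (formOperator j s.form) (edim Q) ev) (hs : CompactForm j s) {k : ℕ}
    (hk : (k : ℕ∞) < edim Q) {r : ℝ} : ev k ≤ r ↔ RayleighLE j s (k + 1) r :=
  ⟨fun hr => hev.rayleighLE hs (by exact_mod_cast Order.add_one_le_of_lt hk) fun i hi =>
    (hev.mono i k (Nat.lt_succ_iff.1 hi) hk).trans hr, hev.le_of_rayleighLE hs hk⟩

theorem IsEigenvalueList.eq_minimaxValue
    (hev : IsEigenvalueList (formOperator j s.form) (edim Q) ev) (hs : CompactForm j s) {k : ℕ}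
    (hk : (k : ℕ∞) < edim Q) : ev k = minimaxValue j s k := by
  have hset : {r | RayleighLE j s (k + 1) r} = Set.Ici (ev k) :=
    Set.ext fun r => (hev.le_iff_rayleighLE hs hk).symm
  rw [minimaxValue, hset, csInf_Ici]

namespace CompactForm

theorem isEigenvalueList_minimaxValue (hs : CompactForm j s) :
    IsEigenvalueList (formOperator j s.form) (edim Q) (minimaxValue j s) := by
  obtain ⟨ev, hev⟩ := hs.exists_isEigenvalueList
  have heq : ∀ {k : ℕ}, (k : ℕ∞) < edim Q → minimaxValue j s k = ev k := fun hk =>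
    (hev.eq_minimaxValue hs hk).symm
  refine ⟨fun i k hik hk => ?_, fun μ => ?_⟩
  · rw [heq hk, heq ((Nat.cast_le.2 hik).trans_lt hk)]
    exact hev.mono i k hik hk
  · rw [← hev.mult]
    congr 1
    ext k
    exact and_congr_right fun hk => by rw [heq hk]

theorem mem_opSpectrum_iff (hs : CompactForm j s) {μ : ℂ} :
    μ ∈ opSpectrum (formOperator j s.form) ↔
      ∃ k : ℕ, (k : ℕ∞) < edim Q ∧ (minimaxValue j s k : ℂ) = μ :=
  hs.isEigenvalueList_minimaxValue.mem_opSpectrum_iff hs.isResolventAt_inv hs.inv_isCompactOperator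

theorem minimaxValue_le_iff (hs : CompactForm j s) {k : ℕ} (hk : (k : ℕ∞) < edim Q) {r : ℝ} :
    minimaxValue j s k ≤ r ↔ RayleighLE j s (k + 1) r :=
  hs.isEigenvalueList_minimaxValue.le_iff_rayleighLE hs hk

theorem exists_minimaxValue_le_iff_lt (hs : CompactForm j s) (r : ℝ) :
    ∃ m : ℕ, (m : ℕ∞) ≤ edim Q ∧
      ∀ k : ℕ, (k : ℕ∞) < edim Q → (minimaxValue j s k ≤ r ↔ k < m) := by
  classical
  have hev := hs.isEigenvalueList_minimaxValue
  obtain ⟨q, h⟩ := hev.exists_isEigenbasis hs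
  obtain ⟨b, hb⟩ := ((h.finite_le hs r).image Subtype.val).bddAbove
  have hex : ∃ m : ℕ, ¬ ((m : ℕ∞) < edim Q ∧ minimaxValue j s m ≤ r) :=
    ⟨b + 1, fun ⟨hk, hr⟩ => (hb ⟨⟨b + 1, hk⟩, hr, rfl⟩).not_gt b.lt_succ_self⟩
  refine ⟨Nat.find hex, ?_, fun k hk => ⟨fun hr => ?_, fun hkm => ?_⟩⟩
  · rcases hm : Nat.find hex with _ | m
    · exact zero_le
    · have hlt := (not_not.1 (Nat.find_min hex (m.lt_succ_self.trans_eq hm.symm))).1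
      exact_mod_cast Order.add_one_le_of_lt hlt
  · refine not_le.1 fun hle => Nat.find_spec hex ⟨(Nat.cast_le.2 hle).trans_lt hk, ?_⟩
    exact (hev.mono _ k hle hk).trans hr
  · exact (not_not.1 (Nat.find_min hex hkm)).2

end CompactForm

end MinimaxPrinciple

theorem exists_pos_sq_div_lt {r R : ℝ} (J : ℝ) (hrR : √r ^ 2 < R) :
    ∃ ε : ℝ, 0 < ε ∧ J * ε < 1 ∧ ((√r + ε) / (1 - J * ε)) ^ 2 < R := by
  have hquot : ContinuousAt (fun ε : ℝ => ((√r + ε) / (1 - J * ε)) ^ 2) 0 :=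
    (ContinuousAt.div (by fun_prop) (by fun_prop) (by simp)).pow 2
  have hprod : ContinuousAt (fun ε : ℝ => J * ε) 0 := by fun_prop
  have hnear := (hprod.eventually_lt_const (u := 1) (by simp)).and
    (hquot.eventually_lt_const (u := R) (by simpa using hrR))
  obtain ⟨ε, ⟨hJε, hεR⟩, hε⟩ := ((hnear.filter_mono
    (nhdsWithin_le_nhds (s := Set.Ioi (0 : ℝ)))).and self_mem_nhdsWithin).exists
  exact ⟨ε, hε, hJε, hεR⟩

section Comparison

variable {Q Q' E E' : Type*} [AddCommGroup Q] [Module ℂ Q] [AddCommGroup Q'] [Module ℂ Q']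
  [NormedAddCommGroup E] [InnerProductSpace ℂ E] [NormedAddCommGroup E']
  [InnerProductSpace ℂ E']

theorem RayleighLE.map {j : Q →ₗ[ℂ] E} {s : NonnegForm Q} {j' : Q' →ₗ[ℂ] E'} {s' : NonnegForm Q'}
    {k : ℕ} {r r' : ℝ} (h : RayleighLE j s k r) (g : Q →ₗ[ℂ] Q')
    (hinj : ∀ u, (s.form u u).re ≤ r * ‖j u‖ ^ 2 → g u = 0 → u = 0)
    (hle : ∀ u, (s.form u u).re ≤ r * ‖j u‖ ^ 2 →
      (s'.form (g u) (g u)).re ≤ r' * ‖j' (g u)‖ ^ 2) : RayleighLE j' s' k r' := by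
  obtain ⟨U, hU, hUr⟩ := h
  refine ⟨U.map g, hU.trans (edim_le_of_injective (f := g.submoduleMap U) ?_), ?_⟩
  · exact (injective_iff_map_eq_zero _).2 fun u hu =>
      Subtype.ext (hinj u (hUr u u.2) (congrArg Subtype.val hu))
  · rintro _ ⟨u, hu, rfl⟩
    exact hle u (hUr u hu)

theorem RayleighLE.lt_edim {j : Q →ₗ[ℂ] E} {s : NonnegForm Q} {k : ℕ} {r : ℝ}
    (h : RayleighLE j s (k + 1) r) : (k : ℕ∞) < edim Q := by
  obtain ⟨U, hU, -⟩ := h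
  exact (Nat.cast_lt.2 k.lt_succ_self).trans_le
    (hU.trans (edim_le_of_injective U.injective_subtype))

end Comparison

section MinimaxComparison

variable {Q Q' E E' : Type*} [NormedAddCommGroup Q] [NormedSpace ℂ Q] [CompleteSpace Q]
  [NormedAddCommGroup Q'] [NormedSpace ℂ Q'] [CompleteSpace Q'] [NormedAddCommGroup E]
  [InnerProductSpace ℂ E] [CompleteSpace E] [NormedAddCommGroup E'] [InnerProductSpace ℂ E']
  [CompleteSpace E']

namespace CompactForm

theorem minimaxValue_pos {j : Q →ₗ[ℂ] E} {s : NonnegForm Q} (hs : CompactForm j s) {k : ℕ}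
    (hk : (k : ℕ∞) < edim Q) : 0 < minimaxValue j s k := by
  obtain ⟨U, hU, hle⟩ := (hs.minimaxValue_le_iff hk).1 le_rfl
  have : Nontrivial U := one_le_edim_iff.1 (le_trans (by simp) hU)
  obtain ⟨u, hu⟩ := exists_ne (0 : U)
  obtain ⟨c, hc, hcs⟩ := hs.exists_le_form
  have hu' : 0 < ‖(u : Q)‖ := norm_pos_iff.2 fun h => hu (Subtype.ext h)
  have hpos : 0 < c * ‖(u : Q)‖ ^ 2 := by positivity
  exact pos_of_mul_pos_left (hpos.trans_le ((hcs u).trans (hle u u.2))) (sq_nonneg _)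

theorem minimaxValue_le_mul {j : Q →ₗ[ℂ] E} {s : NonnegForm Q} {j' : Q' →ₗ[ℂ] E'}
    {s' : NonnegForm Q'} (hs : CompactForm j s) (hs' : CompactForm j' s') {g : Q →ₗ[ℂ] Q'}
    (hg : Function.Injective g) (hnorm : ∀ u, ‖j' (g u)‖ = ‖j u‖) {A : ℝ} (hA : 0 ≤ A)
    (hle : ∀ u, (s'.form (g u) (g u)).re ≤ A * (s.form u u).re) {k : ℕ}
    (hk : (k : ℕ∞) < edim Q) : minimaxValue j' s' k ≤ A * minimaxValue j s k := by
  rw [hs'.minimaxValue_le_iff (hk.trans_le (edim_le_of_injective hg))]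
  refine ((hs.minimaxValue_le_iff hk).1 le_rfl).map g
    (fun u _ hu => hg (hu.trans (map_zero g).symm)) fun u hu => (hle u).trans ?_
  rw [hnorm, mul_assoc]
  exact mul_le_mul_of_nonneg_left hu hA

theorem minimaxValue_le_of_form_le {j : Q →ₗ[ℂ] E} {s : NonnegForm Q} {j' : Q' →ₗ[ℂ] E'}
    {s' : NonnegForm Q'} (hs : CompactForm j s) (hs' : CompactForm j' s') {g : Q →ₗ[ℂ] Q'}
    (hg : Function.Injective g) (hnorm : ∀ u, ‖j' (g u)‖ = ‖j u‖)
    (hle : ∀ u, (s'.form (g u) (g u)).re ≤ (s.form u u).re) {k : ℕ}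
    (hk : (k : ℕ∞) < edim Q) : minimaxValue j' s' k ≤ minimaxValue j s k := by
  simpa only [one_mul] using hs.minimaxValue_le_mul hs' hg hnorm zero_le_one
    (fun u => (hle u).trans_eq (one_mul _).symm) hk

end CompactForm

end MinimaxComparison

/-! ### Penalties and spectral bands -/

section Penalty

variable {Q V E : Type*} [NormedAddCommGroup Q] [NormedSpace ℂ Q] [NormedAddCommGroup V]
  [NormedSpace ℂ V] [NormedAddCommGroup E] [InnerProductSpace ℂ E]

/-- A non-negative form `h` that is dominated by `s` and controls the distance from the range of
`f` in the direction of the retraction `π`. As `τ → ∞`, the penalised forms `s + τ h` force elements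
of `Q` into the range of `f`. -/
structure IsPenalty (f : V →ₗ[ℂ] Q) (π : Q →ₗ[ℂ] V) (s h : NonnegForm Q) : Prop where
  exists_le_mul : ∃ C : ℝ, 0 ≤ C ∧ ∀ u, (h.form u u).re ≤ C * (s.form u u).re
  exists_mul_le : ∃ c : ℝ, 0 < c ∧
    ∀ u, c * (s.form (u - f (π u)) (u - f (π u))).re ≤ (h.form u u).re

theorem CompactForm.addSMul {j : Q →ₗ[ℂ] E} {s h : NonnegForm Q} (hs : CompactForm j s) {C : ℝ}
    (hC : 0 ≤ C) (hle : ∀ u, (h.form u u).re ≤ C * (s.form u u).re) (τ : NNReal) :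
    CompactForm j (s.addSMul h τ) where
  injective := hs.injective
  isCompactOperator := hs.isCompactOperator
  exists_form_le := by
    obtain ⟨D, hD⟩ := hs.exists_form_le
    refine ⟨(1 + τ * C) * D, fun u => ?_⟩
    calc ((s.addSMul h τ).form u u).re ≤ (s.form u u).re + τ * (C * (s.form u u).re) := by
          rw [s.addSMul_apply_re]
          gcongr
          exact hle u
      _ = (1 + τ * C) * (s.form u u).re := by ring
      _ ≤ (1 + τ * C) * D * ‖u‖ ^ 2 := by
          rw [mul_assoc]
          gcongr
          exact hD u
  exists_le_form := by
    obtain ⟨c, hc, hcs⟩ := hs.exists_le_form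
    refine ⟨c, hc, fun u => (hcs u).trans ?_⟩
    rw [s.addSMul_apply_re]
    exact le_add_of_nonneg_right (mul_nonneg τ.2 (h.re_nonneg u))

variable {j : Q →ₗ[ℂ] E} {s h : NonnegForm Q} {f : V →ₗ[ℂ] Q} {π : Q →ₗ[ℂ] V}

theorem norm_sub_retraction_le_of_addSMul_le {c r ε : ℝ} {τ : NNReal} {u : Q}
    (hc : c * (s.form (u - f (π u)) (u - f (π u))).re ≤ (h.form u u).re) (hε : 0 ≤ ε)
    (hτ : r ≤ τ * c * ε ^ 2) (hτc : 0 < τ * c)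
    (hu : ((s.addSMul h τ).form u u).re ≤ r * ‖j u‖ ^ 2) :
    s.norm (u - f (π u)) ≤ ε * ‖j u‖ := by
  have hle : τ * c * (s.form (u - f (π u)) (u - f (π u))).re ≤
      τ * c * (ε ^ 2 * ‖j u‖ ^ 2) :=
    calc τ * c * (s.form (u - f (π u)) (u - f (π u))).re ≤ τ * (h.form u u).re := by
          rw [mul_assoc]
          gcongr
      _ ≤ r * ‖j u‖ ^ 2 := by
          rw [s.addSMul_apply_re] at hu
          linarith [s.re_nonneg u]
      _ ≤ τ * c * ε ^ 2 * ‖j u‖ ^ 2 := by gcongr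
      _ = τ * c * (ε ^ 2 * ‖j u‖ ^ 2) := by ring
  simpa only [Real.sqrt_sq hε] using
    s.norm_le_of_form_le (norm_nonneg _) (le_of_mul_le_mul_left hle hτc)

/-- The retraction `π` transplants a subspace of small Rayleigh quotient for a strongly penalised
form to `V`, at the cost of increasing the quotient slightly. -/
theorem RayleighLE.comap_of_addSMul (hj : Function.Injective j) {J c r ε : ℝ} {τ : NNReal} {k : ℕ}
    (hJ : ∀ u, ‖j u‖ ≤ J * s.norm u) (hJ₀ : 0 ≤ J)
    (hc : ∀ u, c * (s.form (u - f (π u)) (u - f (π u))).re ≤ (h.form u u).re)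
    (hε : 0 ≤ ε) (hJε : J * ε < 1) (hτ : r ≤ τ * c * ε ^ 2) (hτc : 0 < τ * c)
    (hR : RayleighLE j (s.addSMul h τ) k r) :
    RayleighLE (j ∘ₗ f) (s.comap f) k (((√r + ε) / (1 - J * ε)) ^ 2) := by
  have hdist : ∀ u, ((s.addSMul h τ).form u u).re ≤ r * ‖j u‖ ^ 2 →
      s.norm (u - f (π u)) ≤ ε * ‖j u‖ := fun u =>
    norm_sub_retraction_le_of_addSMul_le (hc u) hε hτ hτc
  have hlow : ∀ u, ((s.addSMul h τ).form u u).re ≤ r * ‖j u‖ ^ 2 →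
      (1 - J * ε) * ‖j u‖ ≤ ‖j (f (π u))‖ := fun u hu => by
    have hsub := (hJ _).trans (mul_le_mul_of_nonneg_left (hdist u hu) hJ₀)
    rw [map_sub] at hsub
    linarith [norm_sub_norm_le (j u) (j (f (π u)))]
  refine hR.map π (fun u hu hπ => hj ?_) fun u hu => ?_
  · have := hlow u hu
    rw [hπ, map_zero, map_zero, norm_zero] at this
    rw [map_zero, ← norm_le_zero_iff]
    exact nonpos_of_mul_nonpos_right this (sub_pos.2 hJε)
  · have hsu : s.norm u ≤ √r * ‖j u‖ := by
      rw [s.addSMul_apply_re] at hu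
      exact s.norm_le_of_form_le (norm_nonneg _)
        ((le_add_of_nonneg_right (mul_nonneg τ.2 (h.re_nonneg u))).trans hu)
    have hnorm : s.norm (f (π u)) ≤ (√r + ε) / (1 - J * ε) * ‖j (f (π u))‖ :=
      calc s.norm (f (π u)) ≤ s.norm u + s.norm (f (π u) - u) := by
            simpa only [add_sub_cancel] using s.norm_add_le u (f (π u) - u)
        _ ≤ (√r + ε) * ‖j u‖ := by
            rw [s.norm_sub_rev]
            linarith [hdist u hu]
        _ = (√r + ε) / (1 - J * ε) * ((1 - J * ε) * ‖j u‖) := by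
            rw [← mul_assoc, div_mul_cancel₀ _ (sub_pos.2 hJε).ne']
        _ ≤ (√r + ε) / (1 - J * ε) * ‖j (f (π u))‖ := by
            have := sub_pos.2 hJε
            gcongr
            exact hlow u hu
    calc (s.form (f (π u)) (f (π u))).re = s.norm (f (π u)) ^ 2 := (s.norm_sq _).symm
      _ ≤ ((√r + ε) / (1 - J * ε) * ‖j (f (π u))‖) ^ 2 :=
          pow_le_pow_left₀ (s.norm_nonneg' _) hnorm 2
      _ = ((√r + ε) / (1 - J * ε)) ^ 2 * ‖j (f (π u))‖ ^ 2 := mul_pow _ _ 2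

namespace IsPenalty

theorem compactForm_addSMul (hp : IsPenalty f π s h) (hs : CompactForm j s) (τ : NNReal) :
    CompactForm j (s.addSMul h τ) :=
  let ⟨_, hC, hle⟩ := hp.exists_le_mul
  hs.addSMul hC hle τ

variable [CompleteSpace Q] [CompleteSpace E]

theorem minimaxValue_addSMul_le (hp : IsPenalty f π s h) (hs : CompactForm j s) :
    ∃ C : ℝ, 0 ≤ C ∧ ∀ (σ τ : NNReal) (k : ℕ), (k : ℕ∞) < edim Q →
      minimaxValue j (s.addSMul h τ) k ≤
        (1 + C * dist τ σ) * minimaxValue j (s.addSMul h σ) k := by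
  obtain ⟨C, hC, hle⟩ := hp.exists_le_mul
  refine ⟨C, hC, fun σ τ k hk => ?_⟩
  refine (hs.addSMul hC hle σ).minimaxValue_le_mul (hs.addSMul hC hle τ) (g := .id)
    Function.injective_id (fun _ => rfl) (by positivity) (fun u => ?_) hk
  rw [LinearMap.id_apply, s.addSMul_apply_re, s.addSMul_apply_re, NNReal.dist_eq]
  have hh₀ := h.re_nonneg u
  calc (s.form u u).re + τ * (h.form u u).re
      = (s.form u u).re + σ * (h.form u u).re + (τ - σ) * (h.form u u).re := by ring
    _ ≤ (s.form u u).re + σ * (h.form u u).re + |(τ : ℝ) - σ| * (C * (s.form u u).re) := by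
        gcongr
        · exact le_abs_self _
        · exact hle u
    _ ≤ (s.form u u).re + σ * (h.form u u).re +
          |(τ : ℝ) - σ| * (C * ((s.form u u).re + σ * (h.form u u).re)) := by
        gcongr
        exact le_add_of_nonneg_right (by positivity)
    _ = (1 + C * |(τ : ℝ) - σ|) * ((s.form u u).re + σ * (h.form u u).re) := by ring

theorem continuous_minimaxValue_addSMul (hp : IsPenalty f π s h) (hs : CompactForm j s) {k : ℕ}
    (hk : (k : ℕ∞) < edim Q) :
    Continuous fun τ : NNReal => minimaxValue j (s.addSMul h τ) k := by
  obtain ⟨C, hC, hle⟩ := hp.minimaxValue_addSMul_le hs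
  refine continuous_iff_continuousAt.2 fun σ => ?_
  have hupper : Tendsto (fun τ => (1 + C * dist τ σ) * minimaxValue j (s.addSMul h σ) k)
      (𝓝 σ) (𝓝 (minimaxValue j (s.addSMul h σ) k)) := by
    have hcont : Continuous fun τ : NNReal =>
        (1 + C * dist τ σ) * minimaxValue j (s.addSMul h σ) k := by fun_prop
    simpa using hcont.tendsto σ
  have hlower : Tendsto (fun τ => minimaxValue j (s.addSMul h σ) k / (1 + C * dist σ τ))
      (𝓝 σ) (𝓝 (minimaxValue j (s.addSMul h σ) k)) := by
    have hcont : Continuous fun τ : NNReal =>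
        minimaxValue j (s.addSMul h σ) k / (1 + C * dist σ τ) :=
      continuous_const.div (by fun_prop) fun τ => by positivity
    simpa using hcont.tendsto σ
  refine tendsto_of_tendsto_of_tendsto_of_le_of_le hlower hupper (fun τ => ?_)
    fun τ => hle σ τ k hk
  exact (div_le_iff₀' (by positivity)).2 (hle τ σ k hk)

variable [CompleteSpace V]

theorem exists_lt_minimaxValue_addSMul (hp : IsPenalty f π s h) (hs : CompactForm j s)
    (hV : CompactForm (j ∘ₗ f) (s.comap f)) {k : ℕ} {r : ℝ} (hk : (k : ℕ∞) < edim Q)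
    (hr : (k : ℕ∞) < edim V → r < minimaxValue (j ∘ₗ f) (s.comap f) k) :
    ∃ τ : NNReal, r < minimaxValue j (s.addSMul h τ) k := by
  obtain ⟨c, hc, hcle⟩ := hp.exists_mul_le
  obtain ⟨J, hJ, hjle⟩ := hs.exists_norm_apply_le_norm
  obtain ⟨R, hrR, hRV⟩ : ∃ R : ℝ, √r ^ 2 < R ∧
      ((k : ℕ∞) < edim V → R ≤ minimaxValue (j ∘ₗ f) (s.comap f) k) := by
    by_cases hkV : (k : ℕ∞) < edim V
    · refine ⟨_, ?_, fun _ => le_rfl⟩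
      rw [Real.sq_sqrt']
      exact max_lt (hr hkV) (hV.minimaxValue_pos hkV)
    · exact ⟨√r ^ 2 + 1, lt_add_one _, fun h => absurd h hkV⟩
  obtain ⟨ε, hε, hJε, hεR⟩ := exists_pos_sq_div_lt J hrR
  let τ : NNReal := Real.toNNReal (|r| / (c * ε ^ 2) + 1)
  have hτ : (τ : ℝ) = |r| / (c * ε ^ 2) + 1 := Real.coe_toNNReal _ (by positivity)
  refine ⟨τ, lt_of_not_ge fun hle => ?_⟩
  have hV' := ((hp.compactForm_addSMul hs τ).minimaxValue_le_iff hk).1 hle |>.comap_of_addSMul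
    hs.injective hjle hJ hcle hε.le hJε (ε := ε) (by
      rw [hτ, mul_assoc, add_mul, div_mul_cancel₀ _ (by positivity)]
      linarith [le_abs_self r, show 0 < 1 * (c * ε ^ 2) by positivity])
    (by rw [hτ]; positivity)
  have hkV := hV'.lt_edim
  exact ((hV.minimaxValue_le_iff hkV).2 hV').not_gt (hεR.trans_le (hRV hkV))

theorem exists_minimaxValue_addSMul_eq (hp : IsPenalty f π s h) (hs : CompactForm j s)
    (hV : CompactForm (j ∘ₗ f) (s.comap f)) {k : ℕ} {r : ℝ} (hk : (k : ℕ∞) < edim Q)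
    (hkr : minimaxValue j s k ≤ r)
    (hr : (k : ℕ∞) < edim V → r < minimaxValue (j ∘ₗ f) (s.comap f) k) :
    ∃ τ : NNReal, minimaxValue j (s.addSMul h τ) k = r := by
  obtain ⟨τ, hτ⟩ := hp.exists_lt_minimaxValue_addSMul hs hV hk hr
  exact mem_range_of_exists_le_of_exists_ge (hp.continuous_minimaxValue_addSMul hs hk)
    ⟨0, by rwa [s.addSMul_zero]⟩ ⟨τ, hτ.le⟩

end IsPenalty

end Penalty

section Bands

variable {Q V E : Type*} [NormedAddCommGroup Q] [NormedSpace ℂ Q] [NormedAddCommGroup V]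
  [NormedSpace ℂ V] [NormedAddCommGroup E] [InnerProductSpace ℂ E]

/-- The union of the spectral bands of a form `s` relative to a constraint `f : V → Q`: the `k`-th
band reaches from the `k`-th eigenvalue of `s` to that of its restriction to `V`, or to infinity
when `V` has dimension at most `k`. Eigenvalues are numbered from `0`. -/
def spectralBands (j : Q →ₗ[ℂ] E) (s : NonnegForm Q) (f : V →ₗ[ℂ] Q) : Set ℝ :=
  {r | ∃ k : ℕ, (k : ℕ∞) < edim Q ∧ minimaxValue j s k ≤ r ∧
    ((k : ℕ∞) < edim V → r ≤ minimaxValue (j ∘ₗ f) (s.comap f) k)}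

variable [CompleteSpace Q] [CompleteSpace E] {j : Q →ₗ[ℂ] E} {s t h : NonnegForm Q}
  {f : V →ₗ[ℂ] Q} {π : Q →ₗ[ℂ] V}

theorem CompactForm.isClosed_spectralBands (hs : CompactForm j s) :
    IsClosed (spectralBands j s f) := by
  let band (k : {k : ℕ // (k : ℕ∞) < edim Q}) : Set ℝ :=
    {r | minimaxValue j s k ≤ r ∧
      ((k : ℕ∞) < edim V → r ≤ minimaxValue (j ∘ₗ f) (s.comap f) k)}
  have hbands : spectralBands j s f = ⋃ k, band k := by
    ext r
    simp only [spectralBands, band, Set.mem_iUnion, Subtype.exists, Set.mem_ofPred_eq, exists_prop]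
  rw [hbands]
  refine LocallyFinite.isClosed_iUnion (fun r => ?_) fun k => ?_
  · obtain ⟨m, -, hm⟩ := hs.exists_minimaxValue_le_iff_lt (r + 1)
    refine ⟨Set.Iio (r + 1), Iio_mem_nhds (lt_add_one r),
      ((Set.finite_Iio m).preimage Subtype.val_injective.injOn).subset ?_⟩
    rintro k ⟨x, ⟨hkx, -⟩, hx⟩
    exact (hm k k.2).1 (hkx.trans (le_of_lt hx))
  · exact (isClosed_le continuous_const continuous_id).inter
      (isClosed_imp isOpen_const (isClosed_le continuous_id continuous_const))

theorem CompactForm.minimaxValue_mem_spectralBands [CompleteSpace V] (hs : CompactForm j s)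
    (ht : CompactForm j t) (hV : CompactForm (j ∘ₗ f) (s.comap f)) (hf : Function.Injective f)
    (hle : ∀ u, (s.form u u).re ≤ (t.form u u).re)
    (heq : ∀ v, (t.form (f v) (f v)).re = (s.form (f v) (f v)).re) {k : ℕ}
    (hk : (k : ℕ∞) < edim Q) : minimaxValue j t k ∈ spectralBands j s f :=
  ⟨k, hk, ht.minimaxValue_le_of_form_le hs (g := .id) Function.injective_id (fun _ => rfl) hle hk,
    hV.minimaxValue_le_of_form_le ht hf (fun _ => rfl) fun v => (heq v).le⟩

theorem IsPenalty.spectralBands_subset_closure [CompleteSpace V] (hp : IsPenalty f π s h)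
    (hs : CompactForm j s) (hV : CompactForm (j ∘ₗ f) (s.comap f)) :
    spectralBands j s f ⊆
      closure {r | ∃ (τ : NNReal) (k : ℕ), (k : ℕ∞) < edim Q ∧
        minimaxValue j (s.addSMul h τ) k = r} := by
  rintro r ⟨k, hk, hkr, hr⟩
  have hmem : ∀ x, minimaxValue j s k ≤ x →
      ((k : ℕ∞) < edim V → x < minimaxValue (j ∘ₗ f) (s.comap f) k) →
      x ∈ {r | ∃ (τ : NNReal) (k : ℕ), (k : ℕ∞) < edim Q ∧
        minimaxValue j (s.addSMul h τ) k = r} := fun x hkx hx =>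
    let ⟨τ, hτ⟩ := hp.exists_minimaxValue_addSMul_eq hs hV hk hkx hx
    ⟨τ, k, hk, hτ⟩
  by_cases htop : (k : ℕ∞) < edim V → r < minimaxValue (j ∘ₗ f) (s.comap f) k
  · exact subset_closure (hmem r hkr htop)
  push Not at htop
  rcases hkr.eq_or_lt with rfl | hlt
  · exact subset_closure ⟨0, k, hk, by rw [s.addSMul_zero]⟩
  · refine closure_mono (s := Set.Ico (minimaxValue j s k) r)
      (fun x hx => hmem x hx.1 fun hkV => hx.2.trans_le (hr hkV)) ?_
    rw [closure_Ico hlt.ne]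
    exact ⟨hkr, le_rfl⟩

end Bands

section ShiftedForm

variable {Q E : Type*} [AddCommGroup Q] [Module ℂ Q] [NormedAddCommGroup E]
  [InnerProductSpace ℂ E]

/-- The Hermitian form `(u, w) ↦ s(u, w) - λ (j u, j w)` belonging to the operator generated by
`s` minus `λ`. -/
def shiftedForm (j : Q →ₗ[ℂ] E) (s : NonnegForm Q) (lam : ℝ) : Q →ₗ[ℂ] Q →ₗ⋆[ℂ] ℂ :=
  LinearMap.mk₂'ₛₗ (RingHom.id ℂ) (starRingEnd ℂ)
    (fun u w => s.form u w - lam * ⟪j w, j u⟫_ℂ)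
    (by intros; simp; ring) (by intros; simp; ring) (by intros; simp; ring) (by intros; simp; ring)

variable {j : Q →ₗ[ℂ] E} {s : NonnegForm Q} {lam : ℝ} {u v : Q}

theorem shiftedForm_apply : shiftedForm j s lam u v = s.form u v - lam * ⟪j v, j u⟫_ℂ := rfl

theorem IsResolventAt.exists_forall_shiftedForm_eq {R : formSpace j →L[ℂ] formSpace j}
    (hR : IsResolventAt (formOperator j s.form) lam R) (hj : Function.Injective j)
    (x : formSpace j) : ∃ u, j u = R x ∧ ∀ v, shiftedForm j s lam u v = ⟪j v, x⟫_ℂ := by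
  obtain ⟨hdom, hRx⟩ := hR.1 x
  obtain ⟨u, hu, hform⟩ := exists_eq_formOperator_apply hj ⟨R x, hdom⟩
  refine ⟨u, hu, fun v => ?_⟩
  rw [shiftedForm_apply, hform, hu, sub_eq_iff_eq_add.1 hRx, Submodule.coe_add, Submodule.coe_smul,
    inner_add_right, inner_smul_right, add_sub_cancel_right]

theorem conj_shiftedForm :
    (starRingEnd ℂ) (shiftedForm j s lam u v) = shiftedForm j s lam v u := by
  rw [shiftedForm_apply, shiftedForm_apply, map_sub, map_mul, NonnegForm.conj_symm,
    Complex.conj_ofReal, inner_conj_symm]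

theorem shiftedForm_self_re :
    (shiftedForm j s lam u u).re = (s.form u u).re - lam * ‖j u‖ ^ 2 := by
  rw [shiftedForm_apply, Complex.sub_re, Complex.re_ofReal_mul, @norm_sq_eq_re_inner ℂ]
  rfl

theorem shiftedForm_self_im : (shiftedForm j s lam u u).im = 0 :=
  Complex.conj_eq_iff_im.1 conj_shiftedForm

theorem shiftedForm_add_self_re (h : shiftedForm j s lam u v = 0) :
    (shiftedForm j s lam (u + v) (u + v)).re =
      (shiftedForm j s lam u u).re + (shiftedForm j s lam v v).re := by
  have h' : shiftedForm j s lam v u = 0 := by rw [← conj_shiftedForm, h, map_zero]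
  simp only [map_add, LinearMap.add_apply, h, h', add_zero, zero_add, Complex.add_re]

theorem shiftedForm_smul_self_re (c : ℂ) :
    (shiftedForm j s lam (c • u) (c • u)).re = ‖c‖ ^ 2 * (shiftedForm j s lam u u).re := by
  rw [LinearMap.map_smul₂, LinearMap.map_smulₛₗ, smul_eq_mul, smul_eq_mul, ← mul_assoc,
    Complex.mul_conj', ← Complex.ofReal_pow, Complex.re_ofReal_mul]

theorem RayleighLE.succ_of_shiftedForm {V : Type*} [AddCommGroup V] [Module ℂ V]
    {f : V →ₗ[ℂ] Q} (hf : Function.Injective f) {m : ℕ}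
    (h : RayleighLE (j ∘ₗ f) (s.comap f) m lam) (hu : u ∉ LinearMap.range f)
    (horth : ∀ v, shiftedForm j s lam u (f v) = 0)
    (hneg : (shiftedForm j s lam u u).re ≤ 0) : RayleighLE j s (m + 1) lam := by
  obtain ⟨U, hU, hle⟩ := h
  refine ⟨U.map f ⊔ ℂ ∙ u, ?_, fun w hw => ?_⟩
  · rw [edim_sup_span_singleton fun hmem => hu (LinearMap.map_le_range hmem),
      edim_map_of_injective hf]
    push_cast
    gcongr
  · obtain ⟨_, ⟨v, hv, rfl⟩, _, hc, rfl⟩ := Submodule.mem_sup.1 hw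
    obtain ⟨c, rfl⟩ := Submodule.mem_span_singleton.1 hc
    have hcv : shiftedForm j s lam (c • u) (f v) = 0 := by
      rw [map_smul, LinearMap.smul_apply, horth, smul_zero]
    rw [← sub_nonpos, ← shiftedForm_self_re, add_comm, shiftedForm_add_self_re hcv,
      shiftedForm_smul_self_re]
    exact add_nonpos (mul_nonpos_of_nonneg_of_nonpos (sq_nonneg _) hneg)
      (shiftedForm_self_re.trans_le (sub_nonpos.2 (hle v hv)))

end ShiftedForm

section SchurComplement

variable {Q V E : Type*} [NormedAddCommGroup Q] [NormedSpace ℂ Q] [NormedAddCommGroup V]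
  [NormedSpace ℂ V] [NormedAddCommGroup E] [InnerProductSpace ℂ E]
  {j : Q →ₗ[ℂ] E} {s : NonnegForm Q} {f : V →ₗ[ℂ] Q} {lam : ℝ}

theorem IsEigenbasis.mul_norm_sq_le_shiftedForm {ι : Type*} {x : ι → ℝ} {q : ι → Q} {r' : ℝ}
    (hq : IsEigenbasis j s x q) (hne : ∀ i, x i ≠ lam) (hr' : ∀ i, lam < x i → r' ≤ x i)
    {v : Q} (hv : ∀ i, x i < lam → shiftedForm j s lam v (q i) = 0) :
    (r' - lam) * ‖j v‖ ^ 2 ≤ (shiftedForm j s lam v v).re := by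
  have horth : ∀ i, x i < r' → ⟪j (q i), j v⟫_ℂ = 0 := fun i hi => by
    have hilam : x i < lam := ((hne i).lt_or_gt).resolve_right fun h => hi.not_ge (hr' i h)
    have hzero := hv i hilam
    rw [shiftedForm_apply, hq.form_left, ← sub_mul, ← Complex.ofReal_sub] at hzero
    exact (mul_eq_zero.1 hzero).resolve_left
      (Complex.ofReal_ne_zero.2 (sub_ne_zero.2 hilam.ne))
  rw [shiftedForm_self_re, sub_mul]
  exact sub_le_sub_right (hq.le_form_re_of_orthogonal horth) _

theorem RayleighLE.exists_forall_shiftedForm_eq_zero {k : ℕ}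
    {q : {i : ℕ // (i : ℕ∞) < edim V} → V} (h : RayleighLE j s (k + 1) lam) :
    ∃ u ≠ 0, (shiftedForm j s lam u u).re ≤ 0 ∧
      ∀ i, i.1 < k → shiftedForm j s lam u (f (q i)) = 0 := by
  obtain ⟨U, hU, hle⟩ := h
  have hk : (k : ℕ∞) < edim U := lt_of_lt_of_le (Nat.cast_lt.2 k.lt_succ_self) hU
  obtain ⟨u, hu, hzero⟩ := exists_ne_zero_forall_apply_eq_zero hk fun i =>
    if hi : ((i : ℕ) : ℕ∞) < edim V then
      (shiftedForm j s lam).flip (f (q ⟨i, hi⟩)) ∘ₗ U.subtype else 0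
  refine ⟨u, fun h => hu (Subtype.ext h), ?_, fun i hi => ?_⟩
  · exact shiftedForm_self_re.trans_le (sub_nonpos.2 (hle u u.2))
  · simpa [i.2] using hzero ⟨i, hi⟩

variable [CompleteSpace Q] [CompleteSpace V] [CompleteSpace E]

namespace CompactForm

theorem mem_spectralBands_of_shiftedForm_nonpos (hs : CompactForm j s)
    (hV : CompactForm (j ∘ₗ f) (s.comap f)) (hf : Function.Injective f) {u : Q}
    (hu : u ∉ LinearMap.range f) (horth : ∀ v, shiftedForm j s lam u (f v) = 0)
    (hneg : (shiftedForm j s lam u u).re ≤ 0) : lam ∈ spectralBands j s f := by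
  obtain ⟨m, hm, hcount⟩ := hV.exists_minimaxValue_le_iff_lt lam
  have hlow : RayleighLE (j ∘ₗ f) (s.comap f) m lam :=
    hV.isEigenvalueList_minimaxValue.rayleighLE hV hm fun k hk =>
      (hcount k ((Nat.cast_lt.2 hk).trans_le hm)).2 hk
  have hQ := hlow.succ_of_shiftedForm hf hu horth hneg
  refine ⟨m, hQ.lt_edim, (hs.minimaxValue_le_iff hQ.lt_edim).2 hQ, fun hmV => ?_⟩
  exact (lt_of_not_ge fun hle => lt_irrefl m ((hcount m hmV).1 hle)).le

theorem exists_gap (hs : CompactForm j s) (r : ℝ) :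
    ∃ r' > r, ∀ k : ℕ, (k : ℕ∞) < edim Q → r < minimaxValue j s k →
      r' ≤ minimaxValue j s k := by
  obtain ⟨m, -, hcount⟩ := hs.exists_minimaxValue_le_iff_lt r
  have hle : ∀ k : ℕ, (k : ℕ∞) < edim Q → r < minimaxValue j s k → m ≤ k := fun k hk hrk =>
    not_lt.1 fun hkm => hrk.not_ge ((hcount k hk).2 hkm)
  by_cases hm : (m : ℕ∞) < edim Q
  · refine ⟨minimaxValue j s m, lt_of_not_ge fun h => lt_irrefl m ((hcount m hm).1 h), ?_⟩
    exact fun k hk hrk => hs.isEigenvalueList_minimaxValue.mono m k (hle k hk hrk) hk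
  · exact ⟨r + 1, lt_add_one r, fun k hk hrk =>
      absurd ((Nat.cast_le.2 (hle k hk hrk)).trans_lt hk) hm⟩

end CompactForm

theorem CompactForm.exists_shiftedForm_nonpos (hs : CompactForm j s)
    (hV : CompactForm (j ∘ₗ f) (s.comap f))
    (hne : ∀ k : ℕ, (k : ℕ∞) < edim V → minimaxValue (j ∘ₗ f) (s.comap f) k ≠ lam)
    (hmem : lam ∈ spectralBands j s f) :
    ∃ w ∉ LinearMap.range f, ∀ v, (∀ v', shiftedForm j s lam (w + f v) (f v') = 0) →
      (shiftedForm j s lam (w + f v) (w + f v)).re ≤ 0 := by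
  obtain ⟨k, hk, hkle, hlek⟩ := hmem
  obtain ⟨q, hq⟩ := hV.isEigenvalueList_minimaxValue.exists_isEigenbasis hV
  obtain ⟨r', hr', hgap⟩ := hV.exists_gap lam
  obtain ⟨u, hu, hneg, hzero⟩ :=
    ((hs.minimaxValue_le_iff hk).1 hkle).exists_forall_shiftedForm_eq_zero (f := f) (q := q)
  have hlow : ∀ i : {i : ℕ // (i : ℕ∞) < edim V},
      minimaxValue (j ∘ₗ f) (s.comap f) i < lam → shiftedForm j s lam u (f (q i)) = 0 :=
    fun i hi => hzero i <| not_le.1 fun hki =>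
      hi.not_ge ((hlek ((Nat.cast_le.2 hki).trans_lt i.2)).trans
        (hV.isEigenvalueList_minimaxValue.mono k i hki i.2))
  have hpos : ∀ v, (∀ i : {i : ℕ // (i : ℕ∞) < edim V},
      minimaxValue (j ∘ₗ f) (s.comap f) i < lam → shiftedForm j s lam (f v) (f (q i)) = 0) →
      (r' - lam) * ‖j (f v)‖ ^ 2 ≤ (shiftedForm j s lam (f v) (f v)).re := fun v =>
    hq.mul_norm_sq_le_shiftedForm (fun i => hne i i.2) fun i => hgap i i.2
  refine ⟨u, ?_, fun v hv => ?_⟩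
  · rintro ⟨v, rfl⟩
    have hnorm : ‖j (f v)‖ ^ 2 ≤ 0 :=
      nonpos_of_mul_nonpos_right ((hpos v hlow).trans hneg) (sub_pos.2 hr')
    exact hu (hs.injective (by
      rw [map_zero, ← norm_eq_zero, ← sq_eq_zero_iff]
      exact le_antisymm hnorm (sq_nonneg _)))
  · have hfv : 0 ≤ (shiftedForm j s lam (f v) (f v)).re := by
      refine (mul_nonneg (sub_pos.2 hr').le (sq_nonneg _)).trans (hpos v fun i hi => ?_)
      have := hv (q i)
      rwa [map_add, LinearMap.add_apply, hlow i hi, zero_add] at this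
    have hsplit := shiftedForm_add_self_re
      (by rw [map_neg, hv, neg_zero] : shiftedForm j s lam (u + f v) (-f v) = 0)
    simp only [add_neg_cancel_right, map_neg, LinearMap.neg_apply, neg_neg] at hsplit
    linarith

end SchurComplement

/-! ### The homogenised form -/

namespace NonnegForm

variable {H : Type*} [AddCommGroup H] [Module ℂ H] (s : NonnegForm H)

theorem norm_le_of_sub_mem_orthCompl {V : Submodule ℂ H} {u p : H} (hp : p ∈ V)
    (hu : u - p ∈ s.orthCompl V) : s.norm p ≤ s.norm u := by
  refine Real.sqrt_le_sqrt ?_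
  have pythagoras := s.form_add_self_re (u - p) p
  rw [sub_add_cancel, hu p hp, Complex.zero_re] at pythagoras
  linarith [s.re_nonneg (u - p)]

theorem form_eq_of_sub_mem_nullSpace {u w : H} (h : u - w ∈ s.nullSpace) :
    s.form u u = s.form w w := by
  have left : ∀ x, s.form (u - w) x = 0 := s.apply_eq_zero h
  have right : ∀ x, s.form x (u - w) = 0 := fun x => by rw [← s.conj_symm, left, map_zero]
  rw [← add_sub_cancel w u]
  simp only [map_add, LinearMap.add_apply, left, right, add_zero]

theorem sqrt_re_inv_sq_mul_form {t : ℝ} (ht : 0 < t) (u : H) :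
    √(((t : ℂ) ^ 2)⁻¹ * s.form u u).re = t⁻¹ * s.norm u := by
  rw [← Complex.ofReal_pow, ← Complex.ofReal_inv, Complex.re_ofReal_mul,
    Real.sqrt_mul (by positivity), Real.sqrt_inv, Real.sqrt_sq ht.le, norm]

end NonnegForm

theorem tendsto_inv_pow_mul_of_norm_sub_le {f : ℝ → ℂ} {g : ℂ} (C : ℝ) (k : ℕ)
    (h : ∀ᶠ t : ℝ in 𝓝[>] 0, ‖f t - (t : ℂ) ^ k * g‖ ≤ C * t ^ (k + 1)) :
    Tendsto (fun t : ℝ => ((t : ℂ) ^ k)⁻¹ * f t) (𝓝[>] 0) (𝓝 g) := by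
  rw [tendsto_iff_norm_sub_tendsto_zero]
  have hlim : Tendsto (fun t : ℝ => C * t) (𝓝[>] 0) (𝓝 0) := by
    simpa using ((continuous_const_mul C).tendsto 0).mono_left nhdsWithin_le_nhds
  refine squeeze_zero' (Eventually.of_forall fun _ => norm_nonneg _) ?_ hlim
  filter_upwards [h, self_mem_nhdsWithin] with t ht (ht0 : 0 < t)
  have hne : (t : ℂ) ^ k ≠ 0 := pow_ne_zero k (Complex.ofReal_ne_zero.2 ht0.ne')
  have hfactor : ((t : ℂ) ^ k)⁻¹ * f t - g = ((t : ℂ) ^ k)⁻¹ * (f t - (t : ℂ) ^ k * g) := by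
    rw [mul_sub, inv_mul_cancel_left₀ hne]
  rw [hfactor, norm_mul, norm_inv, norm_pow, Complex.norm_real, Real.norm_of_nonneg ht0.le,
    inv_mul_le_iff₀ (by positivity)]
  exact ht.trans_eq (by ring)

namespace DegenerateProblem

variable {n : ℕ} {H 𝓗 : Type*} [NormedAddCommGroup H] [InnerProductSpace ℂ H]
  [NormedAddCommGroup 𝓗] [InnerProductSpace ℂ 𝓗] (P : DegenerateProblem n H 𝓗)

/-- The inner product `(·,·)_θ = a_θ + b_θ`. -/
abbrev ip (θ : EuclideanSpace ℝ (Fin n)) : NonnegForm H := (P.a θ).add (P.b θ)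

/-- The second-order term `a₀''(v, w) ξ · ξ` of the expansion of `a_θ` at `θ = 0`. -/
def secondOrder (ξ : EuclideanSpace ℝ (Fin n)) (v w : P.V₀) : ℂ :=
  ∑ i, ∑ k, P.a₂ v w i k * (ξ k : ℂ) * (ξ i : ℂ)

theorem firstOrder_smul (t : ℝ) (ξ : EuclideanSpace ℝ (Fin n)) (v : P.V₀) (u : H) :
    P.firstOrder (t • ξ) v u = t * P.firstOrder ξ v u := by
  simp only [firstOrder, LinearMap.coe_mk, AddHom.coe_mk, Finset.mul_sum, PiLp.smul_apply,
    smul_eq_mul, Complex.ofReal_mul, mul_left_comm]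

theorem secondOrder_smul (t : ℝ) (ξ : EuclideanSpace ℝ (Fin n)) (v w : P.V₀) :
    P.secondOrder (t • ξ) v w = (t : ℂ) ^ 2 * P.secondOrder ξ v w := by
  simp only [secondOrder, Finset.mul_sum, PiLp.smul_apply, smul_eq_mul, Complex.ofReal_mul]
  exact Finset.sum_congr rfl fun i _ => Finset.sum_congr rfl fun k _ => by ring

theorem eventually_smul_mem (ξ : EuclideanSpace ℝ (Fin n)) : ∀ᶠ t : ℝ in 𝓝[>] 0, t • ξ ∈ P.Θ := by
  have hlim : Tendsto (fun t : ℝ => t • ξ) (𝓝[>] 0) (𝓝 0) := by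
    simpa using ((continuous_id.smul continuous_const).tendsto (0 : ℝ)).mono_left
      (nhdsWithin_le_nhds (s := Set.Ioi 0)) (f := fun t : ℝ => t • ξ)
  exact hlim.eventually (mem_interior_iff_mem_nhds.1 P.zero_mem_interior)

theorem tendsto_form_smul (ξ : EuclideanSpace ℝ (Fin n)) (u w : H) :
    Tendsto (fun t : ℝ => (P.a (t • ξ)).form u w) (𝓝[>] 0) (𝓝 ((P.a 0).form u w)) := by
  obtain ⟨L, -, hL⟩ := P.a_lipschitz
  have h := tendsto_inv_pow_mul_of_norm_sub_le (f := fun t => (P.a (t • ξ)).form u w)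
    (g := (P.a 0).form u w) (L * ‖ξ‖ * P.ip₀.norm u * P.ip₀.norm w) 0 ?_
  · simpa using h
  filter_upwards [P.eventually_smul_mem ξ, self_mem_nhdsWithin] with t ht (ht0 : 0 < t)
  rw [pow_zero, one_mul, norm_sub_rev]
  refine (hL 0 P.zero_mem _ ht u w).trans_eq ?_
  rw [zero_sub, norm_neg, norm_smul, Real.norm_of_nonneg ht0.le]
  ring

theorem tendsto_firstOrder (ξ : EuclideanSpace ℝ (Fin n)) (v : P.V₀) (u : H) :
    Tendsto (fun t : ℝ => ((t : ℂ) ^ 1)⁻¹ * (P.a (t • ξ)).form v u) (𝓝[>] 0)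
      (𝓝 (P.firstOrder ξ v u)) := by
  obtain ⟨K, -, hK⟩ := P.diff_one
  refine tendsto_inv_pow_mul_of_norm_sub_le (K * ‖ξ‖ ^ 2 * P.ip₀.norm v * P.ip₀.norm u) 1 ?_
  filter_upwards [P.eventually_smul_mem ξ, self_mem_nhdsWithin] with t ht (ht0 : 0 < t)
  rw [pow_one, ← firstOrder_smul]
  refine (hK v u _ ht).trans_eq ?_
  rw [norm_smul, Real.norm_of_nonneg ht0.le]
  ring

theorem tendsto_secondOrder (ξ : EuclideanSpace ℝ (Fin n)) (v w : P.V₀) :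
    Tendsto (fun t : ℝ => ((t : ℂ) ^ 2)⁻¹ * (P.a (t • ξ)).form v w) (𝓝[>] 0)
      (𝓝 (P.secondOrder ξ v w)) := by
  obtain ⟨K, -, hK⟩ := P.diff_two
  refine tendsto_inv_pow_mul_of_norm_sub_le (K * ‖ξ‖ ^ 3 * P.ip₀.norm v * P.ip₀.norm w) 2 ?_
  filter_upwards [P.eventually_smul_mem ξ, self_mem_nhdsWithin] with t ht (ht0 : 0 < t)
  rw [← secondOrder_smul]
  refine (hK v w _ ht).trans_eq ?_
  rw [norm_smul, Real.norm_of_nonneg ht0.le]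
  ring

theorem exists_le_norm_sub_Vstar :
    ∃ c : ℝ, 0 < c ∧ ∀ v ∈ P.Vstar, ∀ z ∈ P.Z, c * ‖z‖ ≤ ‖z - v‖ := by
  obtain ⟨M, hM, hn⟩ := P.norm_equiv
  obtain ⟨K, hK0, hK1, hK⟩ := P.transversal
  have hip : ∀ v ∈ P.Vstar, ∀ z ∈ P.Z, (1 - K) * P.ip₀.norm z ≤ P.ip₀.norm (z - v) := by
    intro v hv z hz
    refine abs_le_of_sq_le_sq' ?_ (P.ip₀.norm_nonneg' _) |>.2
    have hexpand := P.ip₀.form_add_self_re (-v) z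
    simp only [neg_add_eq_sub, map_neg, LinearMap.neg_apply, neg_neg, Complex.neg_re] at hexpand
    have hcross := (Complex.re_le_norm _).trans (hK v hv z hz)
    rw [P.ip₀.norm_sq, hexpand, ← P.ip₀.norm_sq, ← P.ip₀.norm_sq]
    nlinarith [mul_nonneg hK0 (sq_nonneg (P.ip₀.norm v - P.ip₀.norm z)),
      mul_nonneg (sub_nonneg.2 hK1.le) (sq_nonneg (P.ip₀.norm v)),
      mul_nonneg (mul_nonneg hK0 (sub_nonneg.2 hK1.le)) (sq_nonneg (P.ip₀.norm z))]
  refine ⟨(1 - K) / M ^ 2, div_pos (sub_pos.2 hK1) (by positivity), fun v hv z hz => ?_⟩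
  rw [div_mul_eq_mul_div, div_le_iff₀ (by positivity)]
  calc (1 - K) * ‖z‖ ≤ (1 - K) * (M * P.ip₀.norm z) :=
        mul_le_mul_of_nonneg_left (hn 0 P.zero_mem z).1 (sub_nonneg.2 hK1.le)
    _ = M * ((1 - K) * P.ip₀.norm z) := by ring
    _ ≤ M * P.ip₀.norm (z - v) := by gcongr; exact hip v hv z hz
    _ ≤ M * (M * ‖z - v‖) := by gcongr; exact (hn 0 P.zero_mem _).2
    _ = ‖z - v‖ * M ^ 2 := by ring

theorem exists_norm_sub_Vstar_le : ∃ C : ℝ, 0 ≤ C ∧ ∀ θ ∈ P.Θ, θ ≠ 0 → ∀ p ∈ (P.a θ).nullSpace,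
    ∃ v ∈ P.Vstar, ‖p - v‖ ≤ C * ‖θ‖ * ‖p‖ := by
  obtain ⟨M, hM, hn⟩ := P.norm_equiv
  obtain ⟨L, hL, hrem⟩ := P.removable
  refine ⟨M ^ 2 * (L + 1), by positivity, fun θ hθ hθ0 p hp => ?_⟩
  obtain rfl | hp0 := eq_or_ne p 0
  · exact ⟨0, P.Vstar.zero_mem, by simp⟩
  have hpos : 0 < (P.ip θ).norm p :=
    pos_of_mul_pos_right ((norm_pos_iff.2 hp0).trans_le (hn θ hθ p).1) hM.le
  have hdist := hrem θ hθ 0 P.zero_mem p (by rwa [starFamily, if_neg hθ0])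
  rw [sub_zero] at hdist
  have hlt : L * ‖θ‖ * (P.ip θ).norm p < (L + 1) * ‖θ‖ * (P.ip θ).norm p := by
    have := norm_pos_iff.2 hθ0
    gcongr
    exact lt_add_one L
  obtain ⟨⟨v, hv⟩, hlt⟩ := exists_lt_of_ciInf_lt (hdist.trans_lt hlt)
  rw [starFamily, if_pos rfl] at hv
  refine ⟨v, hv, ?_⟩
  calc ‖p - v‖ ≤ M * P.ip₀.norm (p - v) := (hn 0 P.zero_mem _).1
    _ ≤ M * ((L + 1) * ‖θ‖ * (M * ‖p‖)) := by
        gcongr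
        exact hlt.le.trans (by gcongr; exact (hn θ hθ p).2)
    _ = M ^ 2 * (L + 1) * ‖θ‖ * ‖p‖ := by ring

theorem isClosed_nullSpace {θ : EuclideanSpace ℝ (Fin n)} (hθ : θ ∈ P.Θ) :
    IsClosed ((P.a θ).nullSpace : Set H) := by
  obtain ⟨K, -, hK⟩ := P.exists_bound
  have hinter : ((P.a θ).nullSpace : Set H) = ⋂ u : H, {v : H | (P.a θ).form v u = 0} := by
    ext v
    simp only [Set.mem_iInter]
    exact ⟨fun hv u => (P.a θ).apply_eq_zero hv u, fun hv => hv v⟩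
  rw [hinter]
  refine isClosed_iInter fun u => isClosed_eq ?_ continuous_const
  exact ((P.a θ).form.flip u).mkContinuous (K * ‖u‖)
    (fun w => (hK θ hθ w u).1.trans_eq (by ring)) |>.continuous

section Complete

variable [CompleteSpace H]

theorem exists_mem_nullSpace_sub_mem_orthCompl {θ : EuclideanSpace ℝ (Fin n)} (hθ : θ ∈ P.Θ)
    (u : H) : ∃ p ∈ (P.a θ).nullSpace, u - p ∈ (P.ip θ).orthCompl (P.a θ).nullSpace := by
  obtain ⟨K, -, hK⟩ := P.exists_bound
  obtain ⟨M, hM, hn⟩ := P.norm_equiv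
  have coercive : ∀ w ∈ (P.a θ).nullSpace, 1 / M ^ 2 * ‖w‖ ^ 2 ≤ ((P.ip θ).form w w).re := by
    intro w _
    rw [← NonnegForm.norm_sq, one_div_mul_eq_div, div_le_iff₀ (by positivity), ← mul_pow, mul_comm]
    exact pow_le_pow_left₀ (norm_nonneg w) (hn θ hθ w).1 2
  obtain ⟨p, hp, -⟩ := (P.ip θ).existsUnique_solution (P.a θ).nullSpace
    (P.isClosed_nullSpace hθ) K (1 / M ^ 2) (by positivity) (fun u w => (hK θ hθ u w).2)
    coercive ((P.ip θ).form u) (K * ‖u‖) (fun x => (hK θ hθ u x).2)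
  refine ⟨p, p.2, fun v hv => ?_⟩
  rw [map_sub, LinearMap.sub_apply, hp v hv, sub_self]

theorem exists_norm_sub_nullSpace_le : ∃ C : ℝ, 0 ≤ C ∧ ∀ θ ∈ P.Θ, ∀ u : H,
    ∃ p ∈ (P.a θ).nullSpace, ‖p‖ ≤ C * ‖u‖ ∧ ‖θ‖ * ‖u - p‖ ≤ C * (P.a θ).norm u := by
  obtain ⟨M, hM, hn⟩ := P.norm_equiv
  obtain ⟨γ, hγ, hgap⟩ := P.quadratic_gap
  refine ⟨max (M ^ 2) (M / √γ), by positivity, fun θ hθ u => ?_⟩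
  obtain ⟨p, hp, hu⟩ := P.exists_mem_nullSpace_sub_mem_orthCompl hθ u
  refine ⟨p, hp, ?_, ?_⟩
  · calc ‖p‖ ≤ M * (P.ip θ).norm p := (hn θ hθ p).1
      _ ≤ M * (M * ‖u‖) := by
        gcongr
        exact ((P.ip θ).norm_le_of_sub_mem_orthCompl hp hu).trans (hn θ hθ u).2
      _ = M ^ 2 * ‖u‖ := by ring
      _ ≤ max (M ^ 2) (M / √γ) * ‖u‖ := by gcongr; exact le_max_left _ _
  · have henergy : √γ * ‖θ‖ * (P.ip θ).norm (u - p) ≤ (P.a θ).norm u := by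
      refine Real.le_sqrt_of_sq_le ?_
      rw [(P.a θ).form_eq_of_sub_mem_nullSpace (w := u - p) (by simpa using hp), mul_pow, mul_pow,
        Real.sq_sqrt hγ.le]
      exact hgap θ hθ _ hu
    calc ‖θ‖ * ‖u - p‖ ≤ ‖θ‖ * (M * (P.ip θ).norm (u - p)) := by gcongr; exact (hn θ hθ _).1
      _ = M / √γ * (√γ * ‖θ‖ * (P.ip θ).norm (u - p)) := by
        have := Real.sqrt_pos.2 hγ
        field_simp
      _ ≤ max (M ^ 2) (M / √γ) * (P.a θ).norm u :=
        mul_le_mul (le_max_right _ _) henergy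
          (mul_nonneg (by positivity) (NonnegForm.norm_nonneg' _ _)) (by positivity)

theorem exists_norm_mul_norm_le : ∃ C : ℝ, 0 < C ∧ ∀ θ ∈ P.Θ, ∀ z ∈ P.Z, ∀ u : H,
    ‖θ‖ * ‖z‖ ≤ C * ((P.a θ).norm u + ‖θ‖ ^ 2 * ‖u‖ + ‖θ‖ * ‖z - u‖) := by
  obtain ⟨c, hc, hZ⟩ := P.exists_le_norm_sub_Vstar
  obtain ⟨A, hA, hnull⟩ := P.exists_norm_sub_nullSpace_le
  obtain ⟨L, hL, hstar⟩ := P.exists_norm_sub_Vstar_le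
  refine ⟨(1 + A + A * L) / c, by positivity, fun θ hθ z hz u => ?_⟩
  have henergy := (P.a θ).norm_nonneg' u
  obtain rfl | hθ0 := eq_or_ne θ 0
  · rw [norm_zero, zero_mul]
    positivity
  obtain ⟨p, hp, hpu, hup⟩ := hnull θ hθ u
  obtain ⟨v, hv, hpv⟩ := hstar θ hθ hθ0 p hp
  have triangle : ‖z - v‖ ≤ ‖z - u‖ + ‖u - p‖ + ‖p - v‖ :=
    (norm_sub_le_norm_sub_add_norm_sub z p v).trans
      (add_le_add (norm_sub_le_norm_sub_add_norm_sub z u p) le_rfl)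
  rw [div_mul_eq_mul_div, le_div_iff₀ hc]
  calc ‖θ‖ * ‖z‖ * c = ‖θ‖ * (c * ‖z‖) := by ring
    _ ≤ ‖θ‖ * (‖z - u‖ + ‖u - p‖ + L * ‖θ‖ * (A * ‖u‖)) := by
        gcongr
        refine (hZ v hv z hz).trans (triangle.trans ?_)
        gcongr
        exact hpv.trans (by gcongr)
    _ = ‖θ‖ * ‖z - u‖ + ‖θ‖ * ‖u - p‖ + A * L * (‖θ‖ ^ 2 * ‖u‖) := by ring
    _ ≤ ‖θ‖ * ‖z - u‖ + A * (P.a θ).norm u + A * L * (‖θ‖ ^ 2 * ‖u‖) := by gcongr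
    _ ≤ _ := by
        have h₁ : 0 ≤ ‖θ‖ * ‖z - u‖ := by positivity
        have h₂ : 0 ≤ ‖θ‖ ^ 2 * ‖u‖ := by positivity
        have h₃ : 0 ≤ A * L := by positivity
        nlinarith [mul_nonneg hA h₁, mul_nonneg h₃ h₁, mul_nonneg h₃ henergy, mul_nonneg hA h₂]

theorem homForm_apply (ξ : EuclideanSpace ℝ (Fin n)) (v w : P.V₀) :
    P.homForm ξ v w =
      P.secondOrder ξ v w - (P.a 0).form (P.corrector ξ v) (P.corrector ξ w) := rfl

theorem form_corrector_apply (ξ : EuclideanSpace ℝ (Fin n)) (v : P.V₀) {x : H} (hx : x ∈ P.W₀) :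
    (P.a 0).form (P.corrector ξ v) x = -P.firstOrder ξ v x := P.corrector_spec ξ v x hx

theorem corrector_smul (t : ℝ) (ξ : EuclideanSpace ℝ (Fin n)) (v : P.V₀) :
    P.corrector (t • ξ) v = (t : ℂ) • P.corrector ξ v := by
  refine (P.existsUnique_corrector (t • ξ) v).unique
    (fun x hx => P.form_corrector_apply _ v hx) fun x hx => ?_
  rw [Submodule.coe_smul, map_smul, LinearMap.smul_apply, P.form_corrector_apply ξ v hx,
    LinearMap.neg_apply, firstOrder_smul, smul_eq_mul, mul_neg]

theorem homForm_smul (t : ℝ) (ξ : EuclideanSpace ℝ (Fin n)) (v w : P.V₀) :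
    P.homForm (t • ξ) v w = (t : ℂ) ^ 2 * P.homForm ξ v w := by
  rw [homForm_apply, homForm_apply, secondOrder_smul, corrector_smul, corrector_smul]
  simp only [Submodule.coe_smul, map_smul, LinearMap.smul_apply, LinearMap.map_smulₛₗ,
    Complex.conj_ofReal, smul_eq_mul]
  ring

theorem homForm_self (ξ : EuclideanSpace ℝ (Fin n)) (v : P.V₀) :
    P.homForm ξ v v = P.secondOrder ξ v v + P.firstOrder ξ v (P.corrector ξ v) +
      (starRingEnd ℂ) (P.firstOrder ξ v (P.corrector ξ v)) +
      (P.a 0).form (P.corrector ξ v) (P.corrector ξ v) := by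
  have h := P.form_corrector_apply ξ v (P.corrector ξ v).2
  rw [homForm_apply, ← neg_eq_iff_eq_neg.2 h, map_neg, (P.a 0).conj_symm]
  ring

theorem tendsto_homForm (ξ : EuclideanSpace ℝ (Fin n)) (v : P.V₀) :
    Tendsto (fun t : ℝ => ((t : ℂ) ^ 2)⁻¹ * (P.a (t • ξ)).form
      (v + (t : ℂ) • (P.corrector ξ v : H)) (v + (t : ℂ) • (P.corrector ξ v : H)))
      (𝓝[>] 0) (𝓝 (P.homForm ξ v v)) := by
  have hfirst := P.tendsto_firstOrder ξ v (P.corrector ξ v)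
  have hsum := (((P.tendsto_secondOrder ξ v v).add hfirst).add
    ((Complex.continuous_conj.tendsto _).comp hfirst)).add
    (P.tendsto_form_smul ξ (P.corrector ξ v) (P.corrector ξ v))
  rw [homForm_self]
  refine hsum.congr' ?_
  filter_upwards [self_mem_nhdsWithin] with t (ht0 : 0 < t)
  have hne : (t : ℂ) ≠ 0 := Complex.ofReal_ne_zero.2 ht0.ne'
  simp only [Function.comp_apply, map_mul, map_inv₀, map_pow, Complex.conj_ofReal,
    NonnegForm.conj_symm, map_add, LinearMap.add_apply, map_smul, LinearMap.smul_apply,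
    LinearMap.map_smulₛₗ, smul_eq_mul]
  field_simp
  ring

theorem homForm_nonneg (ξ : EuclideanSpace ℝ (Fin n)) (v : P.V₀) : 0 ≤ P.homForm ξ v v := by
  refine ge_of_tendsto (P.tendsto_homForm ξ v) ?_
  filter_upwards [self_mem_nhdsWithin] with t (ht0 : 0 < t)
  refine mul_nonneg ?_ ((P.a _).nonneg _)
  exact_mod_cast (by positivity : (0 : ℝ) ≤ (t ^ 2)⁻¹)

theorem exists_homForm_re_le (ξ : EuclideanSpace ℝ (Fin n)) :
    ∃ C : ℝ, 0 ≤ C ∧ ∀ v : P.V₀, (P.homForm ξ v v).re ≤ C * ‖(v : H)‖ ^ 2 := by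
  obtain ⟨K, hK, hbound⟩ := P.exists_bound
  obtain ⟨M, hM, hn⟩ := P.norm_equiv
  obtain ⟨D, hD, hdiff⟩ := P.diff_two
  obtain ⟨t, hmem, ht0 : 0 < t⟩ := ((P.eventually_smul_mem ξ).and self_mem_nhdsWithin).exists
  refine ⟨(K + D * ‖t • ξ‖ ^ 3 * M ^ 2) / t ^ 2, by positivity, fun v => ?_⟩
  have hscale : t ^ 2 * (P.homForm ξ v v).re = (P.homForm (t • ξ) v v).re := by
    rw [homForm_smul, ← Complex.ofReal_pow, Complex.re_ofReal_mul]
  have hsecond : ‖P.secondOrder (t • ξ) v v‖ ≤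
      K * ‖(v : H)‖ * ‖(v : H)‖ + D * ‖t • ξ‖ ^ 3 * (M * ‖(v : H)‖) * (M * ‖(v : H)‖) := by
    refine (norm_le_norm_add_norm_sub ((P.a (t • ξ)).form v v) _).trans ?_
    refine add_le_add (hbound _ hmem v v).1 ((hdiff v v _ hmem).trans ?_)
    have := P.ip₀.norm_nonneg' v
    gcongr <;> exact (hn 0 P.zero_mem (v : H)).2
  rw [div_mul_eq_mul_div, le_div_iff₀' (by positivity), hscale, homForm_apply, Complex.sub_re]
  linarith [(P.a 0).re_nonneg (P.corrector (t • ξ) v),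
    Complex.re_le_norm (P.secondOrder (t • ξ) v v)]

theorem exists_mul_sq_le_homForm_re : ∃ c : ℝ, 0 < c ∧ ∀ (ξ : EuclideanSpace ℝ (Fin n)) (z : P.V₀),
    (z : H) ∈ P.Z → c * (‖ξ‖ * ‖(z : H)‖) ^ 2 ≤ (P.homForm ξ z z).re := by
  obtain ⟨C, hC, hZ⟩ := P.exists_norm_mul_norm_le
  refine ⟨(C ^ 2)⁻¹, by positivity, fun ξ z hz => ?_⟩
  set N : H := (P.corrector ξ z : H)
  have hlim : Tendsto (fun t : ℝ => C * (√(((t : ℂ) ^ 2)⁻¹ *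
      (P.a (t • ξ)).form (z + (t : ℂ) • N) (z + (t : ℂ) • N)).re +
        t * ‖ξ‖ ^ 2 * ‖(z : H) + (t : ℂ) • N‖ + t * ‖ξ‖ * ‖N‖)) (𝓝[>] 0)
      (𝓝 (C * √(P.homForm ξ z z).re)) := by
    have henergy := ((Real.continuous_sqrt.comp Complex.continuous_re).tendsto _).comp
      (P.tendsto_homForm ξ z)
    have hrest : Continuous fun t : ℝ =>
        t * ‖ξ‖ ^ 2 * ‖(z : H) + (t : ℂ) • N‖ + t * ‖ξ‖ * ‖N‖ := by fun_prop
    have hrest := (hrest.tendsto 0).mono_left (nhdsWithin_le_nhds (s := Set.Ioi 0))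
    simpa [← add_assoc] using (henergy.add hrest).const_mul C
  have hle : ‖ξ‖ * ‖(z : H)‖ ≤ C * √(P.homForm ξ z z).re := by
    refine ge_of_tendsto hlim ?_
    filter_upwards [P.eventually_smul_mem ξ, self_mem_nhdsWithin] with t ht (ht0 : 0 < t)
    have h := hZ _ ht z hz (z + (t : ℂ) • N)
    rw [sub_add_cancel_left, norm_neg, norm_smul, norm_smul, Complex.norm_real,
      Real.norm_of_nonneg ht0.le] at h
    rw [NonnegForm.sqrt_re_inv_sq_mul_form _ ht0]
    refine le_of_mul_le_mul_left ?_ ht0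
    refine (le_of_eq_of_le (by ring) h).trans_eq ?_
    field_simp
  rw [inv_mul_le_iff₀ (by positivity)]
  calc (‖ξ‖ * ‖(z : H)‖) ^ 2 ≤ (C * √(P.homForm ξ z z).re) ^ 2 := by gcongr
    _ = C ^ 2 * (P.homForm ξ z z).re := by
      rw [mul_pow, Real.sq_sqrt (Complex.nonneg_iff.1 (P.homForm_nonneg ξ z)).1]

end Complete

end DegenerateProblem

/-! ### The limit operators -/

namespace DegenerateProblem

variable {n : ℕ} {H 𝓗 : Type*} [NormedAddCommGroup H] [InnerProductSpace ℂ H]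
  [NormedAddCommGroup 𝓗] [InnerProductSpace ℂ 𝓗] (P : DegenerateProblem n H 𝓗)

theorem Vstar_le : P.Vstar ≤ P.V₀ := le_sup_left.trans P.sup_eq.le

theorem compactForm_comap {Q : Type*} [NormedAddCommGroup Q] [NormedSpace ℂ Q] (g : Q →L[ℂ] H)
    (hg : ∀ q, g q ∈ P.V₀) {c : ℝ} (hc : 0 < c) (hbelow : ∀ q, c * ‖q‖ ≤ ‖g q‖) :
    CompactForm (P.emb.toLinearMap ∘ₗ g.toLinearMap) ((P.b 0).comap g.toLinearMap) := by
  obtain ⟨M, hM, hn⟩ := P.norm_equiv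
  have hnorm : ∀ q, P.ip₀.norm (g q) ^ 2 = (((P.b 0).comap g.toLinearMap).form q q).re := by
    intro q
    have hnull : (P.a 0).form (g q) (g q) = 0 := hg q
    rw [NonnegForm.norm_sq]
    change ((P.a 0).form (g q) (g q) + (P.b 0).form (g q) (g q)).re = _
    rw [hnull, zero_add]
    rfl
  refine ⟨?_, P.emb_compact.comp_clm g, ⟨(M * ‖g‖) ^ 2, fun q => ?_⟩,
    (c / M) ^ 2, by positivity, fun q => ?_⟩
  · refine P.emb_injective.comp ((injective_iff_map_eq_zero g.toLinearMap).2 fun q hq => ?_)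
    have hq' : c * ‖q‖ ≤ 0 := (hbelow q).trans_eq (norm_eq_zero.2 hq)
    exact norm_le_zero_iff.1 (nonpos_of_mul_nonpos_right hq' hc)
  · rw [← hnorm, ← mul_pow, mul_assoc]
    have := P.ip₀.norm_nonneg' (g q)
    gcongr
    exact (hn 0 P.zero_mem (g q)).2.trans (by gcongr; exact g.le_opNorm q)
  · rw [← hnorm, ← mul_pow, div_mul_eq_mul_div]
    gcongr
    rw [div_le_iff₀' hM]
    exact (hbelow q).trans (hn 0 P.zero_mem (g q)).1

theorem compactForm_V₀ : CompactForm (P.emb.toLinearMap ∘ₗ P.V₀.subtype)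
    ((P.b 0).comap P.V₀.subtype) :=
  P.compactForm_comap P.V₀.subtypeL Subtype.property one_pos fun v => (one_mul ‖v‖).le

theorem compactForm_Vstar : CompactForm (P.emb.toLinearMap ∘ₗ P.Vstar.subtype)
    ((P.b 0).comap P.Vstar.subtype) :=
  P.compactForm_comap P.Vstar.subtypeL (fun v => P.Vstar_le v.2) one_pos fun v => (one_mul ‖v‖).le

/-- The form `b₀` on `V_⋆ ∔ Z`, with `v + z` encoded by the pair `(v, z)`. -/
def baseForm : NonnegForm (P.Vstar × P.Z) :=
  (P.b 0).comap (P.Vstar.subtype.coprod P.Z.subtype)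

theorem compactForm_baseForm : CompactForm P.sumMap P.baseForm := by
  obtain ⟨c, hc, hZ⟩ := P.exists_le_norm_sub_Vstar
  refine P.compactForm_comap (P.Vstar.subtypeL.coprod P.Z.subtypeL)
    (fun p => add_mem (P.Vstar_le p.1.2) (P.Z_le p.2.2)) (c := c / (1 + c)) (by positivity)
    fun p => ?_
  have hz : c * ‖p.2‖ ≤ ‖(p.1 : H) + p.2‖ := by
    simpa [add_comm] using hZ (-p.1) (neg_mem p.1.2) p.2 p.2.2
  have hv : ‖p.1‖ ≤ ‖(p.1 : H) + p.2‖ + ‖p.2‖ := norm_le_add_norm_add (p.1 : H) p.2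
  have hsum : 0 ≤ ‖(p.1 : H) + p.2‖ := norm_nonneg _
  change c / (1 + c) * max ‖p.1‖ ‖p.2‖ ≤ ‖(p.1 : H) + p.2‖
  rw [div_mul_eq_mul_div, div_le_iff₀ (by positivity), mul_max_of_nonneg _ _ hc.le]
  refine max_le ?_ ?_ <;> nlinarith

/-- The identification `(v, z) ↦ v + z` of `V_⋆ × Z` with `V₀`. -/
def sumEquiv : (P.Vstar × P.Z) ≃ₗ[ℂ] P.V₀ :=
  (LinearEquiv.ofInjective (P.Vstar.subtype.coprod P.Z.subtype)
    (Function.Injective.of_comp P.compactForm_baseForm.injective)).trans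
    (LinearEquiv.ofEq _ _ (by
      rw [LinearMap.range_coprod, Submodule.range_subtype, Submodule.range_subtype, P.sup_eq]))

theorem edim_V₀ : edim P.V₀ = edim P.Vstar + edim P.Z :=
  (edim_congr P.sumEquiv).symm.trans edim_prod

theorem baseForm_comap_inl :
    P.baseForm.comap (LinearMap.inl ℂ P.Vstar P.Z) = (P.b 0).comap P.Vstar.subtype := by
  rw [baseForm, NonnegForm.comap_comap, LinearMap.coprod_inl]

theorem sumMap_comp_inl : P.sumMap ∘ₗ LinearMap.inl ℂ P.Vstar P.Z =
    P.emb.toLinearMap ∘ₗ P.Vstar.subtype := by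
  rw [sumMap, LinearMap.comp_assoc, LinearMap.coprod_inl]

theorem compactForm_comp_inl : CompactForm (P.sumMap ∘ₗ LinearMap.inl ℂ P.Vstar P.Z)
    (P.baseForm.comap (LinearMap.inl ℂ P.Vstar P.Z)) := by
  rw [sumMap_comp_inl, baseForm_comap_inl]
  exact P.compactForm_Vstar

section Complete

variable [CompleteSpace H]

/-- The form `a^h_ξ` on the second summand of `V_⋆ ∔ Z`. -/
def defectForm (ξ : EuclideanSpace ℝ (Fin n)) : NonnegForm (P.Vstar × P.Z) :=
  NonnegForm.comap ⟨P.homForm ξ, P.homForm_nonneg ξ⟩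
    (Submodule.inclusion P.Z_le ∘ₗ LinearMap.snd ℂ P.Vstar P.Z)

theorem defectForm_inl (ξ : EuclideanSpace ℝ (Fin n)) (v : P.Vstar) (p : P.Vstar × P.Z) :
    (P.defectForm ξ).form (LinearMap.inl ℂ P.Vstar P.Z v) p = 0 := by
  change P.homForm ξ (Submodule.inclusion P.Z_le 0) _ = 0
  rw [map_zero, map_zero, LinearMap.zero_apply]

theorem limitForm_sqrt_smul (η : EuclideanSpace ℝ (Fin n)) (τ : NNReal) :
    P.limitForm (√(τ : ℝ) • η) = (P.baseForm.addSMul (P.defectForm η) τ).form := by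
  refine LinearMap.ext₂ fun p q => ?_
  change P.homForm _ _ _ + _ = _ + ((τ : ℝ) : ℂ) * P.homForm _ _ _
  rw [homForm_smul, ← Complex.ofReal_pow, Real.sq_sqrt τ.coe_nonneg, add_comm]
  rfl

theorem limitForm_zero : P.limitForm 0 = P.baseForm.form := by
  simpa [NonnegForm.addSMul_zero] using P.limitForm_sqrt_smul 0 0

theorem exists_defectForm_re_le (ξ : EuclideanSpace ℝ (Fin n)) : ∃ C : ℝ, 0 ≤ C ∧
    ∀ p, ((P.defectForm ξ).form p p).re ≤ C * (P.baseForm.form p p).re := by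
  obtain ⟨C, hC, hhom⟩ := P.exists_homForm_re_le ξ
  obtain ⟨c, hc, hbase⟩ := P.compactForm_baseForm.exists_le_form
  refine ⟨C / c, by positivity, fun p => ?_⟩
  calc ((P.defectForm ξ).form p p).re ≤ C * ‖p.2‖ ^ 2 := hhom _
    _ ≤ C * ‖p‖ ^ 2 := by gcongr; exact norm_snd_le p
    _ = C / c * (c * ‖p‖ ^ 2) := by field_simp
    _ ≤ C / c * (P.baseForm.form p p).re := by gcongr; exact hbase p

theorem isPenalty_defectForm {η : EuclideanSpace ℝ (Fin n)} (hη : η ≠ 0) :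
    IsPenalty (LinearMap.inl ℂ P.Vstar P.Z) (LinearMap.fst ℂ P.Vstar P.Z) P.baseForm
      (P.defectForm η) := by
  refine ⟨P.exists_defectForm_re_le η, ?_⟩
  obtain ⟨c, hc, hhom⟩ := P.exists_mul_sq_le_homForm_re
  obtain ⟨C, hbase⟩ := P.compactForm_baseForm.exists_form_le
  refine ⟨c * ‖η‖ ^ 2 / (|C| + 1), by positivity, fun p => ?_⟩
  have hsub : p - LinearMap.inl ℂ P.Vstar P.Z (LinearMap.fst ℂ P.Vstar P.Z p) = (0, p.2) := by
    simp [Prod.ext_iff]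
  have hform : (P.baseForm.form (0, p.2) (0, p.2)).re ≤ (|C| + 1) * ‖p.2‖ ^ 2 := by
    refine (hbase (0, p.2)).trans ?_
    rw [Prod.norm_mk, norm_zero, max_eq_right (norm_nonneg _)]
    gcongr
    exact (le_abs_self C).trans (lt_add_one |C|).le
  rw [hsub]
  calc c * ‖η‖ ^ 2 / (|C| + 1) * (P.baseForm.form (0, p.2) (0, p.2)).re
      ≤ c * ‖η‖ ^ 2 / (|C| + 1) * ((|C| + 1) * ‖p.2‖ ^ 2) := by gcongr
    _ = c * (‖η‖ * ‖p.2‖) ^ 2 := by field_simp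
    _ ≤ ((P.defectForm η).form p p).re := hhom η (Submodule.inclusion P.Z_le p.2) p.2.2

theorem compactForm_limitForm (η : EuclideanSpace ℝ (Fin n)) (τ : NNReal) :
    CompactForm P.sumMap (P.baseForm.addSMul (P.defectForm η) τ) :=
  let ⟨_, hC, hle⟩ := P.exists_defectForm_re_le η
  P.compactForm_baseForm.addSMul hC hle τ

instance : CompleteSpace P.Vstar := P.isClosed_Vstar.completeSpace_coe

instance : CompleteSpace P.Z := P.isClosed_Z.completeSpace_coe

instance : CompleteSpace P.V₀ := (P.isClosed_nullSpace P.zero_mem).completeSpace_coe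

variable [CompleteSpace 𝓗]

theorem mem_opSpectrum_limitOp_iff (η : EuclideanSpace ℝ (Fin n)) (τ : NNReal) {μ : ℂ} :
    μ ∈ opSpectrum (P.limitOp (√(τ : ℝ) • η)) ↔ ∃ k : ℕ, (k : ℕ∞) < edim (P.Vstar × P.Z) ∧
      (minimaxValue P.sumMap (P.baseForm.addSMul (P.defectForm η) τ) k : ℂ) = μ := by
  rw [limitOp, limitForm_sqrt_smul]
  exact (P.compactForm_limitForm η τ).mem_opSpectrum_iff

theorem limitSpectrum_subset : P.limitSpectrum ⊆
    Complex.ofReal '' spectralBands P.sumMap P.baseForm (LinearMap.inl ℂ P.Vstar P.Z) := by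
  refine closure_minimal (Set.iUnion_subset fun ξ μ hμ => ?_)
    (Complex.isometry_ofReal.isClosedEmbedding.isClosedMap _
      P.compactForm_baseForm.isClosed_spectralBands)
  rw [← one_smul ℝ ξ, ← Real.sqrt_one, ← NNReal.coe_one, mem_opSpectrum_limitOp_iff] at hμ
  obtain ⟨k, hk, rfl⟩ := hμ
  refine ⟨_, P.compactForm_baseForm.minimaxValue_mem_spectralBands (P.compactForm_limitForm ξ 1)
    P.compactForm_comp_inl LinearMap.inl_injective (fun p => ?_) (fun v => ?_) hk, rfl⟩
  · rw [NonnegForm.addSMul_apply_re]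
    exact le_add_of_nonneg_right (mul_nonneg NNReal.zero_le_coe (NonnegForm.re_nonneg _ p))
  · rw [NonnegForm.addSMul_apply_re, defectForm_inl, Complex.zero_re, mul_zero, add_zero]

theorem subset_limitSpectrum (hn : 1 ≤ n) :
    Complex.ofReal '' spectralBands P.sumMap P.baseForm (LinearMap.inl ℂ P.Vstar P.Z) ⊆
      P.limitSpectrum := by
  have : Nonempty (Fin n) := ⟨⟨0, hn⟩⟩
  obtain ⟨η, hη⟩ := exists_ne (0 : EuclideanSpace ℝ (Fin n))
  refine (Set.image_mono ((P.isPenalty_defectForm hη).spectralBands_subset_closure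
    P.compactForm_baseForm P.compactForm_comp_inl)).trans
    ((image_closure_subset_closure_image Complex.continuous_ofReal).trans (closure_mono ?_))
  rintro _ ⟨_, ⟨τ, k, hk, rfl⟩, rfl⟩
  exact Set.mem_iUnion_of_mem _ ((P.mem_opSpectrum_limitOp_iff η τ).2 ⟨k, hk, rfl⟩)

theorem limitSpectrum_eq_image_spectralBands (hn : 1 ≤ n) : P.limitSpectrum =
    Complex.ofReal '' spectralBands P.sumMap P.baseForm (LinearMap.inl ℂ P.Vstar P.Z) :=
  P.limitSpectrum_subset.antisymm (P.subset_limitSpectrum hn)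

end Complete

theorem isEigenvalueList_limitOp_zero_iff [CompleteSpace H] {N : ℕ∞} {ev : ℕ → ℝ} :
    IsEigenvalueList (P.limitOp 0) N ev ↔ IsEigenvalueList P.B₀ N ev := by
  rw [limitOp, limitForm_zero]
  exact isEigenvalueList_formOperator_comp_equiv P.compactForm_V₀.injective
    ((P.b 0).comap P.V₀.subtype) P.sumEquiv

section Complete

variable [CompleteSpace H] [CompleteSpace 𝓗]

theorem exists_isEigenvalueList_B₀ : ∃ ev, IsEigenvalueList P.B₀ (edim P.V₀) ev :=
  P.compactForm_V₀.exists_isEigenvalueList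

theorem exists_isEigenvalueList_Bstar : ∃ ev, IsEigenvalueList P.Bstar (edim P.Vstar) ev :=
  P.compactForm_Vstar.exists_isEigenvalueList

variable {P} {ev₀ evs : ℕ → ℝ}

theorem eigenvalue_eq_minimaxValue_sumMap (h₀ : IsEigenvalueList P.B₀ (edim P.V₀) ev₀) {k : ℕ}
    (hk : (k : ℕ∞) < edim P.V₀) : ev₀ k = minimaxValue P.sumMap P.baseForm k := by
  have h := P.isEigenvalueList_limitOp_zero_iff.2 h₀
  rw [limitOp, limitForm_zero, ← edim_congr P.sumEquiv] at h
  exact h.eq_minimaxValue P.compactForm_baseForm (by rwa [edim_congr P.sumEquiv])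

theorem eigenvalue_eq_minimaxValue_comp_inl (hs : IsEigenvalueList P.Bstar (edim P.Vstar) evs)
    {k : ℕ} (hk : (k : ℕ∞) < edim P.Vstar) : evs k =
      minimaxValue (P.sumMap ∘ₗ LinearMap.inl ℂ P.Vstar P.Z)
        (P.baseForm.comap (LinearMap.inl ℂ P.Vstar P.Z)) k := by
  rw [sumMap_comp_inl, baseForm_comap_inl]
  exact IsEigenvalueList.eq_minimaxValue (s := (P.b 0).comap P.Vstar.subtype) hs
    P.compactForm_Vstar hk

theorem eigenvalue_le (h₀ : IsEigenvalueList P.B₀ (edim P.V₀) ev₀)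
    (hs : IsEigenvalueList P.Bstar (edim P.Vstar) evs) {k : ℕ} (hk : (k : ℕ∞) < edim P.Vstar) :
    ev₀ k ≤ evs k := by
  rw [eigenvalue_eq_minimaxValue_sumMap h₀ (hk.trans_le (edim_mono P.Vstar_le)),
    eigenvalue_eq_minimaxValue_comp_inl hs hk]
  exact P.compactForm_comp_inl.minimaxValue_le_of_form_le P.compactForm_baseForm
    LinearMap.inl_injective (fun _ => rfl) (fun _ => le_rfl) hk

theorem limitSpectrum_eq_image_setOf (hn : 1 ≤ n) (h₀ : IsEigenvalueList P.B₀ (edim P.V₀) ev₀)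
    (hs : IsEigenvalueList P.Bstar (edim P.Vstar) evs) :
    P.limitSpectrum = Complex.ofReal '' {r | ∃ k : ℕ, (k : ℕ∞) < edim P.V₀ ∧ ev₀ k ≤ r ∧
      ((k : ℕ∞) < edim P.Vstar → r ≤ evs k)} := by
  rw [P.limitSpectrum_eq_image_spectralBands hn, spectralBands, edim_congr P.sumEquiv]
  congr 1
  ext r
  refine exists_congr fun k => and_congr_right fun hk => ?_
  rw [eigenvalue_eq_minimaxValue_sumMap h₀ hk]
  refine and_congr_right fun _ => forall_congr' fun hkV => ?_
  rw [eigenvalue_eq_minimaxValue_comp_inl hs hkV]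

theorem limitSpectrum_eq_iUnion_Icc (hn : 1 ≤ n) (h₀ : IsEigenvalueList P.B₀ (edim P.V₀) ev₀)
    (hs : IsEigenvalueList P.Bstar (edim P.Vstar) evs) (htop : edim P.Vstar = ⊤) :
    P.limitSpectrum = Complex.ofReal '' ⋃ k : ℕ, Set.Icc (ev₀ k) (evs k) := by
  rw [limitSpectrum_eq_image_setOf hn h₀ hs, edim_V₀, htop, top_add]
  congr 1
  ext r
  simp only [ENat.natCast_lt_top, true_and, forall_const, Set.mem_ofPred_eq, Set.mem_iUnion,
    Set.mem_Icc]

theorem limitSpectrum_eq_iUnion_Icc_union_Ici (hn : 1 ≤ n)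
    (h₀ : IsEigenvalueList P.B₀ (edim P.V₀) ev₀)
    (hs : IsEigenvalueList P.Bstar (edim P.Vstar) evs) (hZ : P.Z ≠ ⊥) {N : ℕ}
    (hN : edim P.Vstar = N) : P.limitSpectrum = Complex.ofReal ''
      ((⋃ k ∈ Set.Iio N, Set.Icc (ev₀ k) (evs k)) ∪ Set.Ici (ev₀ N)) := by
  have hNV : (N : ℕ∞) < edim P.V₀ := by
    rw [edim_V₀, hN, ← ENat.add_one_le_iff (ENat.natCast_ne_top N)]
    gcongr
    exact one_le_edim_iff.2 ((Submodule.nontrivial_iff_ne_bot).2 hZ)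
  rw [limitSpectrum_eq_image_setOf hn h₀ hs, hN]
  congr 1
  ext r
  simp only [Nat.cast_lt, Set.mem_ofPred_eq, Set.mem_union, Set.mem_iUnion, Set.mem_Iio,
    Set.mem_Icc, Set.mem_Ici, exists_prop]
  constructor
  · rintro ⟨k, hk, hkr, hrk⟩
    rcases lt_or_ge k N with hkN | hNk
    · exact .inl ⟨k, hkN, hkr, hrk hkN⟩
    · exact .inr ((h₀.mono N k hNk hk).trans hkr)
  · rintro (⟨k, hkN, hkr, hrk⟩ | hNr)
    · exact ⟨k, (Nat.cast_lt.2 hkN).trans hNV, hkr, fun _ => hrk⟩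
    · exact ⟨N, hNV, hNr, fun h => (lt_irrefl N h).elim⟩

end Complete

end DegenerateProblem

/-! ### The `β`-function -/

namespace DegenerateProblem

variable {n : ℕ} {H 𝓗 : Type*} [NormedAddCommGroup H] [InnerProductSpace ℂ H]
  [NormedAddCommGroup 𝓗] [InnerProductSpace ℂ 𝓗] [CompleteSpace 𝓗] {P : DegenerateProblem n H 𝓗}
  {lam : ℝ}

theorem exists_forall_form_sub_eq (hlam : (lam : ℂ) ∉ opSpectrum P.Bstar) (z : P.Z) :
    ∃ u : P.Vstar,
      P.emb u = opResolvent P.Bstar lam (P.Vbar.orthogonalProjectionOnto (P.emb z)) ∧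
      ∀ v : P.Vstar, (P.b 0).form u v - lam * ⟪P.emb v, P.emb u⟫_ℂ = ⟪P.emb v, P.emb z⟫_ℂ := by
  obtain ⟨u, hu, hform⟩ := IsResolventAt.exists_forall_shiftedForm_eq
    (s := (P.b 0).comap P.Vstar.subtype) (isResolventAt_opResolvent hlam)
    P.compactForm_Vstar.injective (P.Vbar.orthogonalProjectionOnto (P.emb z))
  exact ⟨u, hu, fun v => (hform v).trans <|
    Submodule.inner_orthogonalProjectionOnto_eq_of_mem_left
      (⟨P.emb v, Submodule.le_topologicalClosure _ ⟨v, rfl⟩⟩ : P.Vbar) (P.emb z)⟩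

theorem inner_betaOp_toZbar (z : P.Z) :
    ⟪P.toZbar z, P.betaOp lam (P.toZbar z)⟫_ℂ =
      lam * ⟪P.emb z, P.emb z⟫_ℂ + ((lam : ℂ) - 1) ^ 2 *
        ⟪P.emb z, opResolvent P.Bstar lam (P.Vbar.orthogonalProjectionOnto (P.emb z))⟫_ℂ := by
  rw [betaOp, add_apply, inner_add_right, smul_apply,
    smul_apply, inner_smul_right, inner_smul_right]
  congr 2
  exact Submodule.inner_orthogonalProjectionOnto_eq_of_mem_left (P.toZbar z) _

/-- `-β_λ` is the Schur complement of `b₀ - λ d₀` with respect to `V_⋆`. -/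
theorem exists_betaForm_eq_neg_shiftedForm
    (horth : ∀ z ∈ P.Z, ∀ v ∈ P.Vstar, (P.b 0).form z v = ⟪P.emb v, P.emb z⟫_ℂ)
    (hlam : (lam : ℂ) ∉ opSpectrum P.Bstar) (z : P.Z) :
    ∃ v : P.Vstar, (∀ v', shiftedForm P.sumMap P.baseForm lam (v, z)
        (LinearMap.inl ℂ P.Vstar P.Z v') = 0) ∧
      P.betaForm lam z z = -shiftedForm P.sumMap P.baseForm lam (v, z) (v, z) := by
  obtain ⟨u, hu, hform⟩ := exists_forall_form_sub_eq hlam z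
  have hort : ∀ v', shiftedForm P.sumMap P.baseForm lam (((lam : ℂ) - 1) • u, z)
      (LinearMap.inl ℂ P.Vstar P.Z v') = 0 := fun v' => by
    change (P.b 0).form (((lam : ℂ) - 1) • (u : H) + z) (v' + (0 : H)) -
      lam * ⟪P.emb (v' + (0 : H)), P.emb (((lam : ℂ) - 1) • (u : H) + z)⟫_ℂ = 0
    simp only [add_zero, map_add, map_smul, LinearMap.add_apply, LinearMap.smul_apply, smul_eq_mul,
      inner_add_right, inner_smul_right, horth z z.2 v' v'.2]
    linear_combination ((lam : ℂ) - 1) * hform v'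
  have hsplit : ((((lam : ℂ) - 1) • u, z) : P.Vstar × P.Z) =
      LinearMap.inl ℂ P.Vstar P.Z (((lam : ℂ) - 1) • u) + (0, z) := by simp
  have huz : (P.b 0).form u z = ⟪P.emb z, P.emb u⟫_ℂ := by
    rw [← NonnegForm.conj_symm, horth z z.2 u u.2, inner_conj_symm]
  refine ⟨((lam : ℂ) - 1) • u, hort, ?_⟩
  nth_rw 2 [hsplit]
  rw [map_add, hort, zero_add, betaForm, inner_betaOp_toZbar, ← hu]
  change _ = -((P.b 0).form (((lam : ℂ) - 1) • (u : H) + z) ((0 : H) + z) -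
      lam * ⟪P.emb ((0 : H) + z), P.emb (((lam : ℂ) - 1) • (u : H) + z)⟫_ℂ)
  simp only [zero_add, map_add, map_smul, LinearMap.add_apply, LinearMap.smul_apply, smul_eq_mul,
    inner_add_right, inner_smul_right, huz]
  ring

variable [CompleteSpace H]

theorem mem_opSpectrum_Bstar_iff :
    (lam : ℂ) ∈ opSpectrum P.Bstar ↔ ∃ k : ℕ, (k : ℕ∞) < edim P.Vstar ∧
      minimaxValue (P.sumMap ∘ₗ LinearMap.inl ℂ P.Vstar P.Z)
        (P.baseForm.comap (LinearMap.inl ℂ P.Vstar P.Z)) k = lam := by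
  rw [sumMap_comp_inl, baseForm_comap_inl]
  exact (CompactForm.mem_opSpectrum_iff P.compactForm_Vstar).trans
    (by simp only [Complex.ofReal_inj])

theorem mem_spectralBands_iff
    (horth : ∀ z ∈ P.Z, ∀ v ∈ P.Vstar, (P.b 0).form z v = ⟪P.emb v, P.emb z⟫_ℂ)
    (hlam : (lam : ℂ) ∉ opSpectrum P.Bstar) :
    lam ∈ spectralBands P.sumMap P.baseForm (LinearMap.inl ℂ P.Vstar P.Z) ↔
      ∃ z : P.Z, z ≠ 0 ∧ 0 ≤ P.betaForm lam z z := by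
  have hsign : ∀ p, 0 ≤ -shiftedForm P.sumMap P.baseForm lam p p ↔
      (shiftedForm P.sumMap P.baseForm lam p p).re ≤ 0 := fun p => by
    rw [Complex.nonneg_iff, Complex.neg_im, shiftedForm_self_im, Complex.neg_re]
    simp
  constructor
  · intro hmem
    obtain ⟨w, hw, hneg⟩ := P.compactForm_baseForm.exists_shiftedForm_nonpos
      P.compactForm_comp_inl (fun k hk h => hlam (mem_opSpectrum_Bstar_iff.2 ⟨k, hk, h⟩)) hmem
    obtain ⟨v, hort, hβ⟩ := exists_betaForm_eq_neg_shiftedForm horth hlam w.2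
    have hshift : w + LinearMap.inl ℂ P.Vstar P.Z (v - w.1) = (v, w.2) := by
      simp [Prod.ext_iff]
    have h := hneg (v - w.1)
    rw [hshift] at h
    refine ⟨w.2, fun h0 => hw ⟨w.1, Prod.ext rfl h0.symm⟩, ?_⟩
    rw [hβ, hsign]
    exact h hort
  · rintro ⟨z, hz, hnonneg⟩
    obtain ⟨v, hort, hβ⟩ := exists_betaForm_eq_neg_shiftedForm horth hlam z
    refine P.compactForm_baseForm.mem_spectralBands_of_shiftedForm_nonpos P.compactForm_comp_inl
      LinearMap.inl_injective ?_ hort ((hsign _).1 (hβ ▸ hnonneg))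
    rintro ⟨v', hv'⟩
    exact hz (congrArg Prod.snd hv').symm

theorem mem_spectralBands_of_mem_opSpectrum (hlam : (lam : ℂ) ∈ opSpectrum P.Bstar) :
    lam ∈ spectralBands P.sumMap P.baseForm (LinearMap.inl ℂ P.Vstar P.Z) := by
  obtain ⟨k, hk, rfl⟩ := mem_opSpectrum_Bstar_iff.1 hlam
  have hinl := LinearMap.inl_injective (R := ℂ) (M := P.Vstar) (M₂ := P.Z)
  exact ⟨k, hk.trans_le (edim_le_of_injective hinl),
    P.compactForm_comp_inl.minimaxValue_le_of_form_le P.compactForm_baseForm hinl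
      (fun _ => rfl) (fun _ => le_rfl) hk, fun _ => le_rfl⟩

theorem limitSpectrum_eq_image_setOf_betaForm (hn : 1 ≤ n)
    (horth : ∀ z ∈ P.Z, ∀ v ∈ P.Vstar, (P.b 0).form z v = ⟪P.emb v, P.emb z⟫_ℂ) :
    P.limitSpectrum = Complex.ofReal '' {lam : ℝ | (lam : ℂ) ∉ opSpectrum P.Bstar ∧
      ∃ z : P.Z, z ≠ 0 ∧ 0 ≤ P.betaForm lam z z} ∪ opSpectrum P.Bstar := by
  rw [P.limitSpectrum_eq_image_spectralBands hn]
  ext μ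
  constructor
  · rintro ⟨lam, hlam, rfl⟩
    by_cases hspec : (lam : ℂ) ∈ opSpectrum P.Bstar
    · exact .inr hspec
    · exact .inl ⟨lam, ⟨hspec, (mem_spectralBands_iff horth hspec).1 hlam⟩, rfl⟩
  · rintro (⟨lam, ⟨hspec, hβ⟩, rfl⟩ | hspec)
    · exact ⟨lam, (mem_spectralBands_iff horth hspec).2 hβ, rfl⟩
    · obtain ⟨k, -, rfl⟩ := (CompactForm.mem_opSpectrum_iff P.compactForm_Vstar).1 hspec
      exact ⟨_, mem_spectralBands_of_mem_opSpectrum hspec, rfl⟩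

end DegenerateProblem

end

theorem mainTheorem5 {n : ℕ} (hn : 1 ≤ n) {H 𝓗 : Type*}
    [NormedAddCommGroup H] [InnerProductSpace ℂ H] [CompleteSpace H]
    [TopologicalSpace.SeparableSpace H]
    [NormedAddCommGroup 𝓗] [InnerProductSpace ℂ 𝓗] [CompleteSpace 𝓗]
    [TopologicalSpace.SeparableSpace 𝓗]
    (P : DegenerateProblem n H 𝓗) :
    -- the eigenvalues can be listed
    (∃ ev₀ : ℕ → ℝ, IsEigenvalueList P.B₀ (edim P.V₀) ev₀) ∧
    (∃ evs : ℕ → ℝ, IsEigenvalueList P.Bstar (edim P.Vstar) evs) ∧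
    -- the band representation
    (∀ ev₀ evs : ℕ → ℝ, IsEigenvalueList P.B₀ (edim P.V₀) ev₀ →
      IsEigenvalueList P.Bstar (edim P.Vstar) evs →
      IsEigenvalueList (P.limitOp 0) (edim P.V₀) ev₀ ∧
      (∀ k : ℕ, (k : ℕ∞) < edim P.Vstar → ev₀ k ≤ evs k) ∧
      (P.Z ≠ ⊥ →
        (edim P.Vstar = ⊤ →
          P.limitSpectrum = Complex.ofReal '' ⋃ k : ℕ, Set.Icc (ev₀ k) (evs k)) ∧
        (∀ N : ℕ, edim P.Vstar = N →
          P.limitSpectrum = Complex.ofReal ''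
            ((⋃ k ∈ Set.Iio N, Set.Icc (ev₀ k) (evs k)) ∪ Set.Ici (ev₀ N))))) ∧
    -- the representation through the β-function
    ((∀ z ∈ P.Z, ∀ v ∈ P.Vstar, (P.b 0).form z v = inner ℂ (P.emb v) (P.emb z)) →
      P.limitSpectrum =
        Complex.ofReal '' {lam : ℝ | (lam : ℂ) ∉ opSpectrum P.Bstar ∧
          ∃ z : P.Z, z ≠ 0 ∧ 0 ≤ P.betaForm lam z z} ∪ opSpectrum P.Bstar) := by
  refine ⟨P.exists_isEigenvalueList_B₀, P.exists_isEigenvalueList_Bstar, fun ev₀ evs h₀ hs => ?_,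
    DegenerateProblem.limitSpectrum_eq_image_setOf_betaForm hn⟩
  refine ⟨P.isEigenvalueList_limitOp_zero_iff.2 h₀,
    fun _ hk => DegenerateProblem.eigenvalue_le h₀ hs hk, fun hZ => ⟨?_, fun N hN => ?_⟩⟩
  · exact DegenerateProblem.limitSpectrum_eq_iUnion_Icc hn h₀ hs
  · exact DegenerateProblem.limitSpectrum_eq_iUnion_Icc_union_Ici hn h₀ hs hZ hN
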